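/- Let $n\ge 1$, $0<T<\infty$, and let $m:\mathbb R^n\setminus\{0\}\to\mathbb C^n$ be a symbol of order zero, i.e. $m$ is $C^\infty$ and for every $k\ge 0$ there is $C_k$ with $|D^k m(\xi)|\le C_k|\xi|^{-k}$ for all $\xi\ne 0$. Consider on $(0,T)\times\mathbb R^n$ the inviscid active scalar equation $$\partial_t\theta+u\cdot\nabla\theta=0,\qquad \operatorname{div}u=0,\qquad \hat u(\xi,t)=m(\xi)\,\hat\theta(\xi,t),\qquad \theta(\cdot,0)=\theta_0,$$ with $\theta,u$ real-valued and $\theta_0\in L^1_{loc}(\mathbb R^n)$. A pair $(\theta,u)$, square integrable on $(0,T)\times K$ for every compact $K\subset\mathbb R^n$, is a weak solution with initial datum $\theta_0$ if, for almost every $t\in(0,T)$, $\theta(t),u(t)\in L^2(\mathbb R^n)$, $\operatorname{div}u(t)=0$ in the sense of distributions and $\hat u(t)=m\,\hat\theta(t)$, and if $$\int_0^T\!\!\int_{\mathbb R^n}\theta\,(\partial_t\phi+u\cdot\nabla\phi)\,dx\,dt+\int_{\mathbb R^n}\theta_0(x)\,\phi(0,x)\,dx=0\qquad\text{for all }\phi\in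 C_c^\infty((-\infty,T)\times\mathbb R^n).$$ Let $p,q\in(2,\infty)$ and $s\in(\tfrac{q}{q-2},\infty]$. Let $(\theta_1,u_1)$ and $(\theta_2,u_2)$ be two weak solutions with the same initial datum $\theta_0$ such that, for $i=1,2$, $$\theta_i\in L^\infty((0,T),L^2(\mathbb R^n))\cap L^q((0,T),L^p(\mathbb R^n)),$$ and $\nabla\theta_i=g_i+b_i$ (weak gradient in $x$, for a.e. $t$), where $g_i\in L^1((0,T),L^\infty(\mathbb R^n))$, $b_i\in L^s((0,T),BMO)$ and the support $\{x: b_i(t,x)\neq0\}$ has finite measure for a.e. $t\in(0,T)$. Here $\|f\|_{BMO}=\|M^\# f\|_{L^\infty}$ with $M^\# f(x)=\sup_{Q\ni x}\frac1{|Q|}\int_Q|f-f_Q|$, the supremum being over all cubes $Q$ containing $x$ and $f_Q$ the average of $f$ on $Q$, and $BMO$ is the set of $f\in L^1_{loc}$ with $\|f\|_{BMO}<\infty$. Then $\theta_1=\theta_2$ and $u_1=u_2$ almost everywhere on $(0,T)\times\mathbb R^n$. -/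

import Mathlib

open MeasureTheory Set
open scoped ENNReal ContDiff FourierTransform

noncomputable section

namespace ActiveScalar

/-- The Euclidean space `ℝⁿ`. -/
abbrev E (n : ℕ) : Type := EuclideanSpace ℝ (Fin n)

/-! ### Bounded mean oscillation -/

/-- The closed axis-parallel cube with centre `c` and side length `2 * r`. -/
def cube {n : ℕ} (c : E n) (r : ℝ) : Set (E n) := {x | ∀ i, |x i - c i| ≤ r}

/-- The sharp maximal function
`M^# f (x) = sup_{Q ∋ x} |Q|⁻¹ ∫_Q |f(y) - f_Q| dy`, the supremum being over all cubes `Q`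
containing `x`, where `f_Q` is the average of `f` on `Q`. -/
def sharpMaximal {n : ℕ} {F : Type*} [NormedAddCommGroup F] [NormedSpace ℝ F]
    (f : E n → F) (x : E n) : ℝ≥0∞ :=
  ⨆ (c : E n) (r : ℝ) (_ : 0 < r) (_ : x ∈ cube c r),
    (volume (cube c r))⁻¹ * ∫⁻ y in cube c r, ‖f y - ⨍ z in cube c r, f z‖ₑ

/-- `‖f‖_BMO = ‖M^# f‖_{L^∞}`. -/
def bmoNorm {n : ℕ} {F : Type*} [NormedAddCommGroup F] [NormedSpace ℝ F]
    (f : E n → F) : ℝ≥0∞ :=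
  eLpNorm (sharpMaximal f) ⊤ volume

/-- `f ∈ BMO`: `f` is locally integrable and `M^# f` is bounded. -/
def MemBMO {n : ℕ} {F : Type*} [NormedAddCommGroup F] [NormedSpace ℝ F]
    (f : E n → F) : Prop :=
  LocallyIntegrable f volume ∧ bmoNorm f < ⊤

/-! ### Spaces of functions of time and space

Functions of time and space are written `f t x` with `t` the time. -/

/-- `f ∈ L^q((0,T), L^p(ℝⁿ))`: `f` is measurable on `(0,T) × ℝⁿ` and
`t ↦ ‖f(t)‖_{L^p}` has finite `L^q(0,T)` norm. -/
def MemLqLp {n : ℕ} {F : Type*} [NormedAddCommGroup F]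
    (T : ℝ) (q p : ℝ≥0∞) (f : ℝ → E n → F) : Prop :=
  AEStronglyMeasurable (Function.uncurry f) ((volume.restrict (Ioo 0 T)).prod volume) ∧
    eLpNorm (fun t => eLpNorm (f t) p volume) q (volume.restrict (Ioo 0 T)) < ⊤

/-- `f ∈ L^s((0,T), BMO)`: `f` is measurable on `(0,T) × ℝⁿ`, `f(t) ∈ BMO` for almost every `t`,
and `t ↦ ‖f(t)‖_BMO` has finite `L^s(0,T)` norm. -/
def MemLsBMO {n : ℕ} {F : Type*} [NormedAddCommGroup F] [NormedSpace ℝ F]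
    (T : ℝ) (s : ℝ≥0∞) (f : ℝ → E n → F) : Prop :=
  AEStronglyMeasurable (Function.uncurry f) ((volume.restrict (Ioo 0 T)).prod volume) ∧
    (∀ᵐ t ∂(volume.restrict (Ioo 0 T)), MemBMO (f t)) ∧
    eLpNorm (fun t => bmoNorm (f t)) s (volume.restrict (Ioo 0 T)) < ⊤

/-- `f ∈ L²((0,T) × K)` for every compact `K ⊆ ℝⁿ`. -/
def MemL2Loc {n : ℕ} {F : Type*} [NormedAddCommGroup F]
    (T : ℝ) (f : ℝ → E n → F) : Prop :=
  ∀ K : Set (E n), IsCompact K →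
    MemLp (Function.uncurry f) 2 ((volume.restrict (Ioo 0 T)).prod (volume.restrict K))

/-! ### Weak derivatives in space -/

/-- `G` is the weak (distributional) gradient of `f` on `ℝⁿ`. -/
def HasWeakGradient {n : ℕ} (f : E n → ℝ) (G : E n → E n) : Prop :=
  LocallyIntegrable f volume ∧ LocallyIntegrable G volume ∧
    ∀ φ : E n → ℝ, ContDiff ℝ ∞ φ → HasCompactSupport φ → ∀ i : Fin n,
      ∫ x, f x * fderiv ℝ φ x (EuclideanSpace.single i 1) = -∫ x, G x i * φ x

/-- `div v = 0` in the sense of distributions on `ℝⁿ`. -/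
def WeakDivFree {n : ℕ} (v : E n → E n) : Prop :=
  LocallyIntegrable v volume ∧
    ∀ φ : E n → ℝ, ContDiff ℝ ∞ φ → HasCompactSupport φ →
      ∫ x, fderiv ℝ φ x (v x) = 0

/-! ### The drift velocity -/

/-- A (vector-valued) Fourier symbol of order zero, as for Calderón-Zygmund operators: `m` is
smooth away from the origin and `|∂^k m(ξ)| ≤ C_k |ξ|^{-k}` for every order `k`. -/
def IsOrderZeroSymbol {n : ℕ} (m : E n → EuclideanSpace ℂ (Fin n)) : Prop :=
  ContDiffOn ℝ ∞ m {0}ᶜ ∧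
    ∀ k : ℕ, ∃ C : ℝ, ∀ ξ : E n, ξ ≠ 0 → ‖iteratedFDeriv ℝ k m ξ‖ ≤ C * (‖ξ‖ ^ k)⁻¹

/-- `v̂(ξ) = m(ξ) f̂(ξ)` for real `f ∈ L²(ℝⁿ)` and a real vector field `v ∈ L²(ℝⁿ)`; `𝓕` is the
Fourier transform on `L²(ℝⁿ)`. -/
def IsMultiplierImage {n : ℕ} (m : E n → EuclideanSpace ℂ (Fin n))
    (f : E n → ℝ) (v : E n → E n) : Prop :=
  ∃ hf : MemLp (fun x => (f x : ℂ)) 2 volume, ∀ j : Fin n,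
    ∃ hv : MemLp (fun x => (v x j : ℂ)) 2 volume,
      (𝓕 (hv.toLp _) : Lp ℂ 2 (volume : Measure (E n))) =ᵐ[volume]
        fun ξ => m ξ j * (𝓕 (hf.toLp _) : Lp ℂ 2 (volume : Measure (E n))) ξ

/-! ### Weak solutions and the uniqueness class -/

/-- `(θ, u)` is a weak solution on `(0,T) × ℝⁿ` of `∂_t θ + u · ∇θ = 0`, `div u = 0`,
`û = m θ̂`, with initial datum `θ₀`. -/
structure IsWeakSolution {n : ℕ} (m : E n → EuclideanSpace ℂ (Fin n)) (T : ℝ)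
    (θ₀ : E n → ℝ) (θ : ℝ → E n → ℝ) (u : ℝ → E n → E n) : Prop where
  locallyIntegrable_init : LocallyIntegrable θ₀ volume
  memL2Loc_scalar : MemL2Loc T θ
  memL2Loc_drift : MemL2Loc T u
  drift_eq : ∀ᵐ t ∂(volume.restrict (Ioo 0 T)), IsMultiplierImage m (θ t) (u t)
  div_free : ∀ᵐ t ∂(volume.restrict (Ioo 0 T)), WeakDivFree (u t)
  /-- `∫_0^T ∫ θ (∂_t φ + u · ∇φ) dx dt + ∫ θ₀ φ(0) dx = 0` for every smooth `φ` with compact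
  support in `(-∞, T) × ℝⁿ`. -/
  weak_eq : ∀ φ : ℝ × E n → ℝ, ContDiff ℝ ∞ φ → HasCompactSupport φ →
    tsupport φ ⊆ Iio T ×ˢ univ →
      (∫ t in Ioo 0 T, ∫ x,
          θ t x * (fderiv ℝ φ (t, x) (1, 0) + fderiv ℝ φ (t, x) (0, u t x)))
        + ∫ x, θ₀ x * φ (0, x) = 0

/-- `θ ∈ L^∞((0,T), L²) ∩ L^q((0,T), L^p)` and `∇θ = g + b` with `g ∈ L¹((0,T), L^∞)` and
`b ∈ L^s((0,T), BMO)`, where `b(t)` is supported on a set of finite measure for almost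
every `t`. -/
def InUniquenessClass {n : ℕ} (T : ℝ) (p q s : ℝ≥0∞) (θ : ℝ → E n → ℝ) : Prop :=
  MemLqLp T ⊤ 2 θ ∧ MemLqLp T q p θ ∧
    ∃ g b : ℝ → E n → E n,
      (∀ᵐ t ∂(volume.restrict (Ioo 0 T)), HasWeakGradient (θ t) (fun x => g t x + b t x)) ∧
      MemLqLp T 1 ⊤ g ∧
      MemLsBMO T s b ∧
      ∀ᵐ t ∂(volume.restrict (Ioo 0 T)), volume (Function.support (b t)) < ⊤

end ActiveScalar

end

open MeasureTheory Set
open scoped ENNReal ContDiff FourierTransform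

noncomputable section

namespace ActiveScalar

open Metric Filter Topology

/-! The proof is an energy estimate for the difference `w = θ₁ - θ₂`. Testing the difference of the
equations with `w`, the term `u₁ · ∇w` disappears because `u₁` is divergence free, and `‖w(t)‖₂² ≤ 2
∫₀ᵗ ∫ |w| |u₁ - u₂| |∇θ₂|` remains (`IsWeakSolution.lintegral_sq_sub_le`). Plancherel gives `‖u₁ -
u₂‖₂ ≤ C ‖w‖₂`, so a bounded `∇θ₂` would allow a direct use of Gronwall.

Here the gradients only have mean oscillation at most `N(t)`, with `N` integrable in time. The
integral is split at the level `|∇θ₂| = L N`. Below the level it costs at most a multiple of `L N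
‖w‖₂²`; above it, the tail estimate `lintegral_level_le` bounds `∫ w² |∇θ₂|²` by `C e^{-cL} N² ∫ (w²
+ θ₂²)`. Thus `F = ‖w‖₂²` satisfies `F(t) ≤ ∫₀ᵗ κ ((L + 1) F + K e^{-cL})` for every `L ≥ 0`. On a
time interval where `∫ κ ≤ c/4`, Gronwall loses at most `e^{(L + 1)c/2}`, which the gain `e^{-cL}`
beats as `L → ∞`; hence `F = 0` there, and finitely many such intervals exhaust `(0,T)`
(`ae_eq_zero_of_osgood`).

The tail estimate combines John–Nirenberg with a scaling argument. John–Nirenberg controls a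
gradient only relative to its average over a ball. If the mass of `w² + θ₂²` in a ball of radius `ρ`
is at most `N² ρ^{n+2}`, integration by parts against a bump shows that the averages of the
gradients are `O(N)` and that `|w| = O(ρ N)` on the half ball; the tail integral on that half ball
is then at most a multiple of `e^{-cL} N² · N² ρ^{n+2}`. Around almost every point where `w ≠ 0` a
radius is chosen at which the mass crosses this threshold, so `N² ρ^{n+2}` is paid for by the mass
of the ball, and a Vitali covering sums the local estimates.

The rest justifies the formal computation. By the same estimates the gradient is locally in `L²`, so
mollification gives the chain rule for `u · ∇` (`WeakDivFree.integral_mul_deriv_comp`); the equation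
says that `θ` is a primitive in time along almost every vertical line, and the square is reached
through a logarithmic truncation and spatial cutoffs. Oscillation is measured by double integrals
over balls, for which a countable supremum provides measurability in time. -/

/-! ### Balls -/

/-- The volume of the unit ball of `ℝⁿ`. -/
def unitVol (n : ℕ) : ℝ := volume.real (closedBall (0 : E n) 1)

lemma unitVol_pos (n : ℕ) : 0 < unitVol n :=
  ENNReal.toReal_pos (measure_closedBall_pos _ _ one_pos).ne' measure_closedBall_lt_top.ne

lemma volume_real_closedBall {n : ℕ} (x : E n) {r : ℝ} (hr : 0 ≤ r) :
    volume.real (closedBall x r) = r ^ n * unitVol n := by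
  have := Measure.addHaar_real_closedBall' (volume : Measure (E n)) x hr
  simpa [unitVol] using this

lemma volume_closedBall_eq {n : ℕ} (x : E n) {r : ℝ} (hr : 0 ≤ r) :
    volume (closedBall x r) = ENNReal.ofReal (r ^ n * unitVol n) := by
  rw [← volume_real_closedBall x hr, ofReal_measureReal measure_closedBall_lt_top.ne]

lemma volume_real_closedBall_pos {n : ℕ} (x : E n) {r : ℝ} (hr : 0 < r) :
    0 < volume.real (closedBall x r) := by
  rw [volume_real_closedBall x hr.le]; have := unitVol_pos n; positivity

/-- The average of `f` over a closed ball. -/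
def ballAvg {n : ℕ} {F : Type*} [NormedAddCommGroup F] [NormedSpace ℝ F]
    (f : E n → F) (x : E n) (r : ℝ) : F := ⨍ z in closedBall x r, f z

/-- The mean oscillation of `f` over every closed ball is at most `N`. -/
def BallOsc {n : ℕ} {F : Type*} [NormedAddCommGroup F] (f : E n → F) (N : ℝ) : Prop :=
  ∀ (x : E n) (r : ℝ), 0 < r →
    ∫⁻ y in closedBall x r, ∫⁻ z in closedBall x r, ‖f y - f z‖ₑ ≤
      ENNReal.ofReal N * volume (closedBall x r) ^ 2

section
variable {n : ℕ} {F : Type*} [NormedAddCommGroup F] {f : E n → F}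

lemma integrableOn_closedBall (hf : LocallyIntegrable f volume) (x : E n) (r : ℝ) :
    IntegrableOn f (closedBall x r) volume :=
  hf.integrableOn_isCompact (isCompact_closedBall x r)

lemma integrableOn_closedBall_norm_sub (hf : LocallyIntegrable f volume) (c : F) (x : E n) (r : ℝ) :
    IntegrableOn (fun y => ‖f y - c‖) (closedBall x r) volume :=
  ((integrableOn_closedBall hf x r).sub
    (integrableOn_const measure_closedBall_lt_top.ne)).norm

variable [NormedSpace ℝ F] [CompleteSpace F]

lemma norm_ballAvg_sub_le (hf : LocallyIntegrable f volume) (x : E n) {r : ℝ} (hr : 0 < r) (c : F) :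
    ‖ballAvg f x r - c‖ ≤
      (volume.real (closedBall x r))⁻¹ * ∫ y in closedBall x r, ‖f y - c‖ := by
  have hv := volume_real_closedBall_pos x hr
  have h1 : ballAvg f x r - c = (volume.real (closedBall x r))⁻¹ • ∫ y in closedBall x r, (f y - c) := by
    rw [integral_sub (integrableOn_closedBall hf x r)
      (integrableOn_const measure_closedBall_lt_top.ne), setIntegral_const, smul_sub, smul_smul,
      inv_mul_cancel₀ hv.ne', one_smul, ballAvg, setAverage_eq]
  rw [h1, norm_smul, Real.norm_of_nonneg (by positivity)]
  gcongr
  exact norm_integral_le_integral_norm _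

/-- Averaging in the second variable inside the norm bounds the deviation from the average by the
mean of `‖f y - f z‖` over `z`; one power of the volume is absorbed. -/
lemma BallOsc.integral_le {N : ℝ} (hN : 0 ≤ N) (h : BallOsc f N) (hf : LocallyIntegrable f volume)
    (x : E n) {r : ℝ} (hr : 0 < r) :
    ∫ y in closedBall x r, ‖f y - ballAvg f x r‖ ≤ N * volume.real (closedBall x r) := by
  have hv := volume_real_closedBall_pos x hr
  set v := volume (closedBall x r) with hvdef
  have hv0 : v ≠ 0 := (measure_closedBall_pos _ _ hr).ne'
  have hvt : v ≠ ⊤ := measure_closedBall_lt_top.ne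
  have key : ∀ y, ‖f y - ballAvg f x r‖ₑ ≤ v⁻¹ * ∫⁻ z in closedBall x r, ‖f y - f z‖ₑ := by
    intro y
    have h1 := norm_ballAvg_sub_le hf x hr (f y)
    rw [← enorm_norm, norm_sub_rev, Real.enorm_of_nonneg (norm_nonneg _)]
    refine (ENNReal.ofReal_le_ofReal h1).trans ?_
    rw [ENNReal.ofReal_mul (by positivity), ENNReal.ofReal_inv_of_pos hv,
      ofReal_measureReal hvt, ofReal_integral_eq_lintegral_ofReal
        (integrableOn_closedBall_norm_sub hf _ x r) (by filter_upwards with y using norm_nonneg _)]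
    gcongr with z
    rw [ofReal_norm, ← enorm_neg, neg_sub]
  have h2 : ∫⁻ y in closedBall x r, ‖f y - ballAvg f x r‖ₑ ≤ ENNReal.ofReal N * v := by
    calc _ ≤ ∫⁻ y in closedBall x r, v⁻¹ * ∫⁻ z in closedBall x r, ‖f y - f z‖ₑ :=
          lintegral_mono fun y => key y
      _ = v⁻¹ * ∫⁻ y in closedBall x r, ∫⁻ z in closedBall x r, ‖f y - f z‖ₑ :=
          lintegral_const_mul' _ _ (ENNReal.inv_ne_top.2 hv0)
      _ ≤ v⁻¹ * (ENNReal.ofReal N * v ^ 2) := by gcongr; exact h x r hr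
      _ = (v⁻¹ * v) * (ENNReal.ofReal N * v) := by ring
      _ = _ := by rw [ENNReal.inv_mul_cancel hv0 hvt, one_mul]
  have hae : AEStronglyMeasurable (fun y => f y - ballAvg f x r)
      (volume.restrict (closedBall x r)) :=
    ((integrableOn_closedBall hf x r).sub (integrableOn_const hvt)).aestronglyMeasurable
  rw [integral_norm_eq_lintegral_enorm hae]
  refine ENNReal.toReal_le_of_le_ofReal (by positivity) (h2.trans_eq ?_)
  rw [ENNReal.ofReal_mul hN, ofReal_measureReal hvt]

/-- Averages over nested balls. -/
lemma norm_ballAvg_sub_ballAvg_le {N : ℝ} (hN : 0 ≤ N) (h : BallOsc f N)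
    (hf : LocallyIntegrable f volume) {x y : E n} {r ρ : ℝ} (hr : 0 < r) (hρ : 0 < ρ)
    (hsub : closedBall y ρ ⊆ closedBall x r) :
    ‖ballAvg f y ρ - ballAvg f x r‖ ≤ (r / ρ) ^ n * N := by
  refine (norm_ballAvg_sub_le hf y hρ _).trans ?_
  have h1 : ∫ z in closedBall y ρ, ‖f z - ballAvg f x r‖ ≤ N * volume.real (closedBall x r) :=
    (setIntegral_mono_set (integrableOn_closedBall_norm_sub hf _ x r)
      (by filter_upwards with y using norm_nonneg _) hsub.eventuallyLE).trans (h.integral_le hN hf x hr)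
  rw [volume_real_closedBall x hr.le] at h1
  rw [volume_real_closedBall y hρ.le]
  have := unitVol_pos n
  calc _ ≤ (ρ ^ n * unitVol n)⁻¹ * (N * (r ^ n * unitVol n)) := by gcongr
    _ = _ := by rw [div_pow]; field_simp

/-! ### The John–Nirenberg inequality on balls. -/

/-- The John–Nirenberg constant. -/
def jnConst (n : ℕ) : ℝ := 2 * 10 ^ n * (1 + 2 ^ n)

lemma jnConst_pos (n : ℕ) : 0 < jnConst n := by unfold jnConst; positivity

end

/-- Stopping radii: from a nonempty set of positive numbers bounded above one can choose an
element which is at least half of every other one. -/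
lemma exists_mem_forall_le_two_mul {P : Set ℝ} (hne : P.Nonempty) (hpos : ∀ ρ ∈ P, 0 < ρ)
    (hb : BddAbove P) : ∃ ρ ∈ P, ∀ ρ' ∈ P, ρ' ≤ 2 * ρ := by
  have h0 : 0 < sSup P := by
    obtain ⟨a, ha⟩ := hne
    exact (hpos a ha).trans_le (le_csSup hb ha)
  obtain ⟨ρ, hρ, h⟩ := exists_lt_of_lt_csSup hne (half_lt_self h0)
  exact ⟨ρ, hρ, fun ρ' hρ' => (le_csSup hb hρ').trans (by linarith)⟩

section
variable {n : ℕ} {F : Type*} [NormedAddCommGroup F] [NormedSpace ℝ F] [CompleteSpace F]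
  {f : E n → F}

/-- Needed because stopping balls centred in a ball may leave it, but stay inside its double. -/
lemma integral_two_mul_closedBall_le {N : ℝ} (hN : 0 ≤ N) (h : BallOsc f N)
    (hf : LocallyIntegrable f volume) (x : E n) {r : ℝ} (hr : 0 < r) :
    ∫ y in closedBall x (2 * r), ‖f y - ballAvg f x r‖ ≤
      2 ^ n * (1 + 2 ^ n) * N * volume.real (closedBall x r) := by
  have h2 : 0 < 2 * r := by linarith
  have hV := unitVol_pos n
  have hsub : closedBall x r ⊆ closedBall x (2 * r) := closedBall_subset_closedBall (by linarith)
  have h3 := norm_ballAvg_sub_ballAvg_le hN h hf h2 hr hsub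
  rw [mul_div_cancel_right₀ _ hr.ne'] at h3
  calc ∫ y in closedBall x (2 * r), ‖f y - ballAvg f x r‖
      ≤ ∫ y in closedBall x (2 * r), (‖f y - ballAvg f x (2 * r)‖ + 2 ^ n * N) := by
        refine integral_mono (integrableOn_closedBall_norm_sub hf _ _ _)
          ((integrableOn_closedBall_norm_sub hf _ _ _).add
            (integrableOn_const measure_closedBall_lt_top.ne)) fun y => ?_
        calc ‖f y - ballAvg f x r‖
            ≤ ‖f y - ballAvg f x (2 * r)‖ + ‖ballAvg f x (2 * r) - ballAvg f x r‖ :=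
              norm_sub_le_norm_sub_add_norm_sub _ _ _
          _ ≤ _ := by rw [norm_sub_rev (ballAvg f x (2 * r))]; gcongr
    _ = (∫ y in closedBall x (2 * r), ‖f y - ballAvg f x (2 * r)‖) +
          volume.real (closedBall x (2 * r)) * (2 ^ n * N) := by
        rw [integral_add (integrableOn_closedBall_norm_sub hf _ _ _)
          (integrableOn_const measure_closedBall_lt_top.ne), setIntegral_const, smul_eq_mul]
    _ ≤ N * volume.real (closedBall x (2 * r)) +
          volume.real (closedBall x (2 * r)) * (2 ^ n * N) := by
        gcongr; exact h.integral_le hN hf x h2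
    _ = _ := by
        rw [volume_real_closedBall x h2.le, volume_real_closedBall x hr.le, mul_pow]; ring

/-- John–Nirenberg inequality for balls, level set form. -/
lemma BallOsc.volume_level_le {N : ℝ} (hN : 0 < N) (h : BallOsc f N)
    (hf : LocallyIntegrable f volume) (m : ℕ) : ∀ (x : E n) (r : ℝ), 0 < r →
    volume {y ∈ closedBall x r | m * (jnConst n * N) < ‖f y - ballAvg f x r‖} ≤
      2⁻¹ ^ m * volume (closedBall x r) := by
  induction m with
  | zero =>
    intro x r hr
    simp only [pow_zero, one_mul]
    exact measure_mono fun y hy => hy.1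
  | succ m ih =>
    -- A stopping argument with balls in place of dyadic cubes. Around a bad point a nearly maximal
    -- radius is chosen at which the mean of `‖f - c‖` exceeds `Λ`. On the fivefold ball the average
    -- is then within `Λ` of `c`, so a deviation above `(m + 1) Λ` from `c` leaves one above `m Λ`
    -- from the new average, and induction applies there.
    intro x r hr
    have hA := jnConst_pos n
    have hV := unitVol_pos n
    set Λ := jnConst n * N with hΛ
    have hΛ0 : 0 < Λ := by positivity
    set c := ballAvg f x r with hc
    set S := {y ∈ closedBall x r | ((m + 1 : ℕ) : ℝ) * Λ < ‖f y - c‖} with hS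
    have hg : LocallyIntegrable (fun y => f y - c) volume := hf.sub (locallyIntegrable_const c)
    have hgn : LocallyIntegrable (fun y => ‖f y - c‖) volume := fun y => (hg y).norm
    have hleb := IsUnifLocDoublingMeasure.ae_tendsto_average (μ := (volume : Measure (E n)))
      hgn 1
    obtain ⟨D, hD, hD0⟩ : ∃ D : Set (E n), (∀ y ∈ Dᶜ, Tendsto (fun ρ =>
        ⨍ z in closedBall y ρ, ‖f z - c‖) (𝓝[>] 0) (𝓝 ‖f y - c‖)) ∧ volume D = 0 := by
      refine ⟨{y | ¬ Tendsto (fun ρ => ⨍ z in closedBall y ρ, ‖f z - c‖) (𝓝[>] 0)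
        (𝓝 ‖f y - c‖)}, fun y hy => not_not.1 hy, ?_⟩
      refine measure_mono_null (fun y hy => ?_) (ae_iff.1 hleb)
      simp only [mem_ofPred_eq] at hy ⊢
      intro h
      refine hy (h (fun _ => y) (fun ρ => ρ) tendsto_id ?_)
      filter_upwards [self_mem_nhdsWithin] with ρ hρ
      have : (0:ℝ) < ρ := hρ
      simpa using this.le
    -- stopping radii
    let P : E n → Set ℝ := fun y => {ρ | 0 < ρ ∧ ρ ≤ r ∧
      Λ * volume.real (closedBall y ρ) < ∫ z in closedBall y ρ, ‖f z - c‖}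
    have hsub2 : ∀ y ∈ closedBall x r, ∀ ρ ≤ r, closedBall y ρ ⊆ closedBall x (2 * r) := by
      intro y hy ρ hρ
      refine closedBall_subset_closedBall' ?_
      have := mem_closedBall.1 hy
      linarith
    have hbig := integral_two_mul_closedBall_le hN.le h hf x hr
    -- If `5 * ρ > r`, the ball is so large that `Λ` times its volume exceeds the whole integral
    -- over the double ball; this is what the factor `10 ^ n = 2 ^ n * 5 ^ n` in `jnConst` is for.
    have hPsmall : ∀ y ∈ closedBall x r, ∀ ρ ∈ P y, 5 * ρ ≤ r := by
      rintro y hy ρ ⟨hρ0, hρr, hρ⟩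
      have h1 : ∫ z in closedBall y ρ, ‖f z - c‖ ≤ ∫ z in closedBall x (2 * r), ‖f z - c‖ :=
        setIntegral_mono_set (integrableOn_closedBall_norm_sub hf _ _ _)
          (by filter_upwards with y using norm_nonneg _) (hsub2 y hy ρ hρr).eventuallyLE
      have h2 := hρ.trans_le (h1.trans hbig)
      rw [volume_real_closedBall _ hρ0.le, volume_real_closedBall _ hr.le, hΛ, jnConst] at h2
      have h3 : (10:ℝ) ^ n = 2 ^ n * 5 ^ n := by rw [← mul_pow]; norm_num
      by_contra! hcon
      have h4 : r ^ n ≤ (5 * ρ) ^ n := pow_le_pow_left₀ hr.le hcon.le n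
      rw [mul_pow] at h4
      have h5 : 2 ^ n * (1 + 2 ^ n) * N * (r ^ n * unitVol n) ≤
          2 ^ n * (1 + 2 ^ n) * N * (5 ^ n * ρ ^ n * unitVol n) := by gcongr
      rw [h3] at h2
      have h6 : 0 < 2 ^ n * (1 + 2 ^ n) * N * (5 ^ n * ρ ^ n * unitVol n) := by positivity
      nlinarith
    have hPne : ∀ y ∈ S \ D, (P y).Nonempty := by
      rintro y ⟨⟨hy, hyl⟩, hyD⟩
      have hlt : Λ < ‖f y - c‖ := by
        refine lt_of_le_of_lt ?_ hyl
        have : (1:ℝ) ≤ ((m + 1 : ℕ) : ℝ) := by norm_cast; omega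
        nlinarith
      have h1 := (hD y hyD).eventually (lt_mem_nhds hlt)
      have h2 : ∀ᶠ ρ in 𝓝[>] (0:ℝ), ρ ≤ r := by
        filter_upwards [Ioc_mem_nhdsGT hr] with ρ hρ using hρ.2
      obtain ⟨ρ, h1ρ, h2ρ, h3ρ⟩ := (h1.and (h2.and self_mem_nhdsWithin)).exists
      have hv := volume_real_closedBall_pos y h3ρ
      refine ⟨ρ, h3ρ, h2ρ, ?_⟩
      rw [setAverage_eq, smul_eq_mul, ← div_eq_inv_mul, lt_div_iff₀ hv] at h1ρ
      exact h1ρ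
    have hch : ∀ y, ∃ ρ, y ∈ S \ D → ρ ∈ P y ∧ ∀ ρ' ∈ P y, ρ' ≤ 2 * ρ := by
      intro y
      by_cases hy : y ∈ S \ D
      · obtain ⟨ρ, h1, h2⟩ := exists_mem_forall_le_two_mul (hPne y hy) (fun ρ hρ => hρ.1)
          ⟨r, fun ρ hρ => hρ.2.1⟩
        exact ⟨ρ, fun _ => ⟨h1, h2⟩⟩
      · exact ⟨0, fun h => absurd h hy⟩
    choose ρ hρ using hch
    obtain ⟨u, huS, hudisj, hucov⟩ :=
      Vitali.exists_disjoint_subfamily_covering_enlargement_closedBall (S \ D) (fun y => y) ρ r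
        (fun y hy => (hρ y hy).1.2.1) 5 (by norm_num)
    have hu0 : ∀ y ∈ u, 0 < ρ y := fun y hy => (hρ y (huS hy)).1.1
    have hucount : u.Countable := by
      refine hudisj.countable_of_nonempty_interior fun y hy => ?_
      exact (nonempty_ball.2 (hu0 y hy)).mono ball_subset_interior_closedBall
    have hSsub : S ⊆ D ∪ ⋃ y ∈ u,
        {z ∈ closedBall y (5 * ρ y) | m * Λ < ‖f z - ballAvg f y (5 * ρ y)‖} := by
      intro z hz
      by_cases hzD : z ∈ D
      · exact Or.inl hzD
      right
      obtain ⟨y, hyu, hzy⟩ := hucov z ⟨hz, hzD⟩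
      have hz0 : 0 < ρ z := (hρ z ⟨hz, hzD⟩).1.1
      have hy0 := hu0 y hyu
      have hyS := huS hyu
      refine mem_iUnion₂.2 ⟨y, hyu, hzy (mem_closedBall_self hz0.le), ?_⟩
      have h5 : 5 * ρ y ≤ r := hPsmall y hyS.1.1 _ (hρ y hyS).1
      -- `ρ y` is at least half of every admissible radius, so five times it is not admissible; as
      -- `5 * ρ y ≤ r`, only the mean condition can fail.
      have h5n : 5 * ρ y ∉ P y := fun h => by
        have := (hρ y hyS).2 _ h
        linarith
      have h6 : ∫ z in closedBall y (5 * ρ y), ‖f z - c‖ ≤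
          Λ * volume.real (closedBall y (5 * ρ y)) := by
        by_contra! hcon
        exact h5n ⟨by linarith, h5, hcon⟩
      have hv := volume_real_closedBall_pos y (show 0 < 5 * ρ y by linarith)
      have h7 : ‖ballAvg f y (5 * ρ y) - c‖ ≤ Λ := by
        refine (norm_ballAvg_sub_le hf y (by linarith) c).trans ?_
        rw [inv_mul_le_iff₀ hv]
        linarith
      have h8 : ‖f z - c‖ ≤ ‖f z - ballAvg f y (5 * ρ y)‖ + ‖ballAvg f y (5 * ρ y) - c‖ :=
        norm_sub_le_norm_sub_add_norm_sub _ _ _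
      have h9 := hz.2
      push_cast at h9
      show m * Λ < _
      linarith
    -- The `5 ^ n` cancels the Vitali enlargement, and the factor `2` in `jnConst` provides the
    -- halving at each level.
    have hsum : ∑' y : u, volume (closedBall (y : E n) (ρ y)) ≤
        ENNReal.ofReal ((2 * 5 ^ n)⁻¹ ) * volume (closedBall x r) := by
      rw [← measure_biUnion hucount hudisj (fun y _ => measurableSet_closedBall)]
      set W := ⋃ y ∈ u, closedBall (y : E n) (ρ y) with hW
      have hWsub : W ⊆ closedBall x (2 * r) := iUnion₂_subset fun y hy =>
        hsub2 y (huS hy).1.1 _ (hρ y (huS hy)).1.2.1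
      have hWm : MeasurableSet W := .biUnion hucount fun y _ => measurableSet_closedBall
      have hWlt : ENNReal.ofReal Λ * volume W ≤
          ENNReal.ofReal (∫ z in closedBall x (2 * r), ‖f z - c‖) := by
        rw [ofReal_integral_eq_lintegral_ofReal (integrableOn_closedBall_norm_sub hf _ _ _)
          (by filter_upwards with y using norm_nonneg _)]
        refine le_trans ?_ (lintegral_mono_set hWsub)
        rw [hW, measure_biUnion hucount hudisj (fun y _ => measurableSet_closedBall),
          lintegral_biUnion hucount (fun y _ => measurableSet_closedBall) hudisj,
          ← ENNReal.tsum_mul_left]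
        refine ENNReal.tsum_le_tsum fun y => ?_
        have hy := (hρ y (huS y.2)).1.2.2
        rw [← ofReal_integral_eq_lintegral_ofReal (integrableOn_closedBall_norm_sub hf _ _ _)
          (by filter_upwards with y using norm_nonneg _), ← ofReal_measureReal
          measure_closedBall_lt_top.ne, ← ENNReal.ofReal_mul hΛ0.le]
        exact ENNReal.ofReal_le_ofReal hy.le
      have hWreal : Λ * volume.real W ≤
          2 ^ n * (1 + 2 ^ n) * N * volume.real (closedBall x r) := by
        refine le_trans ?_ hbig
        rw [← ofReal_measureReal ((measure_mono hWsub).trans_lt measure_closedBall_lt_top).ne,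
          ← ENNReal.ofReal_mul hΛ0.le] at hWlt
        exact (ENNReal.ofReal_le_ofReal_iff (integral_nonneg fun _ => norm_nonneg _)).1 hWlt
      rw [← ofReal_measureReal ((measure_mono hWsub).trans_lt measure_closedBall_lt_top).ne,
        ← ofReal_measureReal (s := closedBall x r) measure_closedBall_lt_top.ne,
        ← ENNReal.ofReal_mul (by positivity)]
      refine ENNReal.ofReal_le_ofReal ?_
      rw [hΛ, jnConst, show (10:ℝ) ^ n = 2 ^ n * 5 ^ n by rw [← mul_pow]; norm_num] at hWreal
      rw [le_inv_mul_iff₀ (by positivity)]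
      have hq : 0 < 2 ^ n * (1 + 2 ^ n) * N := by positivity
      refine le_of_mul_le_mul_left ?_ hq
      linarith
    calc volume S ≤ volume (D ∪ ⋃ y ∈ u,
          {z ∈ closedBall y (5 * ρ y) | m * Λ < ‖f z - ballAvg f y (5 * ρ y)‖}) :=
          measure_mono hSsub
      _ ≤ volume D + ∑' y : u, volume
          {z ∈ closedBall (y : E n) (5 * ρ y) | m * Λ < ‖f z - ballAvg f y (5 * ρ y)‖} :=
          (measure_union_le _ _).trans (by gcongr; exact measure_biUnion_le _ hucount _)
      _ ≤ 0 + ∑' y : u, 2⁻¹ ^ m * (ENNReal.ofReal (5 ^ n) * volume (closedBall (y : E n) (ρ y))) := by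
          rw [hD0]
          gcongr with y
          refine (ih y (5 * ρ y) (by linarith [hu0 y y.2])).trans ?_
          gcongr
          rw [volume_closedBall_eq _ (by linarith [hu0 y y.2]), volume_closedBall_eq _ (hu0 y y.2).le,
            ← ENNReal.ofReal_mul (by positivity), mul_pow, mul_assoc]
      _ = 2⁻¹ ^ m * (ENNReal.ofReal (5 ^ n) * ∑' y : u, volume (closedBall (y : E n) (ρ y))) := by
          rw [zero_add, ENNReal.tsum_mul_left, ENNReal.tsum_mul_left]
      _ ≤ 2⁻¹ ^ m * (ENNReal.ofReal (5 ^ n) *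
          (ENNReal.ofReal ((2 * 5 ^ n)⁻¹ ) * volume (closedBall x r))) := by gcongr
      _ = 2⁻¹ ^ (m + 1) * volume (closedBall x r) := by
          rw [← mul_assoc (ENNReal.ofReal _), ← ENNReal.ofReal_mul (by positivity),
            show (5:ℝ) ^ n * (2 * 5 ^ n)⁻¹ = 2⁻¹ by field_simp, pow_succ, ← mul_assoc,
            ENNReal.ofReal_inv_of_pos two_pos, ENNReal.ofReal_ofNat]

end

/-- The rate in the exponential John–Nirenberg inequality. -/
def jnRate (n : ℕ) : ℝ := Real.log (3 / 2) / jnConst n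

lemma jnRate_pos (n : ℕ) : 0 < jnRate n := div_pos (Real.log_pos (by norm_num)) (jnConst_pos n)

section
variable {n : ℕ} {F : Type*} [NormedAddCommGroup F] [NormedSpace ℝ F] [CompleteSpace F]
  {f : E n → F}

/-- John–Nirenberg inequality for balls, exponential form. -/
lemma BallOsc.lintegral_exp_le {N : ℝ} (hN : 0 < N) (h : BallOsc f N)
    (hf : LocallyIntegrable f volume) (x : E n) {r : ℝ} (hr : 0 < r) :
    ∫⁻ y in closedBall x r, ENNReal.ofReal (Real.exp (jnRate n / N * ‖f y - ballAvg f x r‖)) ≤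
      8 * volume (closedBall x r) := by
  have hA := jnConst_pos n
  set a := jnConst n * N with ha
  have ha0 : 0 < a := by positivity
  set B := closedBall x r with hB
  set S : ℕ → Set (E n) := fun m => {y ∈ B | m * a < ‖f y - ballAvg f x r‖} with hS
  have hmeas : AEMeasurable (fun y => ‖f y - ballAvg f x r‖) (volume.restrict B) :=
    (integrableOn_closedBall_norm_sub hf _ x r).aestronglyMeasurable.aemeasurable
  have hSm : ∀ m, NullMeasurableSet (S m) (volume.restrict B) := fun m => by
    have h1 : NullMeasurableSet {y | m * a < ‖f y - ballAvg f x r‖} (volume.restrict B) :=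
      nullMeasurableSet_lt aemeasurable_const hmeas
    exact measurableSet_closedBall.nullMeasurableSet.inter h1
  -- The rate is chosen so that one level multiplies the exponential by `3/2` while the measure is
  -- halved, leaving a geometric series of ratio `3/4`.
  have hexp : ∀ m : ℕ, Real.exp (jnRate n / N * (m * a)) = (3 / 2) ^ m := fun m => by
    rw [show jnRate n / N * (m * a) = m * Real.log (3 / 2) by
      rw [jnRate, ha]; field_simp, Real.exp_nat_mul, Real.exp_log (by norm_num)]
  have hpt : ∀ y ∈ B, ENNReal.ofReal (Real.exp (jnRate n / N * ‖f y - ballAvg f x r‖)) ≤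
      ENNReal.ofReal (3 / 2) +
        ∑' m : ℕ, (S m).indicator (fun _ => ENNReal.ofReal ((3 / 2) ^ (m + 1))) y := by
    intro y hy
    have hrate := jnRate_pos n
    rcases (norm_nonneg (f y - ballAvg f x r)).eq_or_lt with h0 | h0
    · rw [← h0, mul_zero, Real.exp_zero]
      exact (ENNReal.ofReal_le_ofReal (by norm_num)).trans le_self_add
    · set k := ⌈‖f y - ballAvg f x r‖ / a⌉₊ with hk
      have hk1 : 0 < k := Nat.ceil_pos.2 (by positivity)
      obtain ⟨m, hm⟩ : ∃ m, k = m + 1 := ⟨k - 1, by omega⟩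
      have h1 : ‖f y - ballAvg f x r‖ ≤ (m + 1 : ℕ) * a := by
        rw [← hm, ← div_le_iff₀ ha0]; exact Nat.le_ceil _
      have h2 : m * a < ‖f y - ballAvg f x r‖ := by
        rw [← lt_div_iff₀ ha0]; exact Nat.lt_ceil.1 (by omega)
      refine le_trans ?_ le_add_self
      refine le_trans ?_ (ENNReal.le_tsum m)
      rw [indicator_of_mem (show y ∈ S m from ⟨hy, h2⟩), ← hexp]
      gcongr
  calc _ ≤ ∫⁻ y in B, (ENNReal.ofReal (3 / 2) +
        ∑' m : ℕ, (S m).indicator (fun _ => ENNReal.ofReal ((3 / 2) ^ (m + 1))) y) :=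
        setLIntegral_mono' measurableSet_closedBall hpt
    _ = ENNReal.ofReal (3 / 2) * volume B +
        ∑' m : ℕ, ENNReal.ofReal ((3 / 2) ^ (m + 1)) * volume (S m) := by
        rw [lintegral_add_left measurable_const, setLIntegral_const, lintegral_tsum
          fun m => aemeasurable_const.indicator₀ (hSm m)]
        congr 1
        refine tsum_congr fun m => ?_
        rw [lintegral_indicator₀ (hSm m), lintegral_const, Measure.restrict_apply_univ,
          Measure.restrict_apply₀ (hSm m)]
        congr 2
        exact inter_eq_left.2 fun y hy => hy.1
    _ ≤ ENNReal.ofReal (3 / 2) * volume B +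
        ∑' m : ℕ, ENNReal.ofReal (3 / 2 * (3 / 4) ^ m) * volume B := by
        refine add_le_add le_rfl (ENNReal.tsum_le_tsum fun m => ?_)
        refine (mul_le_mul_right (h.volume_level_le hN hf m x r hr) _).trans_eq ?_
        rw [← mul_assoc]
        congr 1
        rw [show (2⁻¹ : ℝ≥0∞) = ENNReal.ofReal (2⁻¹) by
          rw [ENNReal.ofReal_inv_of_pos two_pos, ENNReal.ofReal_ofNat],
          ← ENNReal.ofReal_pow (by norm_num), ← ENNReal.ofReal_mul (by positivity), pow_succ]
        congr 1
        rw [mul_right_comm, ← mul_pow]; norm_num; ring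
    _ = (ENNReal.ofReal (3 / 2) + ENNReal.ofReal (∑' m : ℕ, 3 / 2 * (3 / 4) ^ m)) * volume B := by
        rw [ENNReal.tsum_mul_right, add_mul, ENNReal.ofReal_tsum_of_nonneg (fun m => by positivity)
          ((summable_geometric_of_lt_one (by norm_num) (by norm_num)).mul_left _)]
    -- The total is `3/2 + 6`, rounded up.
    _ ≤ 8 * volume B := by
        gcongr
        rw [tsum_mul_left, tsum_geometric_of_lt_one (by norm_num) (by norm_num),
          ← ENNReal.ofReal_add (by norm_num) (by norm_num)]
        refine ENNReal.ofReal_le_of_le_toReal ?_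
        norm_num

/-- The part of `f` above the level `L N` is exponentially small in mean square. -/
lemma BallOsc.lintegral_sq_level_le {N : ℝ} (hN : 0 < N) (h : BallOsc f N)
    (hf : LocallyIntegrable f volume) (x : E n) {r : ℝ} (hr : 0 < r) {C₁ : ℝ}
    (hC : ‖ballAvg f x r‖ ≤ C₁ * N) (L : ℝ) :
    ∫⁻ y in closedBall x r, {y | L * N < ‖f y‖}.indicator (fun y => ‖f y‖ₑ ^ 2) y ≤
      ENNReal.ofReal (64 / jnRate n ^ 2 * Real.exp (jnRate n * C₁) *
        Real.exp (-(jnRate n / 2 * L)) * N ^ 2) * volume (closedBall x r) := by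
  have hc := jnRate_pos n
  set c := jnRate n with hcdef
  set K := 8 / c ^ 2 * Real.exp (c * C₁) * Real.exp (-(c / 2 * L)) * N ^ 2 with hK
  have hK0 : 0 ≤ K := by positivity
  calc _ ≤ ∫⁻ y in closedBall x r, ENNReal.ofReal K *
        ENNReal.ofReal (Real.exp (c / N * ‖f y - ballAvg f x r‖)) := by
        refine lintegral_mono fun y => ?_
        by_cases hy : L * N < ‖f y‖
        · rw [indicator_of_mem (by exact hy), ← ENNReal.ofReal_mul hK0, ← ofReal_norm,
            ← ENNReal.ofReal_pow (norm_nonneg _)]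
          refine ENNReal.ofReal_le_ofReal ?_
          set s := ‖f y‖ / N with hs
          have hsN : ‖f y‖ = s * N := by rw [hs]; field_simp
          have hs0 : 0 ≤ s := by positivity
          have hLs : L ≤ s := by rw [hs, le_div_iff₀ hN]; exact hy.le
          have h1 : s ^ 2 ≤ 8 / c ^ 2 * Real.exp (c / 2 * s) := by
            have := Real.quadratic_le_exp_of_nonneg (show 0 ≤ c / 2 * s by positivity)
            rw [div_mul_eq_mul_div, le_div_iff₀ (by positivity)]
            nlinarith [show 0 ≤ c / 2 * s by positivity]
          -- Write `c s / 2 = c s - c s / 2`: the first term is bounded through `s ≤ C₁ + ‖f y -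
          -- ballAvg f x r‖ / N`, the second through `L ≤ s`. Half of the rate thus produces the
          -- decay in `L`, the other half having absorbed the square.
          have h2 : Real.exp (c / 2 * s) ≤ Real.exp (c * C₁) * Real.exp (-(c / 2 * L)) *
              Real.exp (c / N * ‖f y - ballAvg f x r‖) := by
            rw [← Real.exp_add, ← Real.exp_add]
            refine Real.exp_le_exp.2 ?_
            have h3 : s ≤ C₁ + ‖f y - ballAvg f x r‖ / N := by
              rw [hs, div_le_iff₀ hN, add_mul, div_mul_cancel₀ _ hN.ne']
              have := norm_sub_norm_le (f y) (ballAvg f x r)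
              linarith
            have h4 : c / N * ‖f y - ballAvg f x r‖ = c * (‖f y - ballAvg f x r‖ / N) := by ring
            rw [h4]
            nlinarith
          calc ‖f y‖ ^ 2 = s ^ 2 * N ^ 2 := by rw [hsN]; ring
            _ ≤ (8 / c ^ 2 * (Real.exp (c * C₁) * Real.exp (-(c / 2 * L)) *
              Real.exp (c / N * ‖f y - ballAvg f x r‖))) * N ^ 2 := by
                gcongr; exact h1.trans (by gcongr)
            _ = _ := by rw [hK]; ring
        · rw [indicator_of_notMem (by exact hy)]; exact zero_le
    _ = ENNReal.ofReal K * ∫⁻ y in closedBall x r,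
        ENNReal.ofReal (Real.exp (c / N * ‖f y - ballAvg f x r‖)) :=
        lintegral_const_mul' _ _ ENNReal.ofReal_ne_top
    _ ≤ ENNReal.ofReal K * (8 * volume (closedBall x r)) := by
        gcongr; exact h.lintegral_exp_le hN hf x hr
    _ = _ := by
        rw [← mul_assoc, show (8 : ℝ≥0∞) = ENNReal.ofReal 8 by simp, ← ENNReal.ofReal_mul hK0, hK]
        congr 2; ring

end

/-! ### Averages against a smooth bump -/

/-- A smooth bump supported in the unit ball with integral one. -/
def stdBump (n : ℕ) : E n → ℝ :=
  (⟨1 / 2, 1, by norm_num, by norm_num⟩ : ContDiffBump (0 : E n)).normed volume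

lemma stdBump_contDiff (n : ℕ) : ContDiff ℝ ∞ (stdBump n) := ContDiffBump.contDiff_normed _

lemma stdBump_hasCompactSupport (n : ℕ) : HasCompactSupport (stdBump n) :=
  ContDiffBump.hasCompactSupport_normed _

lemma stdBump_nonneg {n : ℕ} (x : E n) : 0 ≤ stdBump n x := ContDiffBump.nonneg_normed _ _

lemma integral_stdBump (n : ℕ) : ∫ x, stdBump n x = 1 := ContDiffBump.integral_normed _

lemma tsupport_stdBump (n : ℕ) : tsupport (stdBump n) = closedBall 0 1 :=
  ContDiffBump.tsupport_normed_eq _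

lemma exists_stdBump_bound (n : ℕ) :
    ∃ C : ℝ, 0 < C ∧ ∀ x, |stdBump n x| ≤ C ∧ ‖fderiv ℝ (stdBump n) x‖ ≤ C := by
  obtain ⟨C₁, h₁⟩ := (stdBump_hasCompactSupport n).exists_bound_of_continuous
    (stdBump_contDiff n).continuous
  obtain ⟨C₂, h₂⟩ := ((stdBump_hasCompactSupport n).fderiv (𝕜 := ℝ)).exists_bound_of_continuous
    ((stdBump_contDiff n).continuous_fderiv (by simp))
  refine ⟨max (max C₁ C₂) 1, by positivity, fun x => ⟨(h₁ x).trans ?_, (h₂ x).trans ?_⟩⟩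
  · exact (le_max_left _ _).trans (le_max_left _ _)
  · exact (le_max_right _ _).trans (le_max_left _ _)

/-- A bound for the standard bump and its derivative. -/
def bumpConst (n : ℕ) : ℝ := (exists_stdBump_bound n).choose

lemma bumpConst_pos (n : ℕ) : 0 < bumpConst n := (exists_stdBump_bound n).choose_spec.1

lemma abs_stdBump_le {n : ℕ} (x : E n) : |stdBump n x| ≤ bumpConst n :=
  ((exists_stdBump_bound n).choose_spec.2 x).1

lemma norm_fderiv_stdBump_le {n : ℕ} (x : E n) : ‖fderiv ℝ (stdBump n) x‖ ≤ bumpConst n :=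
  ((exists_stdBump_bound n).choose_spec.2 x).2

lemma stdBump_eq_zero {n : ℕ} {x : E n} (hx : 1 < ‖x‖) : stdBump n x = 0 := by
  refine image_eq_zero_of_notMem_tsupport ?_
  rw [tsupport_stdBump]; simpa using hx

lemma fderiv_stdBump_eq_zero {n : ℕ} {x : E n} (hx : 1 < ‖x‖) : fderiv ℝ (stdBump n) x = 0 := by
  refine image_eq_zero_of_notMem_tsupport fun h => ?_
  have := tsupport_fderiv_subset ℝ h
  rw [tsupport_stdBump] at this; simp at this; linarith

/-- The bump at `y` of radius `δ`. -/
def bump {n : ℕ} (y : E n) (δ : ℝ) (z : E n) : ℝ := (δ ^ n)⁻¹ * stdBump n (δ⁻¹ • (z - y))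

lemma contDiff_rescale {n : ℕ} {η : E n → ℝ} (hη : ContDiff ℝ ∞ η) (y : E n) (c δ : ℝ) :
    ContDiff ℝ ∞ (fun z => c * η (δ⁻¹ • (z - y))) :=
  contDiff_const.mul (hη.comp (g := η) (f := fun z => δ⁻¹ • (z - y)) (by fun_prop))

lemma hasCompactSupport_of_eq_zero {n : ℕ} {F : Type*} [Zero F] {f : E n → F} (y : E n) (R : ℝ)
    (h : ∀ z, z ∉ closedBall y R → f z = 0) : HasCompactSupport f :=
  HasCompactSupport.intro (isCompact_closedBall y R) fun z hz => h z hz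

lemma one_lt_norm_rescale {n : ℕ} {y z : E n} {δ : ℝ} (hδ : 0 < δ) (hz : z ∉ closedBall y δ) :
    1 < ‖δ⁻¹ • (z - y)‖ := by
  rw [mem_closedBall, dist_eq_norm, not_le] at hz
  rw [norm_smul, norm_inv, Real.norm_of_nonneg hδ.le, ← div_eq_inv_mul, one_lt_div hδ]
  exact hz

lemma bump_eq_zero {n : ℕ} {y z : E n} {δ : ℝ} (hδ : 0 < δ) (hz : z ∉ closedBall y δ) :
    bump y δ z = 0 := by
  rw [bump, stdBump_eq_zero (one_lt_norm_rescale hδ hz), mul_zero]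

lemma bump_contDiff {n : ℕ} (y : E n) (δ : ℝ) : ContDiff ℝ ∞ (bump y δ) :=
  contDiff_rescale (stdBump_contDiff n) y _ _

lemma bump_hasCompactSupport {n : ℕ} (y : E n) {δ : ℝ} (hδ : 0 < δ) :
    HasCompactSupport (bump y δ) :=
  hasCompactSupport_of_eq_zero y δ fun _ hz => bump_eq_zero hδ hz

lemma abs_bump_le {n : ℕ} (y : E n) {δ : ℝ} (hδ : 0 < δ) (z : E n) :
    |bump y δ z| ≤ (δ ^ n)⁻¹ * bumpConst n := by
  rw [bump, abs_mul, abs_of_pos (by positivity)]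
  gcongr; exact abs_stdBump_le _

lemma integral_bump {n : ℕ} (y : E n) {δ : ℝ} (hδ : 0 < δ) : ∫ z, bump y δ z = 1 := by
  unfold bump
  rw [integral_const_mul, integral_sub_right_eq_self (fun z : E n => stdBump n (δ⁻¹ • z)) y,
    Measure.integral_comp_inv_smul, integral_stdBump]
  simp [abs_of_pos (pow_pos hδ n), (pow_pos hδ n).ne']

lemma hasFDerivAt_rescale {n : ℕ} {η : E n → ℝ} (hη : ContDiff ℝ ∞ η) (y : E n) (c δ : ℝ)
    (z : E n) : HasFDerivAt (fun z => c * η (δ⁻¹ • (z - y)))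
      (c • δ⁻¹ • fderiv ℝ η (δ⁻¹ • (z - y))) z := by
  have h1 : HasFDerivAt η (fderiv ℝ η (δ⁻¹ • (z - y))) (δ⁻¹ • (z - y)) :=
    (hη.differentiable (by simp) _).hasFDerivAt
  have h2 : HasFDerivAt (fun z : E n => δ⁻¹ • (z - y)) (δ⁻¹ • ContinuousLinearMap.id ℝ (E n)) z :=
    ((hasFDerivAt_id z).sub_const y).fun_const_smul δ⁻¹
  refine ((h1.comp z h2).const_mul c).congr_fderiv ?_
  ext v; simp

lemma norm_fderiv_bump_le {n : ℕ} (y : E n) {δ : ℝ} (hδ : 0 < δ) (z : E n) :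
    ‖fderiv ℝ (bump y δ) z‖ ≤ (δ ^ (n + 1))⁻¹ * bumpConst n := by
  unfold bump
  rw [(hasFDerivAt_rescale (stdBump_contDiff n) y _ δ z).fderiv, norm_smul, norm_smul,
    Real.norm_of_nonneg (by positivity), Real.norm_of_nonneg (by positivity), pow_succ, mul_inv,
    mul_assoc]
  gcongr; exact norm_fderiv_stdBump_le _

lemma fderiv_bump_eq_zero {n : ℕ} {y z : E n} {δ : ℝ} (hδ : 0 < δ) (hz : z ∉ closedBall y δ) :
    fderiv ℝ (bump y δ) z = 0 := by
  unfold bump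
  rw [(hasFDerivAt_rescale (stdBump_contDiff n) y _ δ z).fderiv,
    fderiv_stdBump_eq_zero (one_lt_norm_rescale hδ hz), smul_zero, smul_zero]

lemma norm_le_sum_abs {n : ℕ} (v : E n) : ‖v‖ ≤ ∑ i, |v i| := by
  have h : v = ∑ i, v i • EuclideanSpace.single i (1 : ℝ) := by
    ext j; simp [Finset.sum_apply, Pi.single_apply]
  conv_lhs => rw [h]
  refine (norm_sum_le _ _).trans (Finset.sum_le_sum fun i _ => ?_)
  rw [norm_smul]; simp

lemma abs_apply_le_norm {n : ℕ} (v : E n) (i : Fin n) : |v i| ≤ ‖v‖ := by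
  simpa using PiLp.norm_apply_le v i

/-- An integral against a bounded function vanishing off a ball. -/
lemma norm_integral_le_of_eq_zero_off {n : ℕ} {F : Type*} [NormedAddCommGroup F] [NormedSpace ℝ F]
    {f : E n → F} {w : E n → ℝ} (y : E n) (R M : ℝ)
    (hw : IntegrableOn w (closedBall y R) volume)
    (h0 : ∀ z, z ∉ closedBall y R → f z = 0) (hb : ∀ z ∈ closedBall y R, ‖f z‖ ≤ M * w z) :
    ‖∫ z, f z‖ ≤ M * ∫ z in closedBall y R, w z := by
  rw [← setIntegral_eq_integral_of_forall_compl_eq_zero h0, ← integral_const_mul]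
  refine norm_integral_le_of_norm_le (hw.const_mul M) ?_
  filter_upwards [ae_restrict_mem measurableSet_closedBall] with z hz using hb z hz

lemma continuous_integrable_mul {n : ℕ} {F : Type*} [NormedAddCommGroup F] [NormedSpace ℝ F]
    {f : E n → F} (hf : LocallyIntegrable f volume) {φ : E n → ℝ} (hφ : Continuous φ)
    (hc : HasCompactSupport φ) : Integrable (fun z => φ z • f z) volume :=
  hf.integrable_smul_left_of_hasCompactSupport hφ hc

lemma LocallyIntegrable.coord {n : ℕ} {G : E n → E n} (hG : LocallyIntegrable G volume)
    (i : Fin n) : LocallyIntegrable (fun x => G x i) volume := fun x => by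
  obtain ⟨s, hs, h⟩ := hG x
  exact ⟨s, hs, (EuclideanSpace.proj (𝕜 := ℝ) i : E n →L[ℝ] ℝ).integrable_comp h⟩

/-- Integration by parts moves the gradient onto the bump at the cost of one power of the radius;
the factor `n` comes from adding the coordinates. -/
lemma HasWeakGradient.norm_integral_bump_le {n : ℕ} {θ : E n → ℝ} {G : E n → E n}
    (h : HasWeakGradient θ G) (y : E n) {δ : ℝ} (hδ : 0 < δ) :
    ‖∫ z, bump y δ z • G z‖ ≤
      n * ((δ ^ (n + 1))⁻¹ * bumpConst n) * ∫ z in closedBall y δ, |θ z| := by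
  obtain ⟨hθ, hG, hw⟩ := h
  have hint : Integrable (fun z => bump y δ z • G z) volume :=
    continuous_integrable_mul hG (bump_contDiff y δ).continuous (bump_hasCompactSupport y hδ)
  refine (norm_le_sum_abs _).trans ?_
  have hle : ∀ i : Fin n, |(∫ z, bump y δ z • G z) i| ≤
      ((δ ^ (n + 1))⁻¹ * bumpConst n) * ∫ z in closedBall y δ, |θ z| := by
    intro i
    have h1 : (∫ z, bump y δ z • G z) i = ∫ z, G z i * bump y δ z := by
      have : ∫ z, bump y δ z * G z i = (∫ z, bump y δ z • G z) i :=
        (EuclideanSpace.proj (𝕜 := ℝ) i : E n →L[ℝ] ℝ).integral_comp_comm hint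
      rw [← this]; simp_rw [mul_comm]
    rw [h1, ← neg_neg (∫ z, G z i * bump y δ z), ← hw _ (bump_contDiff y δ)
      (bump_hasCompactSupport y hδ) i, abs_neg]
    rw [← Real.norm_eq_abs]
    refine norm_integral_le_of_eq_zero_off (w := fun z => |θ z|) y δ _
      (integrableOn_closedBall hθ y δ).norm
      (fun z hz => ?_) (fun z _ => ?_)
    · rw [fderiv_bump_eq_zero hδ hz]; simp
    · rw [norm_mul, mul_comm]
      refine mul_le_mul_of_nonneg_right ?_ (abs_nonneg _)
      refine (ContinuousLinearMap.le_opNorm _ _).trans ?_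
      simpa using norm_fderiv_bump_le y hδ z
  refine (Finset.sum_le_sum fun i _ => hle i).trans ?_
  rw [Finset.sum_const, Finset.card_univ, Fintype.card_fin, nsmul_eq_mul, ← mul_assoc]

/-! ### Variation of smooth averages with the radius. -/

/-- The derivative of `bump y δ z` in the radius. -/
def bumpDeriv {n : ℕ} (y : E n) (δ : ℝ) (z : E n) : ℝ :=
  -((δ ^ (n + 1))⁻¹ * (n * stdBump n (δ⁻¹ • (z - y)) +
    fderiv ℝ (stdBump n) (δ⁻¹ • (z - y)) (δ⁻¹ • (z - y))))

lemma hasDerivAt_bump {n : ℕ} (y z : E n) {δ : ℝ} (hδ : 0 < δ) :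
    HasDerivAt (fun δ => bump y δ z) (bumpDeriv y δ z) δ := by
  have h1 : HasDerivAt (fun δ : ℝ => (δ ^ n)⁻¹) (-(n * (δ ^ (n + 1))⁻¹)) δ := by
    refine ((hasDerivAt_pow n δ).fun_inv (by positivity)).congr_deriv ?_
    rcases n with _ | k
    · simp
    · simp only [Nat.add_sub_cancel]; field_simp; ring
  have h2 : HasDerivAt (fun δ : ℝ => δ⁻¹ • (z - y)) ((-(δ ^ 2)⁻¹) • (z - y)) δ :=
    (hasDerivAt_inv hδ.ne').smul_const _
  have h3 : HasFDerivAt (stdBump n) (fderiv ℝ (stdBump n) (δ⁻¹ • (z - y))) (δ⁻¹ • (z - y)) :=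
    ((stdBump_contDiff n).differentiable (by simp) _).hasFDerivAt
  have h4 : HasDerivAt (fun δ : ℝ => stdBump n (δ⁻¹ • (z - y)))
      (fderiv ℝ (stdBump n) (δ⁻¹ • (z - y)) ((-(δ ^ 2)⁻¹) • (z - y))) δ :=
    h3.comp_hasDerivAt δ h2
  have h5 : HasDerivAt (fun δ => bump y δ z) _ δ := h1.fun_mul h4
  refine h5.congr_deriv ?_
  simp only [bumpDeriv, map_smul, smul_eq_mul]
  field_simp
  ring

/-- The `i`-th component of the radial field whose divergence is minus the radial derivative of
the bump. -/
def radialField {n : ℕ} (y : E n) (δ : ℝ) (i : Fin n) (z : E n) : ℝ :=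
  (δ ^ n)⁻¹ * ((δ⁻¹ • (z - y)) i * stdBump n (δ⁻¹ • (z - y)))

lemma contDiff_coord_mul_stdBump {n : ℕ} (i : Fin n) :
    ContDiff ℝ ∞ (fun w : E n => w i * stdBump n w) :=
  (EuclideanSpace.proj (𝕜 := ℝ) i : E n →L[ℝ] ℝ).contDiff.mul (stdBump_contDiff n)

lemma radialField_contDiff {n : ℕ} (y : E n) (δ : ℝ) (i : Fin n) :
    ContDiff ℝ ∞ (radialField y δ i) :=
  contDiff_rescale (contDiff_coord_mul_stdBump i) y _ _

lemma radialField_eq_zero {n : ℕ} {y z : E n} {δ : ℝ} (hδ : 0 < δ) (i : Fin n)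
    (hz : z ∉ closedBall y δ) : radialField y δ i z = 0 := by
  rw [radialField, stdBump_eq_zero (one_lt_norm_rescale hδ hz), mul_zero, mul_zero]

lemma abs_radialField_le {n : ℕ} {y : E n} {δ : ℝ} (hδ : 0 < δ) (i : Fin n) (z : E n) :
    |radialField y δ i z| ≤ (δ ^ n)⁻¹ * bumpConst n := by
  by_cases hz : z ∈ closedBall y δ
  · have hw : ‖δ⁻¹ • (z - y)‖ ≤ 1 := by
      rw [norm_smul, norm_inv, Real.norm_of_nonneg hδ.le, inv_mul_le_one₀ hδ, ← dist_eq_norm]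
      exact hz
    rw [radialField, abs_mul, abs_mul, abs_of_pos (by positivity : 0 < (δ ^ n)⁻¹)]
    gcongr
    calc _ ≤ 1 * bumpConst n := by
          gcongr
          · exact (abs_apply_le_norm _ _).trans hw
          · exact abs_stdBump_le _
      _ = _ := one_mul _
  · rw [radialField_eq_zero hδ i hz, abs_zero]
    have := bumpConst_pos n; positivity

/-- With `w = (z - y) / δ` this is `div (w η) = n η + w · ∇η`, rescaled. -/
lemma sum_fderiv_radialField {n : ℕ} (y z : E n) (δ : ℝ) :
    ∑ i, fderiv ℝ (radialField y δ i) z (EuclideanSpace.single i 1) = -bumpDeriv y δ z := by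
  have h : ∀ i, fderiv ℝ (radialField y δ i) z (EuclideanSpace.single i 1) =
      (δ ^ (n + 1))⁻¹ * (stdBump n (δ⁻¹ • (z - y)) + (δ⁻¹ • (z - y)) i *
        fderiv ℝ (stdBump n) (δ⁻¹ • (z - y)) (EuclideanSpace.single i 1)) := by
    intro i
    have h1 := hasFDerivAt_rescale (contDiff_coord_mul_stdBump i) y (δ ^ n)⁻¹ δ z
    have h2 : HasFDerivAt (stdBump n) (fderiv ℝ (stdBump n) (δ⁻¹ • (z - y))) (δ⁻¹ • (z - y)) :=
      ((stdBump_contDiff n).differentiable (by simp) _).hasFDerivAt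
    have h3 := ((EuclideanSpace.proj (𝕜 := ℝ) i : E n →L[ℝ] ℝ).hasFDerivAt
      (x := δ⁻¹ • (z - y))).mul h2
    have h4 : fderiv ℝ (fun w : E n => w i * stdBump n w) (δ⁻¹ • (z - y)) = _ := h3.fderiv
    rw [h4] at h1
    rw [show radialField y δ i = fun z => (δ ^ n)⁻¹ * ((δ⁻¹ • (z - y)) i *
      stdBump n (δ⁻¹ • (z - y))) from rfl, h1.fderiv]
    simp [pow_succ]
    ring
  have hsum : ∀ (ℓ : E n →L[ℝ] ℝ) (w : E n), ∑ i, w i * ℓ (EuclideanSpace.single i 1) = ℓ w := by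
    intro ℓ w
    have hw : w = ∑ i, w i • EuclideanSpace.single i (1 : ℝ) := by
      ext j; simp [Finset.sum_apply, Pi.single_apply]
    conv_rhs => rw [hw]
    simp [map_sum]
  simp_rw [h]
  rw [← Finset.mul_sum, Finset.sum_add_distrib, hsum, bumpDeriv]
  simp

lemma bumpDeriv_eq_zero {n : ℕ} {y z : E n} {δ : ℝ} (hδ : 0 < δ) (hz : z ∉ closedBall y δ) :
    bumpDeriv y δ z = 0 := by
  rw [bumpDeriv, stdBump_eq_zero (one_lt_norm_rescale hδ hz),
    fderiv_stdBump_eq_zero (one_lt_norm_rescale hδ hz)]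
  simp

lemma abs_bumpDeriv_le {n : ℕ} (y z : E n) {δ : ℝ} (hδ : 0 < δ) :
    |bumpDeriv y δ z| ≤ (δ ^ (n + 1))⁻¹ * ((n + 1) * bumpConst n) := by
  have hC := bumpConst_pos n
  by_cases hz : z ∈ closedBall y δ
  · have hw : ‖δ⁻¹ • (z - y)‖ ≤ 1 := by
      rw [norm_smul, norm_inv, Real.norm_of_nonneg hδ.le, inv_mul_le_one₀ hδ, ← dist_eq_norm]
      exact hz
    rw [bumpDeriv, abs_neg, abs_mul, abs_of_pos (by positivity : 0 < (δ ^ (n + 1))⁻¹)]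
    gcongr
    refine (abs_add_le _ _).trans ?_
    rw [add_mul, one_mul, abs_mul, Nat.abs_cast]
    gcongr
    · exact abs_stdBump_le _
    · refine ((fderiv ℝ (stdBump n) (δ⁻¹ • (z - y))).le_opNorm _).trans ?_
      rw [← mul_one (bumpConst n)]
      exact mul_le_mul (norm_fderiv_stdBump_le _) hw (norm_nonneg _) hC.le
  · rw [bumpDeriv_eq_zero hδ hz, abs_zero]; positivity

lemma bumpDeriv_continuous {n : ℕ} (y : E n) (δ : ℝ) : Continuous (bumpDeriv y δ) := by
  have h1 := (stdBump_contDiff n).continuous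
  have h2 := (stdBump_contDiff n).continuous_fderiv (by simp)
  have h3 : Continuous fun z : E n => δ⁻¹ • (z - y) := by fun_prop
  unfold bumpDeriv
  exact (continuous_const.mul ((continuous_const.mul (h1.comp h3)).add
    ((h2.comp h3).clm_apply h3))).neg

/-- The smooth average of a function with a weak gradient is differentiable in the radius. -/
lemma HasWeakGradient.hasDerivAt_integral_bump {n : ℕ} {θ : E n → ℝ} {G : E n → E n}
    (h : HasWeakGradient θ G) (y : E n) {δ : ℝ} (hδ : 0 < δ) :
    HasDerivAt (fun δ => ∫ z, θ z * bump y δ z) (∑ i, ∫ z, G z i * radialField y δ i z) δ := by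
  obtain ⟨hθ, hG, hw⟩ := h
  have hC := bumpConst_pos n
  have hcs : ∀ i, HasCompactSupport (radialField y δ i) := fun i =>
    hasCompactSupport_of_eq_zero y δ fun z hz => radialField_eq_zero hδ i hz
  -- Differentiation under the integral produces `θ` against `bumpDeriv`. Since `bumpDeriv` is minus
  -- a divergence, integrating by parts leaves an expression in `G` alone.
  have hval : ∑ i, ∫ z, G z i * radialField y δ i z = ∫ z, θ z * bumpDeriv y δ z := by
    have h1 : ∀ i, ∫ z, G z i * radialField y δ i z =
        -∫ z, θ z * fderiv ℝ (radialField y δ i) z (EuclideanSpace.single i 1) := fun i => by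
      rw [hw _ (radialField_contDiff y δ i) (hcs i) i, neg_neg]
    simp_rw [h1]
    rw [Finset.sum_neg_distrib, ← integral_finsetSum, ← integral_neg]
    · congr 1; ext z
      rw [← Finset.mul_sum, sum_fderiv_radialField]; ring
    · intro i _
      have hc : HasCompactSupport fun z =>
          fderiv ℝ (radialField y δ i) z (EuclideanSpace.single i 1) :=
        ((hcs i).fderiv (𝕜 := ℝ)).comp_left (g := fun ℓ : E n →L[ℝ] ℝ =>
          ℓ (EuclideanSpace.single i 1)) rfl
      have hcont : Continuous fun z =>
          fderiv ℝ (radialField y δ i) z (EuclideanSpace.single i 1) :=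
        ((radialField_contDiff y δ i).continuous_fderiv (by simp)).clm_apply continuous_const
      simpa [mul_comm] using continuous_integrable_mul hθ hcont hc
  rw [hval]
  have hs : ball δ (δ / 2) ∈ 𝓝 δ := ball_mem_nhds _ (by positivity)
  have hmem : ∀ x ∈ ball δ (δ / 2), δ / 2 < x ∧ x < 2 * δ := fun x hx => by
    rw [mem_ball, Real.dist_eq, abs_lt] at hx
    constructor <;> linarith
  -- Radii near `δ` stay between `δ / 2` and `2 * δ`, which gives a uniform bound and a common
  -- support for the domination.
  set M := ((δ / 2) ^ (n + 1))⁻¹ * ((n + 1) * bumpConst n) with hM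
  have hM0 : 0 ≤ M := by positivity
  refine (hasDerivAt_integral_of_dominated_loc_of_deriv_le (F := fun δ z => θ z * bump y δ z)
    (F' := fun δ z => θ z * bumpDeriv y δ z) (bound := (closedBall y (2 * δ)).indicator fun z => M * |θ z|) hs ?_ ?_ ?_ ?_ ?_ ?_).2
  · exact Eventually.of_forall fun x => hθ.aestronglyMeasurable.mul
      (bump_contDiff y x).continuous.aestronglyMeasurable
  · simpa [mul_comm] using continuous_integrable_mul hθ (bump_contDiff y δ).continuous
      (bump_hasCompactSupport y hδ)
  · exact hθ.aestronglyMeasurable.mul (bumpDeriv_continuous y δ).aestronglyMeasurable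
  · refine Eventually.of_forall fun z x hx => ?_
    obtain ⟨h1, h2⟩ := hmem x hx
    have hx0 : 0 < x := by linarith
    by_cases hz : z ∈ closedBall y (2 * δ)
    · rw [indicator_of_mem hz, norm_mul, mul_comm, Real.norm_eq_abs, Real.norm_eq_abs]
      gcongr
      refine (abs_bumpDeriv_le y z hx0).trans ?_
      rw [hM]; gcongr
    · rw [indicator_of_notMem hz, bumpDeriv_eq_zero hx0, mul_zero, norm_zero]
      exact fun h => hz (closedBall_subset_closedBall h2.le h)
  · exact (integrable_indicator_iff measurableSet_closedBall).2
      ((integrableOn_closedBall hθ y (2 * δ)).norm.const_mul M)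
  · refine Eventually.of_forall fun z x hx => ?_
    exact (hasDerivAt_bump y z (by linarith [(hmem x hx).1])).const_mul (θ z)

lemma abs_sum_integral_radialField_le {n : ℕ} {G : E n → E n} (hG : LocallyIntegrable G volume)
    (y : E n) {δ : ℝ} (hδ : 0 < δ) :
    |∑ i, ∫ z, G z i * radialField y δ i z| ≤
      n * ((δ ^ n)⁻¹ * bumpConst n) * ∫ z in closedBall y δ, ‖G z‖ := by
  have hle : ∀ i, |∫ z, G z i * radialField y δ i z| ≤
      ((δ ^ n)⁻¹ * bumpConst n) * ∫ z in closedBall y δ, ‖G z‖ := by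
    intro i
    rw [← Real.norm_eq_abs]
    refine norm_integral_le_of_eq_zero_off (w := fun z => ‖G z‖) y δ _
      (integrableOn_closedBall hG y δ).norm (fun z hz => ?_) fun z _ => ?_
    · rw [radialField_eq_zero hδ i hz, mul_zero]
    · rw [norm_mul, mul_comm]
      exact mul_le_mul (abs_radialField_le hδ i z) (abs_apply_le_norm _ _) (norm_nonneg _)
        (by have := bumpConst_pos n; positivity)
  refine (Finset.abs_sum_le_sum_abs _ _).trans ((Finset.sum_le_sum fun i _ => hle i).trans ?_)
  rw [Finset.sum_const, Finset.card_univ, Fintype.card_fin, nsmul_eq_mul, ← mul_assoc]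

lemma ae_tendsto_integral_bump {n : ℕ} {θ : E n → ℝ} (hθ : LocallyIntegrable θ volume) :
    ∀ᵐ y, Tendsto (fun δ => ∫ z, θ z * bump y δ z) (𝓝[>] 0) (𝓝 (θ y)) := by
  filter_upwards [IsUnifLocDoublingMeasure.ae_tendsto_average_norm_sub
    (μ := (volume : Measure (E n))) hθ 1] with y hy
  have h1 := hy (fun _ => y) (fun δ => δ) tendsto_id (by
    filter_upwards [self_mem_nhdsWithin] with ρ hρ
    have : (0:ℝ) < ρ := hρ
    simpa using this.le)
  have hC := bumpConst_pos n
  have hV := unitVol_pos n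
  rw [tendsto_iff_norm_sub_tendsto_zero]
  have h2 := h1.const_mul (bumpConst n * unitVol n)
  rw [mul_zero] at h2
  refine squeeze_zero' (Eventually.of_forall fun _ => norm_nonneg _) ?_ h2
  filter_upwards [self_mem_nhdsWithin] with δ hδ
  have hδ : 0 < δ := hδ
  have hint : ∀ f : E n → ℝ, LocallyIntegrable f volume →
      Integrable (fun z => f z * bump y δ z) volume := fun f hf => by
    simpa [mul_comm] using continuous_integrable_mul hf (bump_contDiff y δ).continuous
      (bump_hasCompactSupport y hδ)
  have h3 : (∫ z, θ z * bump y δ z) - θ y = ∫ z, (θ z - θ y) * bump y δ z := by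
    simp_rw [sub_mul]
    rw [integral_sub (hint θ hθ) (hint _ (locallyIntegrable_const _)), integral_const_mul,
      integral_bump y hδ, mul_one]
  rw [h3]
  refine (norm_integral_le_of_eq_zero_off (w := fun z => ‖θ z - θ y‖) y δ
    ((δ ^ n)⁻¹ * bumpConst n) (integrableOn_closedBall_norm_sub hθ _ _ _) (fun z hz => ?_)
    fun z _ => ?_).trans_eq ?_
  · rw [bump_eq_zero hδ hz, mul_zero]
  · rw [norm_mul, mul_comm]
    gcongr; exact abs_bump_le y hδ z
  · rw [setAverage_eq, volume_real_closedBall _ hδ.le, smul_eq_mul]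
    field_simp

/-- The constant in `HasWeakGradient.abs_sub_integral_bump_le`. -/
def oscConst (n : ℕ) (C₁ : ℝ) : ℝ :=
  n * bumpConst n * 2 ^ n * unitVol n * (C₁ + 1 + 2 ^ n)

/-- Each halving moves the average by at most `2 ^ n * N`, so averages of a function of bounded mean
oscillation grow only logarithmically as the radius shrinks. -/
lemma BallOsc.norm_ballAvg_halving_le {n : ℕ} {G : E n → E n} {N : ℝ} (hN : 0 ≤ N)
    (h : BallOsc G N) (hG : LocallyIntegrable G volume) (y : E n) {ρ : ℝ} (hρ : 0 < ρ) {C₁ : ℝ}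
    (hC : ‖ballAvg G y ρ‖ ≤ C₁ * N) (k : ℕ) :
    ‖ballAvg G y (ρ / 2 ^ k)‖ ≤ (C₁ + k * 2 ^ n) * N := by
  induction k with
  | zero => simpa using hC
  | succ k ih =>
    have h1 : 0 < ρ / 2 ^ k := by positivity
    have h2 : 0 < ρ / 2 ^ (k + 1) := by positivity
    have h3 := norm_ballAvg_sub_ballAvg_le hN h hG (x := y) (y := y) h1 h2
      (closedBall_subset_closedBall (by
        rw [pow_succ]
        exact div_le_div_of_nonneg_left hρ.le (by positivity) (by nlinarith [pow_pos (two_pos (α := ℝ)) k])))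
    rw [show ρ / 2 ^ k / (ρ / 2 ^ (k + 1)) = 2 by field_simp; ring] at h3
    have h4 := norm_le_insert' (ballAvg G y (ρ / 2 ^ (k + 1))) (ballAvg G y (ρ / 2 ^ k))
    push_cast
    linarith

lemma BallOsc.integral_norm_le {n : ℕ} {G : E n → E n} {N : ℝ} (hN : 0 ≤ N)
    (h : BallOsc G N) (hG : LocallyIntegrable G volume) (y : E n) {ρ : ℝ} (hρ : 0 < ρ) {C₁ : ℝ}
    (hC : ‖ballAvg G y ρ‖ ≤ C₁ * N) :
    ∫ z in closedBall y ρ, ‖G z‖ ≤ (C₁ + 1) * N * volume.real (closedBall y ρ) := by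
  calc _ ≤ ∫ z in closedBall y ρ, (‖G z - ballAvg G y ρ‖ + C₁ * N) := by
        refine integral_mono (integrableOn_closedBall hG _ _).norm
          ((integrableOn_closedBall_norm_sub hG _ _ _).add
            (integrableOn_const measure_closedBall_lt_top.ne)) fun z => ?_
        have := norm_le_insert' (G z) (ballAvg G y ρ)
        dsimp only
        linarith
    _ = (∫ z in closedBall y ρ, ‖G z - ballAvg G y ρ‖) +
        volume.real (closedBall y ρ) * (C₁ * N) := by
        rw [integral_add (integrableOn_closedBall_norm_sub hG _ _ _)
          (integrableOn_const measure_closedBall_lt_top.ne), setIntegral_const, smul_eq_mul]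
    _ ≤ _ := by
        have := h.integral_le hN hG y hρ
        linarith

/-- A function whose gradient has bounded mean oscillation is close to its smooth averages. -/
lemma HasWeakGradient.abs_sub_integral_bump_le {n : ℕ} {θ : E n → ℝ} {G : E n → E n}
    (h : HasWeakGradient θ G) {N : ℝ} (hN : 0 ≤ N) (hosc : BallOsc G N) {y : E n}
    (hy : Tendsto (fun δ => ∫ z, θ z * bump y δ z) (𝓝[>] 0) (𝓝 (θ y))) {ρ : ℝ} (hρ : 0 < ρ)
    {C₁ : ℝ} (hC₁ : 0 ≤ C₁) (hC : ‖ballAvg G y ρ‖ ≤ C₁ * N) :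
    |θ y - ∫ z, θ z * bump y ρ z| ≤ oscConst n C₁ * ρ * N := by
  have hC0 := bumpConst_pos n
  have hV := unitVol_pos n
  set a : ℝ → ℝ := fun δ => ∫ z, θ z * bump y δ z with ha
  set D := n * bumpConst n * 2 ^ n * unitVol n with hD
  have hD0 : 0 ≤ D := by positivity
  -- On the dyadic range the radial derivative is `O((C₁ + 1 + k * 2 ^ n) N)`; the linear growth in
  -- `k` is summable against the length `ρ / 2 ^ (k + 1)`.
  have hstep : ∀ k : ℕ, |a (ρ / 2 ^ (k + 1)) - a (ρ / 2 ^ k)| ≤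
      D * (C₁ + 1 + k * 2 ^ n) * N * (ρ / 2 ^ (k + 1)) := by
    intro k
    have hk1 : 0 < ρ / 2 ^ (k + 1) := by positivity
    have hk : ρ / 2 ^ k = 2 * (ρ / 2 ^ (k + 1)) := by rw [pow_succ]; field_simp
    have hk0 : 0 < ρ / 2 ^ k := by positivity
    have hI : ∫ z in closedBall y (ρ / 2 ^ k), ‖G z‖ ≤
        (C₁ + k * 2 ^ n + 1) * N * ((ρ / 2 ^ k) ^ n * unitVol n) := by
      rw [← volume_real_closedBall y hk0.le]
      exact hosc.integral_norm_le hN h.2.1 y hk0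
        (hosc.norm_ballAvg_halving_le hN h.2.1 y hρ hC k)
    have hder : ∀ δ ∈ Icc (ρ / 2 ^ (k + 1)) (ρ / 2 ^ k),
        ‖∑ i, ∫ z, G z i * radialField y δ i z‖ ≤ D * (C₁ + 1 + k * 2 ^ n) * N := by
      rintro δ ⟨h1, h2⟩
      have hδ : 0 < δ := hk1.trans_le h1
      refine (abs_sum_integral_radialField_le h.2.1 y hδ).trans ?_
      have h3 : ∫ z in closedBall y δ, ‖G z‖ ≤ ∫ z in closedBall y (ρ / 2 ^ k), ‖G z‖ :=
        setIntegral_mono_set (integrableOn_closedBall h.2.1 _ _).norm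
          (by filter_upwards with z using norm_nonneg _)
          (closedBall_subset_closedBall h2).eventuallyLE
      calc _ ≤ n * (((ρ / 2 ^ (k + 1)) ^ n)⁻¹ * bumpConst n) *
            ((C₁ + k * 2 ^ n + 1) * N * ((ρ / 2 ^ k) ^ n * unitVol n)) := by
            gcongr
            exact h3.trans hI
        _ = _ := by rw [hk, mul_pow, hD]; field_simp; ring
    have hmv := (convex_Icc (ρ / 2 ^ (k + 1)) (ρ / 2 ^ k)).norm_image_sub_le_of_norm_hasDerivWithin_le
      (f := a) (fun δ hδ => (h.hasDerivAt_integral_bump y (hk1.trans_le hδ.1)).hasDerivWithinAt)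
      hder (right_mem_Icc.2 (by linarith)) (left_mem_Icc.2 (by linarith))
    refine hmv.trans_eq ?_
    rw [Real.norm_eq_abs, abs_sub_comm, abs_of_nonneg (by linarith), hk]
    ring
  -- The bracket is the closed form of the sum of `(C₁ + 1 + k * 2 ^ n) / 2 ^ (k + 1)` over `k < m`.
  have hsum : ∀ m : ℕ, |a (ρ / 2 ^ m) - a ρ| ≤ D * N * ρ *
      (C₁ + 1 + 2 ^ n - (C₁ + 1 + 2 ^ n + m * 2 ^ n) / 2 ^ m) := by
    intro m
    induction m with
    | zero => simp
    | succ m ih =>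
      have h1 := abs_sub_le (a (ρ / 2 ^ (m + 1))) (a (ρ / 2 ^ m)) (a ρ)
      refine (h1.trans (add_le_add (hstep m) ih)).trans_eq ?_
      push_cast
      field_simp
      ring
  have hlim : Tendsto (fun m : ℕ => ρ / 2 ^ m) atTop (𝓝[>] 0) := by
    refine tendsto_nhdsWithin_iff.2 ⟨?_, Eventually.of_forall fun m => by
      show 0 < ρ / 2 ^ m; positivity⟩
    have := (tendsto_pow_atTop_nhds_zero_of_lt_one (r := (1/2:ℝ)) (by norm_num) (by norm_num)).const_mul ρ
    simpa [div_eq_mul_inv] using this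
  have hlim2 : Tendsto (fun m : ℕ => |a (ρ / 2 ^ m) - a ρ|) atTop (𝓝 |θ y - a ρ|) :=
    ((hy.comp hlim).sub_const _).abs
  refine le_of_tendsto hlim2 (Eventually.of_forall fun m => (hsum m).trans ?_)
  have h5 : 0 ≤ (C₁ + 1 + 2 ^ n + m * 2 ^ n) / 2 ^ m := by positivity
  calc _ ≤ D * N * ρ * (C₁ + 1 + 2 ^ n) := by gcongr; linarith
    _ = _ := by rw [oscConst, hD]; ring

/-! ### Pointwise bounds from small local mass. -/

section
variable {n : ℕ}

/-- The hypothesis says that `θ` has mean square size at most of order `N * ρ` on the ball. Young's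
inequality `|θ| ≤ θ² / (2 N ρ) + N ρ / 2` is integrated. -/
lemma integral_abs_le_of_integral_sq_le {θ : E n → ℝ} (hθ : LocallyIntegrable θ volume)
    (hθ2 : Integrable (fun y => θ y ^ 2) volume) {N ρ : ℝ} (hN : 0 < N) (hρ : 0 < ρ) {x : E n}
    (hw : ∫ y in closedBall x ρ, θ y ^ 2 ≤ N ^ 2 * ρ ^ (n + 2)) :
    ∫ y in closedBall x ρ, |θ y| ≤ (1 + unitVol n) / 2 * (N * ρ ^ (n + 1)) := by
  have hs : 0 < N * ρ := by positivity
  have hV := unitVol_pos n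
  calc _ ≤ ∫ y in closedBall x ρ, ((2 * (N * ρ))⁻¹ * θ y ^ 2 + N * ρ / 2) := by
        refine integral_mono (integrableOn_closedBall hθ _ _).norm
          ((hθ2.integrableOn.const_mul _).add
            (integrableOn_const measure_closedBall_lt_top.ne)) fun y => ?_
        dsimp only
        rw [← sq_abs, ← sub_nonneg]
        have : (2 * (N * ρ))⁻¹ * |θ y| ^ 2 + N * ρ / 2 - |θ y| =
          (2 * (N * ρ))⁻¹ * (|θ y| - N * ρ) ^ 2 := by field_simp; ring
        rw [this]; positivity
    _ = (2 * (N * ρ))⁻¹ * (∫ y in closedBall x ρ, θ y ^ 2) +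
        ρ ^ n * unitVol n * (N * ρ / 2) := by
        rw [integral_add (hθ2.integrableOn.const_mul _)
          (integrableOn_const measure_closedBall_lt_top.ne), setIntegral_const, smul_eq_mul,
          integral_const_mul, volume_real_closedBall x hρ.le]
    _ ≤ (2 * (N * ρ))⁻¹ * (N ^ 2 * ρ ^ (n + 2)) + ρ ^ n * unitVol n * (N * ρ / 2) := by gcongr
    _ = _ := by field_simp; ring

/-- The constant in `HasWeakGradient.norm_ballAvg_le`. -/
def avgConst (n : ℕ) : ℝ := n * bumpConst n * ((1 + unitVol n) / 2) + bumpConst n * unitVol n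

lemma avgConst_pos (n : ℕ) : 0 < avgConst n := by
  have := unitVol_pos n; have := bumpConst_pos n; unfold avgConst; positivity

/-- A gradient with a large average would force `θ` to be large. The smooth average of `G` is
bounded by integration by parts, and its distance to the plain average by the oscillation. -/
lemma HasWeakGradient.norm_ballAvg_le {θ : E n → ℝ} {G : E n → E n} (h : HasWeakGradient θ G)
    (hθ2 : Integrable (fun y => θ y ^ 2) volume) {N ρ : ℝ} (hN : 0 < N) (hosc : BallOsc G N)
    (hρ : 0 < ρ) {x : E n} (hw : ∫ y in closedBall x ρ, θ y ^ 2 ≤ N ^ 2 * ρ ^ (n + 2)) :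
    ‖ballAvg G x ρ‖ ≤ avgConst n * N := by
  have hC := bumpConst_pos n
  have hV := unitVol_pos n
  have hint : ∀ f : E n → E n, LocallyIntegrable f volume →
      Integrable (fun z => bump x ρ z • f z) volume := fun f hf =>
    continuous_integrable_mul hf (bump_contDiff x ρ).continuous (bump_hasCompactSupport x hρ)
  have h1 : ‖∫ z, bump x ρ z • G z‖ ≤ n * bumpConst n * ((1 + unitVol n) / 2) * N := by
    refine (h.norm_integral_bump_le x hρ).trans ?_
    calc _ ≤ n * ((ρ ^ (n + 1))⁻¹ * bumpConst n) * ((1 + unitVol n) / 2 * (N * ρ ^ (n + 1))) := by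
          gcongr; exact integral_abs_le_of_integral_sq_le h.1 hθ2 hN hρ hw
      _ = _ := by field_simp
  have h2 : ‖(∫ z, bump x ρ z • G z) - ballAvg G x ρ‖ ≤ bumpConst n * unitVol n * N := by
    have h3 : (∫ z, bump x ρ z • G z) - ballAvg G x ρ =
        ∫ z, bump x ρ z • (G z - ballAvg G x ρ) := by
      simp_rw [smul_sub]
      rw [integral_sub (hint _ h.2.1) (hint _ (locallyIntegrable_const _)), integral_smul_const,
        integral_bump x hρ, one_smul]
    rw [h3]
    refine (norm_integral_le_of_eq_zero_off (w := fun z => ‖G z - ballAvg G x ρ‖) x ρ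
      ((ρ ^ n)⁻¹ * bumpConst n) (integrableOn_closedBall_norm_sub h.2.1 _ _ _) (fun z hz => ?_)
      fun z _ => ?_).trans ?_
    · rw [bump_eq_zero hρ hz, zero_smul]
    · rw [norm_smul]
      gcongr; exact abs_bump_le x hρ z
    · calc _ ≤ (ρ ^ n)⁻¹ * bumpConst n * (N * (ρ ^ n * unitVol n)) := by
            rw [← volume_real_closedBall x hρ.le]
            gcongr; exact hosc.integral_le hN.le h.2.1 x hρ
        _ = _ := by field_simp
  have h4 := norm_le_insert (∫ z, bump x ρ z • G z) (ballAvg G x ρ)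
  rw [avgConst, add_mul]
  linarith

/-- The constant in `HasWeakGradient.abs_le_of_integral_sq_le`. -/
def supConst (n : ℕ) : ℝ :=
  oscConst n (avgConst n + 2 ^ n) / 2 + 2 ^ n * bumpConst n * ((1 + unitVol n) / 2)

lemma supConst_pos (n : ℕ) : 0 < supConst n := by
  have := unitVol_pos n; have := bumpConst_pos n; have := avgConst_pos n
  unfold supConst oscConst; positivity

/-- At a Lebesgue point `y` of the half ball, `θ y` is compared with its smooth average at radius `ρ
/ 2`. That average is controlled by the mass, and the difference by the oscillation of `G` together
with its average. -/
lemma HasWeakGradient.abs_le_of_integral_sq_le {θ : E n → ℝ} {G : E n → E n}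
    (h : HasWeakGradient θ G) (hθ2 : Integrable (fun y => θ y ^ 2) volume) {N ρ : ℝ} (hN : 0 < N)
    (hosc : BallOsc G N) (hρ : 0 < ρ) {x : E n}
    (hw : ∫ y in closedBall x ρ, θ y ^ 2 ≤ N ^ 2 * ρ ^ (n + 2)) {y : E n}
    (hy : Tendsto (fun δ => ∫ z, θ z * bump y δ z) (𝓝[>] 0) (𝓝 (θ y)))
    (hyx : y ∈ closedBall x (ρ / 2)) : |θ y| ≤ supConst n * (ρ * N) := by
  have hC := bumpConst_pos n
  have hV := unitVol_pos n
  have hρ2 : 0 < ρ / 2 := by positivity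
  have hsub : closedBall y (ρ / 2) ⊆ closedBall x ρ := by
    refine closedBall_subset_closedBall' ?_
    have := mem_closedBall.1 hyx
    linarith
  have h1 : ‖ballAvg G y (ρ / 2)‖ ≤ (avgConst n + 2 ^ n) * N := by
    have h2 := norm_ballAvg_sub_ballAvg_le hN.le hosc h.2.1 hρ hρ2 hsub
    rw [show ρ / (ρ / 2) = 2 by field_simp] at h2
    have h3 := h.norm_ballAvg_le hθ2 hN hosc hρ hw
    have h4 := norm_le_insert' (ballAvg G y (ρ / 2)) (ballAvg G x ρ)
    linarith
  have h2 := h.abs_sub_integral_bump_le hN.le hosc hy hρ2 (by have := avgConst_pos n; positivity) h1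
  have h3 : |∫ z, θ z * bump y (ρ / 2) z| ≤
      2 ^ n * bumpConst n * ((1 + unitVol n) / 2) * (ρ * N) := by
    rw [← Real.norm_eq_abs]
    refine (norm_integral_le_of_eq_zero_off (w := fun z => |θ z|) y (ρ / 2)
      (((ρ / 2) ^ n)⁻¹ * bumpConst n) (integrableOn_closedBall h.1 _ _).norm (fun z hz => ?_)
      fun z _ => ?_).trans ?_
    · rw [bump_eq_zero hρ2 hz, mul_zero]
    · rw [norm_mul, mul_comm]
      exact mul_le_mul_of_nonneg_right (abs_bump_le y hρ2 z) (abs_nonneg _)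
    · have h5 : ∫ z in closedBall y (ρ / 2), |θ z| ≤ ∫ z in closedBall x ρ, |θ z| :=
        setIntegral_mono_set (integrableOn_closedBall h.1 _ _).norm
          (by filter_upwards with z using abs_nonneg _) hsub.eventuallyLE
      calc _ ≤ ((ρ / 2) ^ n)⁻¹ * bumpConst n * ((1 + unitVol n) / 2 * (N * ρ ^ (n + 1))) := by
            gcongr
            exact h5.trans (integral_abs_le_of_integral_sq_le h.1 hθ2 hN hρ hw)
        _ = _ := by rw [div_pow]; field_simp; ring
  have h6 := abs_sub_abs_le_abs_sub (θ y) (∫ z, θ z * bump y (ρ / 2) z)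
  calc |θ y| ≤ oscConst n (avgConst n + 2 ^ n) * (ρ / 2) * N +
        2 ^ n * bumpConst n * ((1 + unitVol n) / 2) * (ρ * N) := by linarith
    _ = _ := by rw [supConst]; ring

/-- The constant in `lintegral_level_ball_le`. -/
def levelConst (n : ℕ) : ℝ :=
  supConst n ^ 2 * (64 / jnRate n ^ 2 * Real.exp (jnRate n * avgConst n)) * unitVol n

lemma levelConst_pos (n : ℕ) : 0 < levelConst n := by
  have := unitVol_pos n; have := supConst_pos n; have := jnRate_pos n
  unfold levelConst; positivity

/-- The bound `|θ| ≤ C ρ N` comes out of the integral over the half ball. The tail of `G'` on the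
full ball is `O(e^{-cL} N² ρ^n)` by John–Nirenberg, since its average is `O(N)`. -/
lemma lintegral_level_ball_le {θ θ' : E n → ℝ} {G G' : E n → E n} (h : HasWeakGradient θ G)
    (h' : HasWeakGradient θ' G') (hθ : Integrable (fun y => θ y ^ 2) volume)
    (hθ' : Integrable (fun y => θ' y ^ 2) volume) {N ρ : ℝ} (hN : 0 < N)
    (hosc : BallOsc G N) (hosc' : BallOsc G' N) (hρ : 0 < ρ) {x : E n}
    (hw : ∫ y in closedBall x ρ, (θ y ^ 2 + θ' y ^ 2) ≤ N ^ 2 * ρ ^ (n + 2)) (L : ℝ) :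
    ∫⁻ y in closedBall x (ρ / 2),
        {y | L * N < ‖G' y‖}.indicator (fun y => ‖θ y‖ₑ ^ 2 * ‖G' y‖ₑ ^ 2) y ≤
      ENNReal.ofReal (levelConst n * Real.exp (-(jnRate n / 2 * L)) * N ^ 2 *
        (N ^ 2 * ρ ^ (n + 2))) := by
  have hS := supConst_pos n
  have hV := unitVol_pos n
  have hc := jnRate_pos n
  have hw1 : ∫ y in closedBall x ρ, θ y ^ 2 ≤ N ^ 2 * ρ ^ (n + 2) :=
    (integral_mono hθ.integrableOn (hθ.add hθ').integrableOn
      fun y => le_add_of_nonneg_right (sq_nonneg _)).trans hw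
  have hw2 : ∫ y in closedBall x ρ, θ' y ^ 2 ≤ N ^ 2 * ρ ^ (n + 2) :=
    (integral_mono hθ'.integrableOn (hθ.add hθ').integrableOn
      fun y => le_add_of_nonneg_left (sq_nonneg _)).trans hw
  have havg := h'.norm_ballAvg_le hθ' hN hosc' hρ hw2
  calc _ ≤ ∫⁻ y in closedBall x (ρ / 2), ENNReal.ofReal ((supConst n * (ρ * N)) ^ 2) *
        {y | L * N < ‖G' y‖}.indicator (fun y => ‖G' y‖ₑ ^ 2) y := by
        refine lintegral_mono_ae ?_
        filter_upwards [ae_restrict_mem measurableSet_closedBall,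
          ae_restrict_of_ae (ae_tendsto_integral_bump h.1)] with y hy hyl
        by_cases hl : L * N < ‖G' y‖
        · rw [indicator_of_mem (by exact hl), indicator_of_mem (by exact hl)]
          gcongr
          rw [← ofReal_norm, ← ENNReal.ofReal_pow (norm_nonneg _)]
          refine ENNReal.ofReal_le_ofReal (pow_le_pow_left₀ (norm_nonneg _) ?_ 2)
          exact h.abs_le_of_integral_sq_le hθ hN hosc hρ hw1 hyl hy
        · rw [indicator_of_notMem (by exact hl), indicator_of_notMem (by exact hl), mul_zero]
    _ = ENNReal.ofReal ((supConst n * (ρ * N)) ^ 2) * ∫⁻ y in closedBall x (ρ / 2),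
        {y | L * N < ‖G' y‖}.indicator (fun y => ‖G' y‖ₑ ^ 2) y :=
        lintegral_const_mul' _ _ ENNReal.ofReal_ne_top
    _ ≤ ENNReal.ofReal ((supConst n * (ρ * N)) ^ 2) * ∫⁻ y in closedBall x ρ,
        {y | L * N < ‖G' y‖}.indicator (fun y => ‖G' y‖ₑ ^ 2) y := by
        exact mul_le_mul' le_rfl (lintegral_mono_set (closedBall_subset_closedBall (by linarith)))
    _ ≤ ENNReal.ofReal ((supConst n * (ρ * N)) ^ 2) *
        (ENNReal.ofReal (64 / jnRate n ^ 2 * Real.exp (jnRate n * avgConst n) *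
        Real.exp (-(jnRate n / 2 * L)) * N ^ 2) * volume (closedBall x ρ)) := by
        gcongr; exact hosc'.lintegral_sq_level_le hN h'.2.1 x hρ havg L
    _ = _ := by
        rw [volume_closedBall_eq x hρ.le, ← ENNReal.ofReal_mul (by positivity),
          ← ENNReal.ofReal_mul (by positivity), levelConst]
        congr 1; ring

end

/-! ### The global tail estimate by a Vitali covering. -/

section
variable {n : ℕ}

/-- The contribution of the set where `∇θ'` is large is exponentially small. -/
theorem lintegral_level_le {θ θ' : E n → ℝ} {G G' : E n → E n} (h : HasWeakGradient θ G)
    (h' : HasWeakGradient θ' G') (hθ : Integrable (fun y => θ y ^ 2) volume)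
    (hθ' : Integrable (fun y => θ' y ^ 2) volume) {N : ℝ} (hN : 0 < N)
    (hosc : BallOsc G N) (hosc' : BallOsc G' N) (L : ℝ) :
    ∫⁻ y, {y | L * N < ‖G' y‖}.indicator (fun y => ‖θ y‖ₑ ^ 2 * ‖G' y‖ₑ ^ 2) y ≤
      ENNReal.ofReal (levelConst n * 10 ^ (n + 2) * Real.exp (-(jnRate n / 2 * L)) * N ^ 2 *
        ∫ y, (θ y ^ 2 + θ' y ^ 2)) := by
  have hV := unitVol_pos n
  have hK := levelConst_pos n
  set w : E n → ℝ := fun y => θ y ^ 2 + θ' y ^ 2 with hwdef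
  have hw : Integrable w volume := hθ.add hθ'
  have hw0 : ∀ y, 0 ≤ w y := fun y => by positivity
  set I := ∫ y, w y with hI
  set Φ : E n → ℝ≥0∞ := {y | L * N < ‖G' y‖}.indicator (fun y => ‖θ y‖ₑ ^ 2 * ‖G' y‖ₑ ^ 2) with hΦ
  obtain ⟨D, hD, hD0⟩ : ∃ D : Set (E n), (∀ y ∈ Dᶜ, Tendsto (fun ρ =>
      ⨍ z in closedBall y ρ, w z) (𝓝[>] 0) (𝓝 (w y))) ∧ volume D = 0 := by
    refine ⟨{y | ¬ Tendsto (fun ρ => ⨍ z in closedBall y ρ, w z) (𝓝[>] 0)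
      (𝓝 (w y))}, fun y hy => not_not.1 hy, ?_⟩
    refine measure_mono_null (fun y hy => ?_) (ae_iff.1
      (IsUnifLocDoublingMeasure.ae_tendsto_average (μ := (volume : Measure (E n)))
        hw.locallyIntegrable 1))
    simp only [mem_ofPred_eq] at hy ⊢
    intro h
    refine hy (h (fun _ => y) (fun ρ => ρ) tendsto_id ?_)
    filter_upwards [self_mem_nhdsWithin] with ρ hρ
    have : (0:ℝ) < ρ := hρ
    simpa using this.le
  set S := {y | θ y ≠ 0} \ D with hS
  -- At these radii the ball carries at least the threshold mass; far above the chosen radius the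
  -- opposite holds. Both sides are needed: the local estimate wants little mass, the summation
  -- wants enough.
  let P : E n → Set ℝ := fun y => {ρ | 0 < ρ ∧ N ^ 2 * ρ ^ (n + 2) ≤ ∫ z in closedBall y ρ, w z}
  -- The total mass is finite and `ρ ≤ ρ ^ (n + 2)` for `ρ ≥ 1`; the summand `1` covers small radii.
  have hPb : ∀ y, ∀ ρ ∈ P y, ρ ≤ 1 + I / N ^ 2 := by
    rintro y ρ ⟨hρ0, hρ⟩
    have h1 : ∫ z in closedBall y ρ, w z ≤ I :=
      setIntegral_le_integral hw (by filter_upwards with y using hw0 y)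
    have hI0 : 0 ≤ I := integral_nonneg hw0
    rcases le_or_gt ρ 1 with hρ1 | hρ1
    · have : 0 ≤ I / N ^ 2 := by positivity
      linarith
    · have h2 : ρ ≤ ρ ^ (n + 2) := le_self_pow₀ hρ1.le (by omega)
      have h3 : ρ ^ (n + 2) ≤ I / N ^ 2 := by
        rw [le_div_iff₀ (by positivity)]; linarith
      linarith
  have hPne : ∀ y ∈ S, (P y).Nonempty := by
    rintro y ⟨hy, hyD⟩
    have hwy : 0 < w y := by
      have : 0 < θ y ^ 2 := by have : θ y ≠ 0 := hy; positivity
      have h2 : 0 ≤ θ' y ^ 2 := sq_nonneg _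
      simp only [hwdef]; linarith
    have h1 := (hD y hyD).eventually (lt_mem_nhds (half_lt_self hwy))
    -- At a Lebesgue point where `w > 0` the mass behaves like `ρ ^ n`, which dominates `ρ ^ (n +
    -- 2)` as `ρ → 0`.
    have h2 : ∀ᶠ ρ in 𝓝[>] (0:ℝ), N ^ 2 * ρ ^ 2 < w y / 2 * unitVol n := by
      have : Tendsto (fun ρ : ℝ => N ^ 2 * ρ ^ 2) (𝓝[>] 0) (𝓝 (N ^ 2 * 0 ^ 2)) :=
        (Continuous.tendsto (by fun_prop) 0).mono_left nhdsWithin_le_nhds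
      exact this.eventually (gt_mem_nhds (by simp; positivity))
    obtain ⟨ρ, h1ρ, h2ρ, h3ρ⟩ := (h1.and (h2.and self_mem_nhdsWithin)).exists
    have h3ρ : 0 < ρ := h3ρ
    have hv := volume_real_closedBall_pos y h3ρ
    refine ⟨ρ, h3ρ, ?_⟩
    rw [setAverage_eq, smul_eq_mul, ← div_eq_inv_mul, lt_div_iff₀ hv,
      volume_real_closedBall _ h3ρ.le] at h1ρ
    refine le_trans ?_ h1ρ.le
    calc N ^ 2 * ρ ^ (n + 2) = (N ^ 2 * ρ ^ 2) * ρ ^ n := by ring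
      _ ≤ (w y / 2 * unitVol n) * ρ ^ n := by gcongr
      _ = _ := by ring
  have hch : ∀ y, ∃ ρ, y ∈ S → ρ ∈ P y ∧ ∀ ρ' ∈ P y, ρ' ≤ 2 * ρ := by
    intro y
    by_cases hy : y ∈ S
    · obtain ⟨ρ, h1, h2⟩ := exists_mem_forall_le_two_mul (hPne y hy) (fun ρ hρ => hρ.1)
        ⟨_, fun ρ hρ => hPb y ρ hρ⟩
      exact ⟨ρ, fun _ => ⟨h1, h2⟩⟩
    · exact ⟨0, fun h => absurd h hy⟩
  choose ρ hρ using hch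
  obtain ⟨u, huS, hudisj, hucov⟩ :=
    Vitali.exists_disjoint_subfamily_covering_enlargement_closedBall S (fun y => y) ρ _
      (fun y hy => hPb y _ (hρ y hy).1) 5 (by norm_num)
  have hu0 : ∀ y ∈ u, 0 < ρ y := fun y hy => (hρ y (huS hy)).1.1
  have hucount : u.Countable := by
    refine hudisj.countable_of_nonempty_interior fun y hy => ?_
    exact (nonempty_ball.2 (hu0 y hy)).mono ball_subset_interior_closedBall
  set c := levelConst n * Real.exp (-(jnRate n / 2 * L)) * N ^ 2 with hc
  have hc0 : 0 ≤ c := by positivity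
  have hball : ∀ y ∈ u, ∫⁻ z in closedBall y (5 * ρ y), Φ z ≤
      ENNReal.ofReal (c * 10 ^ (n + 2)) * ∫⁻ z in closedBall y (ρ y), ENNReal.ofReal (w z) := by
    intro y hy
    have hy0 := hu0 y hy
    have h10 : 0 < 10 * ρ y := by linarith
    -- The radius `10 * ρ y` is above the threshold, and its half is exactly the Vitali radius `5 *
    -- ρ y`.
    have hnot : 10 * ρ y ∉ P y := fun hmem => by
      have := (hρ y (huS hy)).2 _ hmem
      linarith
    have h1 : ∫ z in closedBall y (10 * ρ y), w z ≤ N ^ 2 * (10 * ρ y) ^ (n + 2) := by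
      by_contra! hcon
      exact hnot ⟨h10, hcon.le⟩
    have h2 := lintegral_level_ball_le h h' hθ hθ' hN hosc hosc' h10 h1 L
    rw [show 10 * ρ y / 2 = 5 * ρ y by ring] at h2
    refine h2.trans ?_
    rw [← ofReal_integral_eq_lintegral_ofReal hw.integrableOn
      (by filter_upwards with y using hw0 y), ← ENNReal.ofReal_mul (by positivity)]
    refine ENNReal.ofReal_le_ofReal ?_
    calc _ = c * 10 ^ (n + 2) * (N ^ 2 * ρ y ^ (n + 2)) := by rw [hc, mul_pow]; ring
      _ ≤ _ := by gcongr; exact (hρ y (huS hy)).1.2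
  -- Points with `θ y = 0` contribute nothing, so only `S` and a null set have to be covered.
  have hcov : ∀ᵐ y, Φ y ≤ ∑' x : u, (closedBall (x : E n) (5 * ρ x)).indicator Φ y := by
    filter_upwards [measure_eq_zero_iff_ae_notMem.1 hD0] with y hyD
    by_cases hy : θ y = 0
    · have : Φ y = 0 := by simp [hΦ, indicator, hy]
      rw [this]; exact zero_le
    · have hyS : y ∈ S := ⟨hy, hyD⟩
      obtain ⟨x, hxu, hyx⟩ := hucov y hyS
      have h0 := (hρ y hyS).1.1
      refine le_trans ?_ (ENNReal.le_tsum ⟨x, hxu⟩)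
      rw [indicator_of_mem (hyx (mem_closedBall_self h0.le))]
  have : Countable u := hucount.to_subtype
  have hΦm : AEMeasurable Φ volume := by
    have hG := h'.2.1.aestronglyMeasurable
    have h1 : NullMeasurableSet {y | L * N < ‖G' y‖} volume :=
      nullMeasurableSet_lt aemeasurable_const hG.norm.aemeasurable
    exact ((h.1.aestronglyMeasurable.enorm.pow_const 2).mul (hG.enorm.pow_const 2)).indicator₀ h1
  calc ∫⁻ y, Φ y ≤ ∫⁻ y, ∑' x : u, (closedBall (x : E n) (5 * ρ x)).indicator Φ y :=
        lintegral_mono_ae hcov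
    _ = ∑' x : u, ∫⁻ y in closedBall (x : E n) (5 * ρ x), Φ y := by
        rw [lintegral_tsum fun x => hΦm.indicator measurableSet_closedBall]
        exact tsum_congr fun x => lintegral_indicator measurableSet_closedBall _
    _ ≤ ∑' x : u, ENNReal.ofReal (c * 10 ^ (n + 2)) *
        ∫⁻ z in closedBall (x : E n) (ρ x), ENNReal.ofReal (w z) :=
        ENNReal.tsum_le_tsum fun x => hball x x.2
    _ = ENNReal.ofReal (c * 10 ^ (n + 2)) *
        ∫⁻ z in ⋃ x ∈ u, closedBall (x : E n) (ρ x), ENNReal.ofReal (w z) := by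
        rw [ENNReal.tsum_mul_left, lintegral_biUnion hucount (fun y _ => measurableSet_closedBall)
          hudisj]
    _ ≤ ENNReal.ofReal (c * 10 ^ (n + 2)) * ∫⁻ z, ENNReal.ofReal (w z) := by
        exact mul_le_mul' le_rfl (setLIntegral_le_lintegral _ _)
    _ = _ := by
        rw [← ofReal_integral_eq_lintegral_ofReal hw (by filter_upwards with y using hw0 y),
          ← ENNReal.ofReal_mul (by positivity), hc]
        congr 1; ring

end

/-! ### The chain rule for primitives and a Gronwall lemma -/

lemma absolutelyContinuousOnInterval_comp {f β : ℝ → ℝ} {a b K : ℝ} (hK : 0 ≤ K)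
    (hf : AbsolutelyContinuousOnInterval f a b)
    (hβ : ∀ x ∈ uIcc a b, ∀ y ∈ uIcc a b, dist (β (f x)) (β (f y)) ≤ K * dist (f x) (f y)) :
    AbsolutelyContinuousOnInterval (fun x => β (f x)) a b := by
  rw [absolutelyContinuousOnInterval_iff] at hf ⊢
  intro ε hε
  obtain ⟨δ, hδ, h⟩ := hf (ε / (K + 1)) (by positivity)
  refine ⟨δ, hδ, fun I hI hs => ?_⟩
  have h1 := h I hI hs
  rw [lt_div_iff₀ (by positivity), Finset.sum_mul] at h1
  refine lt_of_le_of_lt (Finset.sum_le_sum fun i hi => ?_) h1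
  have h2 := hI.1 i hi
  refine (hβ _ h2.1 _ h2.2).trans ?_
  nlinarith [dist_nonneg (x := f (I.2 i).1) (y := f (I.2 i).2)]

/-- The chain rule for the primitive of an integrable function. -/
lemma integral_deriv_comp_primitive {h : ℝ → ℝ} {a b : ℝ} (hh : IntervalIntegrable h volume a b)
    {β β' : ℝ → ℝ} (hβ : ∀ x, HasDerivAt β (β' x) x) (hc : Continuous β') :
    ∫ τ in a..b, β' (∫ v in a..τ, h v) * h τ = β (∫ v in a..b, h v) - β 0 := by
  set Θ : ℝ → ℝ := fun τ => ∫ v in a..τ, h v with hΘ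
  have hac : AbsolutelyContinuousOnInterval Θ a b :=
    hh.absolutelyContinuousOnInterval_intervalIntegral left_mem_uIcc
  obtain ⟨C, hC⟩ := hac.exists_bound
  obtain ⟨K, hK⟩ := (isCompact_closedBall (0:ℝ) C).exists_bound_of_continuousOn hc.continuousOn
  have hmem : ∀ x ∈ uIcc a b, Θ x ∈ closedBall (0:ℝ) C := fun x hx => by simpa using hC x hx
  have hK0 : 0 ≤ K := (norm_nonneg _).trans (hK _ (hmem a left_mem_uIcc))
  -- `β` is Lipschitz on the bounded range of the primitive, so the composition stays absolutely
  -- continuous and the fundamental theorem applies although `h` is merely integrable.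
  have hac2 : AbsolutelyContinuousOnInterval (fun x => β (Θ x)) a b := by
    refine absolutelyContinuousOnInterval_comp hK0 hac fun x hx y hy => ?_
    rw [dist_eq_norm, dist_eq_norm]
    exact (convex_closedBall (0:ℝ) C).norm_image_sub_le_of_norm_hasDerivWithin_le
      (fun z _ => (hβ z).hasDerivWithinAt) hK (hmem y hy) (hmem x hx)
  have h1 := hac2.integral_deriv_eq_sub
  have h2 : Θ a = 0 := by simp [hΘ]
  rw [h2] at h1
  rw [← h1]
  refine intervalIntegral.integral_congr_ae ?_
  filter_upwards [hh.ae_hasDerivAt_integral] with x hx hxm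
  exact (((hβ _).comp x (hx (uIoc_subset_uIcc hxm) a left_mem_uIcc)).deriv).symm

/-- Gronwall's inequality with an integrable kernel. -/
lemma gronwall_lintegral {a b : ℝ} {κ : ℝ → ℝ} (hκ : IntervalIntegrable κ volume a b)
    (hκ0 : ∀ τ, 0 ≤ κ τ) {F : ℝ → ℝ≥0∞} {A K l : ℝ} (hA : 0 ≤ A) (hK : 0 ≤ K) (hl : 0 < l)
    (hFK : ∀ᵐ t ∂volume.restrict (Ioo a b), F t ≤ ENNReal.ofReal K)
    (hF : ∀ᵐ t ∂volume.restrict (Ioo a b), F t ≤ ENNReal.ofReal A +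
      ∫⁻ τ in Ioo a t, ENNReal.ofReal (l * κ τ) * F τ) :
    ∀ᵐ t ∂volume.restrict (Ioo a b),
      F t ≤ ENNReal.ofReal (2 * A * Real.exp (2 * l * ∫ τ in a..b, κ τ)) := by
  set m : ℝ → ℝ := fun t => ∫ τ in a..t, κ τ with hm
  have hm0 : ∀ t ∈ Ioo a b, 0 ≤ m t := fun t ht =>
    intervalIntegral.integral_nonneg ht.1.le fun _ _ => hκ0 _
  have hmono : ∀ t ∈ Ioo a b, m t ≤ m b := fun t ht =>
    intervalIntegral.integral_mono_interval le_rfl ht.1.le ht.2.le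
      (by filter_upwards with τ using hκ0 τ) hκ
  have hint : ∀ t ∈ Ioo a b, IntervalIntegrable κ volume a t := fun t ht =>
    hκ.mono_set (by rw [uIcc_of_le ht.1.le, uIcc_of_le (ht.1.trans ht.2).le]; exact Icc_subset_Icc_right ht.2.le)
  -- Bootstrapping: inserting a bound `c * exp (2 l m)` into the inequality returns half of it, so
  -- the crude part `K` is halved at each round. Neither continuity nor measurability of `F` is
  -- used.
  have hkey : ∀ j : ℕ, ∀ᵐ t ∂volume.restrict (Ioo a b),
      F t ≤ ENNReal.ofReal ((2 * A + K / 2 ^ j) * Real.exp (2 * l * m t)) := by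
    intro j
    induction j with
    | zero =>
      filter_upwards [hFK, ae_restrict_mem measurableSet_Ioo] with t ht htm
      refine ht.trans (ENNReal.ofReal_le_ofReal ?_)
      have h1 : 1 ≤ Real.exp (2 * l * m t) := Real.one_le_exp (by have := hm0 t htm; positivity)
      rw [pow_zero, div_one]
      nlinarith
    | succ j ih =>
      filter_upwards [hF, ae_restrict_mem measurableSet_Ioo] with t ht htm
      refine ht.trans ?_
      set c := 2 * A + K / 2 ^ j with hc
      have hc0 : 0 ≤ c := by positivity
      have hder : ∀ x, HasDerivAt (fun x => c / 2 * Real.exp (2 * l * x))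
          (c * l * Real.exp (2 * l * x)) x := fun x => by
        have := (((hasDerivAt_id x).const_mul (2 * l)).exp).const_mul (c / 2)
        refine this.congr_deriv ?_
        simp only [id]; ring
      have hchain := integral_deriv_comp_primitive (hint t htm) hder (by fun_prop)
      have hcont : ContinuousOn m (uIcc a t) :=
        intervalIntegral.continuousOn_primitive_interval' (hint t htm) left_mem_uIcc
      have hint2 : IntervalIntegrable (fun τ => c * l * Real.exp (2 * l * m τ) * κ τ)
          volume a t := (hint t htm).continuousOn_mul (by fun_prop)
      have hle : ∫⁻ τ in Ioo a t, ENNReal.ofReal (l * κ τ) * F τ ≤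
          ENNReal.ofReal (∫ τ in a..t, c * l * Real.exp (2 * l * m τ) * κ τ) := by
        rw [intervalIntegral.integral_of_le htm.1.le, integral_Ioc_eq_integral_Ioo,
          ofReal_integral_eq_lintegral_ofReal
            ((intervalIntegrable_iff_integrableOn_Ioo_of_le htm.1.le).1 hint2)
            (by filter_upwards with τ; have := hκ0 τ; positivity)]
        refine lintegral_mono_ae ?_
        have hsub : Ioo a t ⊆ Ioo a b := Ioo_subset_Ioo_right htm.2.le
        filter_upwards [ae_mono (Measure.restrict_mono hsub le_rfl) ih] with τ hτ
        refine (mul_le_mul' le_rfl hτ).trans_eq ?_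
        rw [← ENNReal.ofReal_mul (by have := hκ0 τ; positivity)]
        congr 1; ring
      refine (add_le_add le_rfl hle).trans ?_
      rw [← ENNReal.ofReal_add hA (intervalIntegral.integral_nonneg htm.1.le
        fun τ _ => by have := hκ0 τ; positivity)]
      refine ENNReal.ofReal_le_ofReal ?_
      rw [hchain]
      simp only [mul_zero, Real.exp_zero]
      have h1 : 1 ≤ Real.exp (2 * l * m t) := Real.one_le_exp (by have := hm0 t htm; positivity)
      change A + (c / 2 * Real.exp (2 * l * m t) - c / 2 * 1) ≤ _
      have h2 : K / 2 ^ (j + 1) = K / 2 ^ j / 2 := by rw [pow_succ]; field_simp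
      have h3 : 0 ≤ K / 2 ^ j := by positivity
      rw [h2, hc]
      nlinarith
  filter_upwards [ae_all_iff.2 hkey, ae_restrict_mem measurableSet_Ioo] with t ht htm
  have hlim : Tendsto (fun j : ℕ => (2 * A + K / 2 ^ j) * Real.exp (2 * l * m t)) atTop
      (𝓝 ((2 * A + K * 0) * Real.exp (2 * l * m t))) := by
    have := (tendsto_pow_atTop_nhds_zero_of_lt_one (r := (1/2:ℝ)) (by norm_num) (by norm_num))
    have h2 := ((this.const_mul K).const_add (2 * A)).mul_const (Real.exp (2 * l * m t))
    simpa [div_eq_mul_inv] using h2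
  refine (ge_of_tendsto' (ENNReal.tendsto_ofReal hlim) ht).trans (ENNReal.ofReal_le_ofReal ?_)
  rw [mul_zero, add_zero]
  have := hmono t htm
  gcongr

/-- An Osgood type uniqueness criterion: the logarithmic loss is expressed by the free
parameter `L`. -/
lemma ae_eq_zero_of_osgood {T : ℝ} (hT : 0 < T) {κ : ℝ → ℝ}
    (hκ : IntervalIntegrable κ volume 0 T) (hκ0 : ∀ τ, 0 ≤ κ τ) {F : ℝ → ℝ≥0∞} {K c : ℝ}
    (hK : 0 ≤ K) (hc : 0 < c) (hFK : ∀ᵐ t ∂volume.restrict (Ioo 0 T), F t ≤ ENNReal.ofReal K)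
    (hF : ∀ᵐ t ∂volume.restrict (Ioo 0 T), ∀ L : ℝ, 0 ≤ L → F t ≤ ∫⁻ τ in Ioo 0 t,
      ENNReal.ofReal (κ τ) * (ENNReal.ofReal (L + 1) * F τ +
        ENNReal.ofReal (Real.exp (-(c * L)) * K))) :
    ∀ᵐ t ∂volume.restrict (Ioo 0 T), F t = 0 := by
  have hcont : ContinuousOn (fun t => ∫ τ in (0:ℝ)..t, κ τ) (Icc 0 T) := by
    have := intervalIntegral.continuousOn_primitive_interval' hκ left_mem_uIcc
    rwa [uIcc_of_le hT.le] at this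
  -- `c / 4` makes the Gronwall exponent `2 (L + 1) (c / 4)` grow at only half the rate `c L` of the
  -- gain.
  obtain ⟨δ, hδ, hunif⟩ := Metric.uniformContinuousOn_iff.1
    (isCompact_Icc.uniformContinuousOn_of_continuous hcont) (c / 4) (by positivity)
  set M := ∫ τ in (0:ℝ)..T, κ τ with hM
  have hM0 : 0 ≤ M := intervalIntegral.integral_nonneg hT.le fun _ _ => hκ0 _
  have hsub : ∀ a b, 0 ≤ a → a ≤ b → b ≤ T → IntervalIntegrable κ volume a b :=
    fun a b h0 hab hb => hκ.mono_set (by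
      rw [uIcc_of_le hab, uIcc_of_le hT.le]; exact Icc_subset_Icc h0 hb)
  -- Time is advanced in steps of `δ / 2`, strictly less than `δ`.
  have hkey : ∀ k : ℕ, ∀ᵐ t ∂volume.restrict (Ioo 0 T), t < k * (δ / 2) → F t = 0 := by
    intro k
    induction k with
    | zero =>
      filter_upwards [ae_restrict_mem measurableSet_Ioo] with t ht h
      simp only [Nat.cast_zero, zero_mul] at h
      exact absurd h (not_lt.2 ht.1.le)
    | succ k ih =>
      set a := k * (δ / 2) with ha
      have ha0 : 0 ≤ a := by positivity
      rcases le_or_gt T a with hTa | hTa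
      · filter_upwards [ih, ae_restrict_mem measurableSet_Ioo] with t ht htm _
        exact ht (htm.2.trans_le hTa)
      set b := min (a + δ / 2) T with hb
      have hab : a < b := lt_min (by linarith) hTa
      have hbT : b ≤ T := min_le_right _ _
      have hm : ∫ τ in a..b, κ τ ≤ c / 4 := by
        have h1 := hunif b ⟨ha0.trans hab.le, hbT⟩ a ⟨ha0, hTa.le⟩ (by
          rw [Real.dist_eq, abs_of_nonneg (by linarith)]
          have := min_le_left (a + δ / 2) T
          linarith)
        rw [Real.dist_eq, intervalIntegral.integral_interval_sub_left
          (hsub _ _ le_rfl (ha0.trans hab.le) hbT) (hsub _ _ le_rfl ha0 hTa.le)] at h1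
        exact (le_abs_self _).trans h1.le
      -- `F` vanishes before `a`, so Gronwall restarts at `a`, with inhomogeneity `exp (-(c * L)) *
      -- K * M` and kernel factor `L + 1`.
      have hmain : ∀ L : ℕ, ∀ᵐ t ∂volume.restrict (Ioo a b), F t ≤
          ENNReal.ofReal (2 * (Real.exp (-(c * L)) * K * M) * Real.exp (2 * (L + 1) * (c / 4))) := by
        intro L
        have hsubI : Ioo a b ⊆ Ioo 0 T := Ioo_subset_Ioo ha0 hbT
        have hgr := gronwall_lintegral (F := F) (A := Real.exp (-(c * L)) * K * M) (K := K)
          (l := L + 1) (hsub a b ha0 hab.le hbT) hκ0 (by positivity) hK (by positivity)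
          (ae_mono (Measure.restrict_mono hsubI le_rfl) hFK) (by
            filter_upwards [ae_mono (Measure.restrict_mono hsubI le_rfl) hF,
              ae_restrict_mem measurableSet_Ioo] with t ht htm
            refine (ht L (Nat.cast_nonneg _)).trans ?_
            have ht0 : 0 ≤ t := ha0.trans htm.1.le
            have htT : t ≤ T := htm.2.le.trans hbT
            have hκm : AEMeasurable κ (volume.restrict (Ioo 0 t)) :=
              ((intervalIntegrable_iff_integrableOn_Ioo_of_le ht0).1
                (hsub 0 t le_rfl ht0 htT)).aemeasurable
            simp_rw [mul_add]
            rw [lintegral_add_right' _ (hκm.ennreal_ofReal.mul_const _), add_comm]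
            refine add_le_add ?_ ?_
            · rw [lintegral_mul_const' _ _ ENNReal.ofReal_ne_top,
                ← ofReal_integral_eq_lintegral_ofReal
                  ((intervalIntegrable_iff_integrableOn_Ioo_of_le ht0).1 (hsub 0 t le_rfl ht0 htT))
                  (by filter_upwards with τ using hκ0 τ), ← integral_Ioc_eq_integral_Ioo,
                ← intervalIntegral.integral_of_le ht0, mul_comm, ← ENNReal.ofReal_mul (by positivity)]
              refine ENNReal.ofReal_le_ofReal ?_
              gcongr
              exact intervalIntegral.integral_mono_interval le_rfl ht0 htT
                (by filter_upwards with τ using hκ0 τ) hκ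
            · rw [← lintegral_indicator measurableSet_Ioo, ← lintegral_indicator measurableSet_Ioo]
              refine lintegral_mono_ae ?_
              have hih := (ae_restrict_iff' measurableSet_Ioo).1 ih
              have hna : ∀ᵐ τ : ℝ, τ ≠ a := by simp [ae_iff, measure_singleton]
              filter_upwards [hih, hna] with τ hτ hτa
              by_cases h1 : τ ∈ Ioo 0 t
              · rw [indicator_of_mem h1]
                rcases lt_or_gt_of_ne hτa with h2 | h2
                · rw [hτ ⟨h1.1, h1.2.trans_le htT⟩ h2]; simp
                · rw [indicator_of_mem (show τ ∈ Ioo a t from ⟨h2, h1.2⟩), ← mul_assoc,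
                    ← ENNReal.ofReal_mul (hκ0 τ), mul_comm (κ τ)]
              · rw [indicator_of_notMem h1]; exact zero_le)
        filter_upwards [hgr] with t ht
        refine ht.trans (ENNReal.ofReal_le_ofReal ?_)
        gcongr
      have hlim : Tendsto (fun L : ℕ => 2 * (Real.exp (-(c * L)) * K * M) *
          Real.exp (2 * (L + 1) * (c / 4))) atTop (𝓝 0) := by
        have h1 : Tendsto (fun L : ℕ => Real.exp (-(c / 2 * L))) atTop (𝓝 0) :=
          Real.tendsto_exp_neg_atTop_nhds_zero.comp
            (tendsto_natCast_atTop_atTop.const_mul_atTop (by positivity))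
        have h2 := h1.const_mul (2 * K * M * Real.exp (c / 2))
        rw [mul_zero] at h2
        refine h2.congr fun L => ?_
        calc _ = 2 * K * M * (Real.exp (c / 2) * Real.exp (-(c / 2 * L))) := by ring
          _ = 2 * K * M * (Real.exp (-(c * L)) * Real.exp (2 * (L + 1) * (c / 4))) := by
              rw [← Real.exp_add, ← Real.exp_add]; congr 2; ring
          _ = _ := by ring
      have hzero : ∀ᵐ t ∂volume.restrict (Ioo a b), F t = 0 := by
        filter_upwards [ae_all_iff.2 hmain] with t ht
        have := ge_of_tendsto' (ENNReal.tendsto_ofReal hlim) ht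
        simpa using this
      rw [ae_restrict_iff' measurableSet_Ioo] at hzero ih ⊢
      have hna : ∀ᵐ τ : ℝ, τ ≠ a := by simp [ae_iff, measure_singleton]
      filter_upwards [hzero, ih, hna] with t h1 h2 h3 htm htk
      rcases lt_or_gt_of_ne h3 with h4 | h4
      · exact h2 htm h4
      · refine h1 ⟨h4, lt_min ?_ htm.2⟩
        push_cast at htk
        linarith
  filter_upwards [ae_all_iff.2 hkey] with t ht
  obtain ⟨k, hk⟩ := exists_nat_gt (t / (δ / 2))
  exact ht k ((div_lt_iff₀ (by positivity)).1 hk)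

/-! ### The trilinear term. -/

/-- The nonlinear term is controlled with a logarithmic loss. -/
lemma lintegral_nonlinear_le {n : ℕ} {θ θ' : E n → ℝ} {G G' u : E n → E n}
    (h : HasWeakGradient θ G) (h' : HasWeakGradient θ' G')
    (hθ : Integrable (fun y => θ y ^ 2) volume) (hθ' : Integrable (fun y => θ' y ^ 2) volume)
    {N : ℝ} (hN : 0 < N) (hosc : BallOsc G N) (hosc' : BallOsc G' N)
    (hum : AEStronglyMeasurable u volume) {M : ℝ} (hM : 0 ≤ M)
    (hu : ∫⁻ y, ‖u y‖ₑ ^ 2 ≤ ENNReal.ofReal M * ∫⁻ y, ‖θ y‖ₑ ^ 2) {L : ℝ} (hL : 0 ≤ L) :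
    ∫⁻ y, ‖θ y‖ₑ * ‖u y‖ₑ * ‖G' y‖ₑ ≤
      ENNReal.ofReal ((1 + M + levelConst n * 10 ^ (n + 2)) * N) *
        (ENNReal.ofReal (L + 1) * (∫⁻ y, ‖θ y‖ₑ ^ 2) +
          ENNReal.ofReal (Real.exp (-(jnRate n / 2 * L)) * ∫ y, (θ y ^ 2 + θ' y ^ 2))) := by
  have hlc := levelConst_pos n
  set Φ : E n → ℝ≥0∞ := {y | L * N < ‖G' y‖}.indicator (fun y => ‖θ y‖ₑ ^ 2 * ‖G' y‖ₑ ^ 2) with hΦ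
  -- Above the level the factor `‖G' y‖` is attached to `θ`, because a local supremum bound is
  -- available for `θ` and not for the nonlocal `u`.
  have hpt : ∀ y, ‖θ y‖ₑ * ‖u y‖ₑ * ‖G' y‖ₑ ≤ ENNReal.ofReal (L * N) * ‖θ y‖ₑ ^ 2 +
      ENNReal.ofReal (L * N + N) * ‖u y‖ₑ ^ 2 + ENNReal.ofReal N⁻¹ * Φ y := by
    intro y
    rw [← ofReal_norm, ← ofReal_norm, ← ofReal_norm, ← ENNReal.ofReal_mul (norm_nonneg _),
      ← ENNReal.ofReal_mul (by positivity), ← ENNReal.ofReal_pow (norm_nonneg _),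
      ← ENNReal.ofReal_pow (norm_nonneg _), ← ENNReal.ofReal_mul (by positivity),
      ← ENNReal.ofReal_mul (by positivity)]
    set A := ‖θ y‖
    set B := ‖u y‖
    have hA : 0 ≤ A := norm_nonneg _
    have hB : 0 ≤ B := norm_nonneg _
    have hLN : 0 ≤ L * N := by positivity
    by_cases hy : L * N < ‖G' y‖
    · rw [hΦ, indicator_of_mem (by exact hy), ← ofReal_norm, ← ofReal_norm,
        ← ENNReal.ofReal_pow (norm_nonneg _), ← ENNReal.ofReal_pow (norm_nonneg _),
        ← ENNReal.ofReal_mul (by positivity), ← ENNReal.ofReal_mul (by positivity),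
        ← ENNReal.ofReal_add (by positivity) (by positivity),
        ← ENNReal.ofReal_add (by positivity) (by positivity)]
      refine ENNReal.ofReal_le_ofReal ?_
      set D := ‖G' y‖
      change A * B * D ≤ L * N * A ^ 2 + (L * N + N) * B ^ 2 + N⁻¹ * (A ^ 2 * D ^ 2)
      -- Young's inequality with weight `N`, so that the `N²` of the tail estimate is reduced to one
      -- power of `N`.
      have h1 : A * B * D ≤ N * B ^ 2 + N⁻¹ * (A ^ 2 * D ^ 2) := by
        have h2 : N * B ^ 2 + N⁻¹ * (A ^ 2 * D ^ 2) - 2 * (A * B * D) = N⁻¹ * (N * B - A * D) ^ 2 := by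
          field_simp; ring
        have h3 : 0 ≤ N⁻¹ * (N * B - A * D) ^ 2 := by positivity
        have h4 : 0 ≤ A * B * D := by positivity
        linarith
      nlinarith [mul_nonneg hLN (sq_nonneg A), mul_nonneg hLN (sq_nonneg B)]
    · rw [hΦ, indicator_of_notMem (by exact hy), mul_zero, add_zero,
        ← ENNReal.ofReal_add (by positivity) (by positivity)]
      refine ENNReal.ofReal_le_ofReal ?_
      push Not at hy
      have h1 : A * B * ‖G' y‖ ≤ A * B * (L * N) := by gcongr
      nlinarith [mul_nonneg hLN (sq_nonneg (A - B)), mul_nonneg hN.le (sq_nonneg B),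
        mul_nonneg hLN (sq_nonneg A), mul_nonneg hLN (sq_nonneg B)]
  have hθm : AEMeasurable (fun y => ‖θ y‖ₑ ^ 2) volume := h.1.aestronglyMeasurable.enorm.pow_const 2
  have hum2 : AEMeasurable (fun y => ‖u y‖ₑ ^ 2) volume := hum.enorm.pow_const 2
  have hlev := lintegral_level_le h h' hθ hθ' hN hosc hosc' L
  set F := ∫⁻ y, ‖θ y‖ₑ ^ 2 with hF
  set I := ∫ y, (θ y ^ 2 + θ' y ^ 2) with hI
  have hI0 : 0 ≤ I := integral_nonneg fun y => by positivity
  calc _ ≤ ∫⁻ y, (ENNReal.ofReal (L * N) * ‖θ y‖ₑ ^ 2 +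
      ENNReal.ofReal (L * N + N) * ‖u y‖ₑ ^ 2 + ENNReal.ofReal N⁻¹ * Φ y) := lintegral_mono hpt
    _ = ENNReal.ofReal (L * N) * F + ENNReal.ofReal (L * N + N) * (∫⁻ y, ‖u y‖ₑ ^ 2) +
        ENNReal.ofReal N⁻¹ * ∫⁻ y, Φ y := by
        have hm1 : AEMeasurable (fun y => ENNReal.ofReal (L * N) * ‖θ y‖ₑ ^ 2 +
            ENNReal.ofReal (L * N + N) * ‖u y‖ₑ ^ 2) volume :=
          (hθm.const_mul _).add (hum2.const_mul _)
        rw [lintegral_add_left' hm1, lintegral_add_left' (hθm.const_mul _), lintegral_const_mul' _ _ ENNReal.ofReal_ne_top,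
          lintegral_const_mul' _ _ ENNReal.ofReal_ne_top,
          lintegral_const_mul' _ _ ENNReal.ofReal_ne_top]
    _ ≤ ENNReal.ofReal (L * N) * F + ENNReal.ofReal (L * N + N) * (ENNReal.ofReal M * F) +
        ENNReal.ofReal N⁻¹ * ENNReal.ofReal (levelConst n * 10 ^ (n + 2) *
          Real.exp (-(jnRate n / 2 * L)) * N ^ 2 * I) := by gcongr
    _ = ENNReal.ofReal (L * N + (L * N + N) * M) * F +
        ENNReal.ofReal (levelConst n * 10 ^ (n + 2) * N * (Real.exp (-(jnRate n / 2 * L)) * I)) := by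
        rw [← mul_assoc, ← ENNReal.ofReal_mul (by positivity), ← add_mul,
          ← ENNReal.ofReal_add (by positivity) (by positivity),
          ← ENNReal.ofReal_mul (by positivity)]
        congr 2
        field_simp
    _ ≤ _ := by
        have hq : 0 ≤ levelConst n * 10 ^ (n + 2) := by positivity
        have hq2 : 0 ≤ (1 + M + levelConst n * 10 ^ (n + 2)) * N := by positivity
        rw [mul_add, ← mul_assoc (ENNReal.ofReal _) (ENNReal.ofReal _) F,
          ← ENNReal.ofReal_mul hq2, ← ENNReal.ofReal_mul hq2]
        gcongr ENNReal.ofReal ?_ * F + ENNReal.ofReal ?_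
        · have h1 : 0 ≤ N * (L + 1) := by positivity
          nlinarith [mul_nonneg hq h1]
        · gcongr; linarith

/-! ### The drift velocity in `L²` -/

lemma eLpNorm_two_sq {α F : Type*} [MeasurableSpace α] [NormedAddCommGroup F] (f : α → F)
    (μ : Measure α) : eLpNorm f 2 μ ^ 2 = ∫⁻ x, ‖f x‖ₑ ^ 2 ∂μ := by
  rw [eLpNorm_eq_lintegral_rpow_enorm_toReal two_ne_zero ENNReal.ofNat_ne_top, ← ENNReal.rpow_natCast,
    ← ENNReal.rpow_mul]
  simp

lemma enorm_sq_eq_sum {n : ℕ} (v : E n) : ‖v‖ₑ ^ 2 = ∑ i, ‖v i‖ₑ ^ 2 := by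
  rw [← ofReal_norm, ← ENNReal.ofReal_pow (norm_nonneg _), EuclideanSpace.norm_sq_eq,
    ENNReal.ofReal_sum_of_nonneg fun i _ => by positivity]
  refine Finset.sum_congr rfl fun i _ => ?_
  rw [ENNReal.ofReal_pow (norm_nonneg _), ofReal_norm]

lemma MemLp.of_ofReal {n : ℕ} {f : E n → ℝ} (hf : MemLp (fun x => (f x : ℂ)) 2 volume) :
    MemLp f 2 volume := by
  have := hf.re
  simpa using this

lemma IsMultiplierImage.sub {n : ℕ} {m : E n → EuclideanSpace ℂ (Fin n)} {f f' : E n → ℝ}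
    {v v' : E n → E n} (h : IsMultiplierImage m f v) (h' : IsMultiplierImage m f' v') :
    IsMultiplierImage m (fun x => f x - f' x) (fun x => v x - v' x) := by
  obtain ⟨hf, h⟩ := h
  obtain ⟨hf', h'⟩ := h'
  have key : ∀ {a b : E n → ℝ} (ha : MemLp (fun x => (a x : ℂ)) 2 volume)
      (hb : MemLp (fun x => (b x : ℂ)) 2 volume),
      ∃ hab : MemLp (fun x => ((a x - b x : ℝ) : ℂ)) 2 volume,
        (𝓕 (hab.toLp _) : Lp ℂ 2 (volume : Measure (E n))) =ᵐ[volume] fun ξ =>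
          (𝓕 (ha.toLp _) : Lp ℂ 2 (volume : Measure (E n))) ξ -
            (𝓕 (hb.toLp _) : Lp ℂ 2 (volume : Measure (E n))) ξ := by
    intro a b ha hb
    have hab : MemLp (fun x => ((a x - b x : ℝ) : ℂ)) 2 volume := by
      have := ha.sub hb
      refine this.ae_eq (Eventually.of_forall fun x => ?_)
      simp
    refine ⟨hab, ?_⟩
    have h1 : hab.toLp _ = ha.toLp _ - hb.toLp _ := by
      rw [← MemLp.toLp_sub]
      exact MemLp.toLp_congr _ _ (Eventually.of_forall fun x => by simp)
    have h2 : (𝓕 (hab.toLp _) : Lp ℂ 2 (volume : Measure (E n))) =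
        𝓕 (ha.toLp _) - 𝓕 (hb.toLp _) := by
      rw [h1]
      exact (Lp.fourierTransformₗᵢ (E n) ℂ).map_sub _ _
    rw [h2]
    exact Lp.coeFn_sub _ _
  obtain ⟨hff, hff'⟩ := key hf hf'
  refine ⟨hff, fun j => ?_⟩
  obtain ⟨hv, hvj⟩ := h j
  obtain ⟨hv', hvj'⟩ := h' j
  obtain ⟨hvv, hvv'⟩ := key hv hv'
  refine ⟨hvv, ?_⟩
  filter_upwards [hff', hvj, hvj', hvv'] with ξ h1 h2 h3 h4
  refine h4.trans ?_
  rw [h1, h2, h3, mul_sub]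

/-- Plancherel in each coordinate, bounding every component of the symbol by `C`; adding the
coordinates gives the factor `n`. -/
lemma IsMultiplierImage.lintegral_le {n : ℕ} {m : E n → EuclideanSpace ℂ (Fin n)} {C : ℝ}
    (hm : ∀ ξ, ξ ≠ 0 → ‖m ξ‖ ≤ C) (hn : 1 ≤ n) {f : E n → ℝ} {v : E n → E n}
    (h : IsMultiplierImage m f v) :
    ∫⁻ x, ‖v x‖ₑ ^ 2 ≤ ENNReal.ofReal (n * C ^ 2) * ∫⁻ x, ‖f x‖ₑ ^ 2 := by
  obtain ⟨hf, h⟩ := h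
  have : Nonempty (Fin n) := ⟨⟨0, hn⟩⟩
  have hC : 0 ≤ C := (norm_nonneg _).trans (hm (EuclideanSpace.single ⟨0, hn⟩ 1) (by simp))
  -- The symbol is bounded only off the origin, which is a null set since `1 ≤ n`.
  have hne : ∀ᵐ ξ : E n, ξ ≠ 0 := by simp [ae_iff, measure_singleton]
  have hj : ∀ j, ∫⁻ x, ‖v x j‖ₑ ^ 2 ≤ ENNReal.ofReal (C ^ 2) * ∫⁻ x, ‖f x‖ₑ ^ 2 := by
    intro j
    obtain ⟨hv, hvj⟩ := h j
    have h1 : eLpNorm (fun x => (v x j : ℂ)) 2 volume ≤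
        ENNReal.ofReal C * eLpNorm (fun x => (f x : ℂ)) 2 volume := by
      have e1 : ∀ {a : E n → ℂ} (ha : MemLp a 2 volume), eLpNorm a 2 volume =
          eLpNorm (𝓕 (ha.toLp _) : Lp ℂ 2 (volume : Measure (E n))) 2 volume := by
        intro a ha
        rw [← Lp.enorm_def, ← Lp.enorm_toLp ha, ← ofReal_norm, ← ofReal_norm, Lp.norm_fourier_eq]
      rw [e1 hv, e1 hf]
      refine eLpNorm_le_mul_eLpNorm_of_ae_le_mul ?_ 2
      filter_upwards [hvj, hne] with ξ h2 h3
      rw [h2, norm_mul]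
      gcongr
      exact (PiLp.norm_apply_le (m ξ) j).trans (hm ξ h3)
    have h2 := pow_le_pow_left' h1 2
    rw [mul_pow, eLpNorm_two_sq, eLpNorm_two_sq, ← ENNReal.ofReal_pow hC] at h2
    have e2 : ∀ a : ℝ, ‖(a : ℂ)‖ₑ = ‖a‖ₑ := fun a => by
      rw [← ofReal_norm, ← ofReal_norm, Complex.norm_real]
    simpa only [e2] using h2
  have hmeas : ∀ j, AEMeasurable (fun x => ‖v x j‖ₑ ^ 2) volume := fun j => by
    obtain ⟨hv, -⟩ := h j
    exact (MemLp.of_ofReal hv).aestronglyMeasurable.enorm.pow_const 2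
  simp_rw [enorm_sq_eq_sum]
  rw [lintegral_finsetSum' _ fun j _ => hmeas j]
  refine (Finset.sum_le_sum fun j _ => hj j).trans_eq ?_
  rw [Finset.sum_const, Finset.card_univ, Fintype.card_fin, nsmul_eq_mul, ← mul_assoc,
    ENNReal.ofReal_mul (by positivity), ENNReal.ofReal_natCast]

lemma IsOrderZeroSymbol.exists_bound {n : ℕ} {m : E n → EuclideanSpace ℂ (Fin n)}
    (hm : IsOrderZeroSymbol m) : ∃ C : ℝ, ∀ ξ, ξ ≠ 0 → ‖m ξ‖ ≤ C := by
  obtain ⟨C, hC⟩ := hm.2 0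
  refine ⟨C, fun ξ hξ => ?_⟩
  simpa using hC ξ hξ

/-! ### Mollification -/

lemma lintegral_mul_le_sqrt {α : Type*} [MeasurableSpace α] {μ : Measure α} {a b : α → ℝ≥0∞}
    (ha : AEMeasurable a μ) (hb : AEMeasurable b μ) :
    ∫⁻ x, a x * b x ∂μ ≤ (∫⁻ x, a x ^ 2 ∂μ) ^ (1 / 2 : ℝ) * (∫⁻ x, b x ^ 2 ∂μ) ^ (1 / 2 : ℝ) := by
  have h := ENNReal.lintegral_mul_le_Lp_mul_Lq μ Real.HolderConjugate.two_two ha hb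
  simpa using h

lemma tendsto_lintegral_translate {n : ℕ} {F : Type*} [NormedAddCommGroup F] {f : E n → F}
    (hf : MemLp f 2 volume) :
    Tendsto (fun t : E n => ∫⁻ x, ‖f (x - t) - f x‖ₑ ^ 2) (𝓝 0) (𝓝 0) := by
  let g : E n → C(E n, E n) := fun t => ⟨fun x => x - t, by fun_prop⟩
  have hg : Continuous g := by
    refine ContinuousMap.continuous_of_continuous_uncurry _ ?_
    show Continuous fun p : E n × E n => p.2 - p.1
    fun_prop
  have hgm : ∀ t, MeasurePreserving (g t) volume volume := fun t =>
    measurePreserving_sub_right volume t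
  have h1 := Filter.Tendsto.compMeasurePreservingLp
    (tendsto_const_nhds (x := hf.toLp f) (f := 𝓝 (0 : E n))) (hg.tendsto 0) hgm (hgm 0)
    ENNReal.ofNat_ne_top
  rw [tendsto_iff_edist_tendsto_0] at h1
  have h2 : ∀ t, edist (Lp.compMeasurePreserving (g t) (hgm t) (hf.toLp f))
      (Lp.compMeasurePreserving (g 0) (hgm 0) (hf.toLp f)) =
      eLpNorm (fun x => f (x - t) - f x) 2 volume := by
    intro t
    rw [Lp.toLp_compMeasurePreserving, Lp.toLp_compMeasurePreserving, Lp.edist_toLp_toLp]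
    congr 1
    ext x
    simp [g]
  simp_rw [h2] at h1
  have h3 := ENNReal.Tendsto.pow (n := 2) h1
  simp_rw [eLpNorm_two_sq] at h3
  simpa using h3

lemma stdBump_neg {n : ℕ} (x : E n) : stdBump n (-x) = stdBump n x :=
  ContDiffBump.normed_neg _ _

lemma bump_sub_comm {n : ℕ} (x z : E n) (ε : ℝ) : bump 0 ε (x - z) = bump x ε z := by
  rw [bump, bump, sub_zero, ← stdBump_neg, ← smul_neg, neg_sub]

lemma bump_nonneg {n : ℕ} (y : E n) {δ : ℝ} (hδ : 0 < δ) (z : E n) : 0 ≤ bump y δ z :=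
  mul_nonneg (by positivity) (stdBump_nonneg _)

/-- The mollification of `f` at scale `ε`. -/
def moll {n : ℕ} {F : Type*} [NormedAddCommGroup F] [NormedSpace ℝ F] (ε : ℝ) (f : E n → F)
    (x : E n) : F := ∫ z, bump x ε z • f z

section
variable {n : ℕ} {F : Type*} [NormedAddCommGroup F] [NormedSpace ℝ F]

lemma moll_eq_integral_translate (ε : ℝ) (f : E n → F) (x : E n) :
    moll ε f x = ∫ t, bump 0 ε t • f (x - t) := by
  rw [moll, ← integral_sub_left_eq_self (fun z => bump x ε z • f z) volume x]
  congr 1; ext t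
  rw [← bump_sub_comm, sub_sub_cancel]

lemma moll_congr_ae (ε : ℝ) {f f' : E n → F} (h : f =ᵐ[volume] f') : moll ε f = moll ε f' := by
  ext x
  refine integral_congr_ae ?_
  filter_upwards [h] with z hz
  rw [hz]

lemma moll_eq_of_eqOn {ε : ℝ} (hε : 0 < ε) {f f' : E n → F} {x : E n}
    (h : ∀ z ∈ closedBall x ε, f z = f' z) : moll ε f x = moll ε f' x := by
  refine integral_congr_ae (Eventually.of_forall fun z => ?_)
  by_cases hz : z ∈ closedBall x ε
  · simp only [h z hz]
  · simp only [bump_eq_zero hε hz, zero_smul]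

/-- Jensen's inequality for the probability density `bump 0 ε`, obtained from Cauchy–Schwarz by
splitting the weight into two square roots. -/
lemma enorm_moll_sub_sq_le [CompleteSpace F] {ε : ℝ} (hε : 0 < ε) {f : E n → F}
    (hf : StronglyMeasurable f) (hfl : LocallyIntegrable f volume) (x : E n) :
    ‖moll ε f x - f x‖ₑ ^ 2 ≤
      ∫⁻ t, ENNReal.ofReal (bump 0 ε t) * ‖f (x - t) - f x‖ₑ ^ 2 := by
  have hcs := bump_hasCompactSupport (n := n) 0 hε
  have hcont := (bump_contDiff (n := n) 0 ε).continuous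
  have hint : Integrable (fun t : E n => bump 0 ε t) volume :=
    hcont.integrable_of_hasCompactSupport hcs
  have hone : ∫⁻ t : E n, ENNReal.ofReal (bump 0 ε t) = 1 := by
    rw [← ofReal_integral_eq_lintegral_ofReal hint (Eventually.of_forall fun t => bump_nonneg 0 hε t),
      integral_bump 0 hε, ENNReal.ofReal_one]
  have hint2 : Integrable (fun t => bump 0 ε t • f (x - t)) volume := by
    have h1 : Integrable (fun z => bump x ε z • f z) volume :=
      continuous_integrable_mul hfl (bump_contDiff x ε).continuous (bump_hasCompactSupport x hε)
    have h2 := h1.comp_sub_left x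
    refine h2.congr (Eventually.of_forall fun t => ?_)
    simp only
    rw [← bump_sub_comm, sub_sub_cancel]
  have h1 : moll ε f x - f x = ∫ t, bump 0 ε t • (f (x - t) - f x) := by
    simp_rw [smul_sub]
    rw [integral_sub hint2 (hint.smul_const _), integral_smul_const, integral_bump 0 hε, one_smul,
      moll_eq_integral_translate]
  set φ : E n → ℝ≥0∞ := fun t => ENNReal.ofReal (bump 0 ε t) with hφ
  have hφm : Measurable φ := hcont.measurable.ennreal_ofReal
  have hm : Measurable fun t => ‖f (x - t) - f x‖ₑ :=
    ((hf.comp_measurable (measurable_const.sub measurable_id)).sub stronglyMeasurable_const).enorm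
  have hsq : ∀ a : ℝ≥0∞, (a ^ (1 / 2 : ℝ)) ^ 2 = a := fun a => by
    rw [← ENNReal.rpow_natCast, ← ENNReal.rpow_mul]; norm_num
  have h2 : ‖moll ε f x - f x‖ₑ ≤
      (∫⁻ t, φ t * ‖f (x - t) - f x‖ₑ ^ 2) ^ (1 / 2 : ℝ) := by
    calc _ ≤ ∫⁻ t, ‖bump 0 ε t • (f (x - t) - f x)‖ₑ := by
          rw [h1]; exact enorm_integral_le_lintegral_enorm _
      _ = ∫⁻ t, φ t ^ (1 / 2 : ℝ) * (φ t ^ (1 / 2 : ℝ) * ‖f (x - t) - f x‖ₑ) := by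
          refine lintegral_congr fun t => ?_
          rw [← mul_assoc, ← sq, hsq, enorm_smul, Real.enorm_of_nonneg (bump_nonneg 0 hε t)]
      _ ≤ (∫⁻ t, (φ t ^ (1 / 2 : ℝ)) ^ 2) ^ (1 / 2 : ℝ) *
          (∫⁻ t, (φ t ^ (1 / 2 : ℝ) * ‖f (x - t) - f x‖ₑ) ^ 2) ^ (1 / 2 : ℝ) :=
          lintegral_mul_le_sqrt (hφm.pow_const _).aemeasurable
            ((hφm.pow_const _).mul hm).aemeasurable
      _ = _ := by simp_rw [mul_pow, hsq]; rw [hone, ENNReal.one_rpow, one_mul]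
  calc _ ≤ ((∫⁻ t, φ t * ‖f (x - t) - f x‖ₑ ^ 2) ^ (1 / 2 : ℝ)) ^ 2 := pow_le_pow_left' h2 2
    _ = _ := hsq _

/-- Mollifications converge in `L²`. -/
lemma tendsto_moll [CompleteSpace F] {f : E n → F} (hf : MemLp f 2 volume) :
    Tendsto (fun ε => ∫⁻ x, ‖moll ε f x - f x‖ₑ ^ 2) (𝓝[>] 0) (𝓝 0) := by
  -- Tonelli below needs joint measurability in position and shift; mollification depends only on
  -- the almost everywhere class.
  wlog hfm : StronglyMeasurable f generalizing f
  · have h := this (f := hf.1.mk f) (hf.ae_eq hf.1.ae_eq_mk) hf.1.stronglyMeasurable_mk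
    refine h.congr fun ε => ?_
    rw [← moll_congr_ae ε hf.1.ae_eq_mk]
    refine lintegral_congr_ae ?_
    filter_upwards [hf.1.ae_eq_mk] with x hx
    rw [hx]
  have hfl : LocallyIntegrable f volume := hf.locallyIntegrable one_le_two
  rw [ENNReal.tendsto_nhds_zero]
  intro η hη
  obtain ⟨δ, hδ, hball⟩ := Metric.eventually_nhds_iff_ball.1
    ((ENNReal.tendsto_nhds_zero.1 (tendsto_lintegral_translate hf)) η hη)
  filter_upwards [Ioo_mem_nhdsGT hδ] with ε hε
  have hcont := (bump_contDiff (n := n) 0 ε).continuous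
  have hmeas : Measurable fun p : E n × E n =>
      ENNReal.ofReal (bump 0 ε p.2) * ‖f (p.1 - p.2) - f p.1‖ₑ ^ 2 :=
    (hcont.measurable.comp measurable_snd).ennreal_ofReal.mul
      (((hfm.comp_measurable (measurable_fst.sub measurable_snd)).sub
        (hfm.comp_measurable measurable_fst)).enorm.pow_const 2)
  calc _ ≤ ∫⁻ x, ∫⁻ t, ENNReal.ofReal (bump 0 ε t) * ‖f (x - t) - f x‖ₑ ^ 2 :=
        lintegral_mono fun x => enorm_moll_sub_sq_le hε.1 hfm hfl x
    _ = ∫⁻ t, ∫⁻ x, ENNReal.ofReal (bump 0 ε t) * ‖f (x - t) - f x‖ₑ ^ 2 :=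
        lintegral_lintegral_swap hmeas.aemeasurable
    _ = ∫⁻ t, ENNReal.ofReal (bump 0 ε t) * ∫⁻ x, ‖f (x - t) - f x‖ₑ ^ 2 := by
        refine lintegral_congr fun t => ?_
        rw [lintegral_const_mul' _ _ ENNReal.ofReal_ne_top]
    _ ≤ ∫⁻ t : E n, ENNReal.ofReal (bump 0 ε t) * η := by
        refine lintegral_mono fun t => ?_
        by_cases ht : t ∈ closedBall (0 : E n) ε
        · exact mul_le_mul' le_rfl (hball t (closedBall_subset_ball hε.2 ht))
        · simp only [bump_eq_zero hε.1 ht, ENNReal.ofReal_zero, zero_mul, le_refl]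
    _ = η := by
        rw [lintegral_mul_const _ hcont.measurable.ennreal_ofReal,
          ← ofReal_integral_eq_lintegral_ofReal
            (hcont.integrable_of_hasCompactSupport (bump_hasCompactSupport 0 hε.1))
            (Eventually.of_forall fun t => bump_nonneg 0 hε.1 t),
          integral_bump 0 hε.1, ENNReal.ofReal_one, one_mul]

end

lemma moll_eq_convolution {n : ℕ} (ε : ℝ) (θ : E n → ℝ) :
    moll ε θ = MeasureTheory.convolution (bump (0 : E n) ε) θ (ContinuousLinearMap.lsmul ℝ ℝ)
      volume := by
  ext x
  rw [moll_eq_integral_translate]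
  rfl

lemma moll_contDiff {n : ℕ} {ε : ℝ} (hε : 0 < ε) {θ : E n → ℝ} (hθ : LocallyIntegrable θ volume) :
    ContDiff ℝ ∞ (moll ε θ) := by
  rw [moll_eq_convolution]
  exact (bump_hasCompactSupport 0 hε).contDiff_convolution_left _ (bump_contDiff 0 ε) hθ

lemma HasWeakGradient.integral_fderiv {n : ℕ} {θ : E n → ℝ} {G : E n → E n}
    (h : HasWeakGradient θ G) {φ : E n → ℝ} (hφ : ContDiff ℝ ∞ φ) (hc : HasCompactSupport φ)
    (v : E n) : ∫ z, θ z * fderiv ℝ φ z v = -∫ z, φ z * inner ℝ (G z) v := by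
  have hv : v = ∑ i, v i • EuclideanSpace.single i (1 : ℝ) := by
    ext j; simp [Finset.sum_apply, Pi.single_apply]
  have hint : ∀ i : Fin n, Integrable
      (fun z => θ z * fderiv ℝ φ z (EuclideanSpace.single i 1)) volume := fun i => by
    have hc' : HasCompactSupport fun z => fderiv ℝ φ z (EuclideanSpace.single i 1) :=
      (hc.fderiv (𝕜 := ℝ)).comp_left (g := fun ℓ : E n →L[ℝ] ℝ =>
        ℓ (EuclideanSpace.single i 1)) rfl
    have hcont : Continuous fun z => fderiv ℝ φ z (EuclideanSpace.single i 1) :=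
      (hφ.continuous_fderiv (by simp)).clm_apply continuous_const
    simpa [mul_comm] using continuous_integrable_mul h.1 hcont hc'
  have hint2 : ∀ i : Fin n, Integrable (fun z => G z i * φ z) volume := fun i => by
    simpa [mul_comm] using continuous_integrable_mul (LocallyIntegrable.coord h.2.1 i)
      hφ.continuous hc
  have h1 : ∀ z, θ z * fderiv ℝ φ z v =
      ∑ i, v i * (θ z * fderiv ℝ φ z (EuclideanSpace.single i 1)) := fun z => by
    conv_lhs => rw [hv]
    rw [map_sum, Finset.mul_sum]
    refine Finset.sum_congr rfl fun i _ => ?_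
    rw [map_smul, smul_eq_mul]; ring
  have h2 : ∀ z, φ z * inner ℝ (G z) v = ∑ i, v i * (G z i * φ z) := fun z => by
    rw [PiLp.inner_apply, Finset.mul_sum]
    refine Finset.sum_congr rfl fun i _ => ?_
    simp; ring
  simp_rw [h1, h2]
  rw [integral_finsetSum _ fun i _ => (hint i).const_mul _,
    integral_finsetSum _ fun i _ => (hint2 i).const_mul _, ← Finset.sum_neg_distrib]
  refine Finset.sum_congr rfl fun i _ => ?_
  rw [integral_const_mul, integral_const_mul, h.2.2 φ hφ hc i, mul_neg]

/-- Mollification commutes with the weak gradient. -/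
lemma HasWeakGradient.fderiv_moll {n : ℕ} {ε : ℝ} (hε : 0 < ε) {θ : E n → ℝ} {G : E n → E n}
    (h : HasWeakGradient θ G) (x v : E n) :
    fderiv ℝ (moll ε θ) x v = inner ℝ (moll ε G x) v := by
  have hcs := bump_hasCompactSupport (n := n) 0 hε
  have hb1 : ContDiff ℝ 1 (bump (0 : E n) ε) := (bump_contDiff 0 ε).of_le (by simp)
  have h1 := hcs.hasFDerivAt_convolution_left (ContinuousLinearMap.lsmul ℝ ℝ) hb1 h.1 x
  rw [← moll_eq_convolution] at h1
  rw [h1.fderiv]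
  have hcs' := hcs.fderiv (𝕜 := ℝ)
  have hex : MeasureTheory.ConvolutionExistsAt (fderiv ℝ (bump (0 : E n) ε)) θ x
      ((ContinuousLinearMap.lsmul ℝ ℝ).precompL (E n)) volume :=
    hcs'.convolutionExists_left _ (hb1.continuous_fderiv one_ne_zero) h.1 x
  rw [MeasureTheory.convolution_def, ContinuousLinearMap.integral_apply hex]
  have hder : ∀ z, fderiv ℝ (bump x ε) z v = -fderiv ℝ (bump (0 : E n) ε) (x - z) v := by
    intro z
    have h2 : HasFDerivAt (bump (0 : E n) ε) (fderiv ℝ (bump (0 : E n) ε) (x - z)) (x - z) :=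
      (hb1.differentiable one_ne_zero _).hasFDerivAt
    have h3 : HasFDerivAt (fun z => x - z) (-ContinuousLinearMap.id ℝ (E n)) z :=
      (hasFDerivAt_id z).const_sub x
    have h4 : HasFDerivAt (bump x ε) _ z := (h2.comp z h3).congr_of_eventuallyEq
      (Eventually.of_forall fun z => (bump_sub_comm x z ε).symm)
    rw [h4.fderiv]
    simp
  have h5 := h.integral_fderiv (bump_contDiff x ε) (bump_hasCompactSupport x hε) v
  have h6 : inner ℝ (moll ε G x) v = ∫ z, bump x ε z * inner ℝ (G z) v := by
    rw [real_inner_comm, moll, ← integral_inner (continuous_integrable_mul h.2.1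
      (bump_contDiff x ε).continuous (bump_hasCompactSupport x hε))]
    congr 1; ext z
    rw [inner_smul_right, real_inner_comm]
  rw [h6, ← neg_neg (∫ z, _ * _), ← h5, ← integral_neg,
    ← integral_sub_left_eq_self _ volume x]
  congr 1; ext z
  rw [hder, sub_sub_cancel]
  simp [mul_comm]

lemma aestronglyMeasurable_clm_apply {α : Type*} [MeasurableSpace α] {μ : Measure α} {n : ℕ}
    {L : α → E n →L[ℝ] ℝ} {u : α → E n} (hL : AEStronglyMeasurable L μ)
    (hu : AEStronglyMeasurable u μ) : AEStronglyMeasurable (fun x => L x (u x)) μ :=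
  isBoundedBilinearMap_apply.continuous.comp_aestronglyMeasurable (hL.prodMk hu)

lemma integrable_clm_apply {n : ℕ} {u : E n → E n} (hu : LocallyIntegrable u volume)
    {L : E n → E n →L[ℝ] ℝ} (hL : Continuous L) (hc : HasCompactSupport L) :
    Integrable (fun x => L x (u x)) volume := by
  have h1 : Integrable (fun x => ‖L x‖ • u x) volume :=
    hu.integrable_smul_left_of_hasCompactSupport hL.norm hc.norm
  refine h1.mono (aestronglyMeasurable_clm_apply hL.aestronglyMeasurable hu.aestronglyMeasurable)
    (Eventually.of_forall fun x => ?_)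
  rw [norm_smul, norm_norm]
  exact (L x).le_opNorm _

lemma tendsto_lintegral_mul_zero {α ι : Type*} [MeasurableSpace α] {μ : Measure α} {l : Filter ι}
    {a : ι → α → ℝ≥0∞} {b : α → ℝ≥0∞} (ha : ∀ i, AEMeasurable (a i) μ) (hb : AEMeasurable b μ)
    (hbt : ∫⁻ x, b x ^ 2 ∂μ < ⊤) (h : Tendsto (fun i => ∫⁻ x, a i x ^ 2 ∂μ) l (𝓝 0)) :
    Tendsto (fun i => ∫⁻ x, a i x * b x ∂μ) l (𝓝 0) := by
  refine tendsto_of_tendsto_of_tendsto_of_le_of_le tendsto_const_nhds ?_ (fun _ => zero_le)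
    (fun i => lintegral_mul_le_sqrt (ha i) hb)
  have h1 := ((ENNReal.continuous_rpow_const (y := (1 / 2 : ℝ))).tendsto 0).comp h
  have h2 := ENNReal.Tendsto.mul_const (b := (∫⁻ x, b x ^ 2 ∂μ) ^ (1 / 2 : ℝ)) h1
    (Or.inr (ENNReal.rpow_lt_top_of_nonneg (by norm_num) hbt.ne).ne)
  simpa using h2

/-- Chain rule for the transport operator of a divergence free `L²` field. -/
lemma WeakDivFree.integral_mul_deriv_comp {n : ℕ} {u G : E n → E n} {θ : E n → ℝ}
    (hu : WeakDivFree u) (hu2 : MemLp u 2 volume) (h : HasWeakGradient θ G)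
    (hθ2 : MemLp θ 2 volume) (hG2 : ∀ R : ℝ, MemLp G 2 (volume.restrict (closedBall 0 R)))
    {β : ℝ → ℝ} (hβ : ContDiff ℝ ∞ β) {K : ℝ} (hK : ∀ s, |deriv β s| ≤ K)
    {χ : E n → ℝ} (hχ : ContDiff ℝ ∞ χ) (hχc : HasCompactSupport χ) :
    ∫ x, χ x * (deriv β (θ x) * inner ℝ (G x) (u x)) = -∫ x, β (θ x) * fderiv ℝ χ x (u x) := by
  have hK0 : 0 ≤ K := (abs_nonneg _).trans (hK 0)
  have hlip : ∀ s t, |β s - β t| ≤ K * |s - t| := fun s t => by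
    have := Convex.norm_image_sub_le_of_norm_deriv_le (f := β) (C := K) (s := univ)
      (fun x _ => (hβ.differentiable (by simp)) x) (fun x _ => hK x) convex_univ (mem_univ t)
      (mem_univ s)
    simpa using this
  have hβc : Continuous (deriv β) := hβ.continuous_deriv (by simp)
  obtain ⟨R, hR⟩ := hχc.isCompact.isBounded.subset_closedBall (0 : E n)
  have hχ0 : ∀ x ∉ closedBall (0 : E n) R, χ x = 0 := fun x hx =>
    image_eq_zero_of_notMem_tsupport fun hx' => hx (hR hx')
  have hfχ0 : ∀ x ∉ closedBall (0 : E n) R, fderiv ℝ χ x = 0 := fun x hx =>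
    image_eq_zero_of_notMem_tsupport fun hx' => hx (hR (tsupport_fderiv_subset ℝ hx'))
  have hfχc : Continuous (fderiv ℝ χ) := hχ.continuous_fderiv (by simp)
  obtain ⟨C₀, hC₀⟩ := hχc.exists_bound_of_continuous hχ.continuous
  obtain ⟨C₁, hC₁⟩ := (hχc.fderiv (𝕜 := ℝ)).exists_bound_of_continuous hfχc
  have hC₀n : 0 ≤ C₀ := (norm_nonneg _).trans (hC₀ 0)
  have hC₁n : 0 ≤ C₁ := (norm_nonneg _).trans (hC₁ 0)
  -- `G` is only locally square integrable. Scales at most `1` do not see the truncation from points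
  -- of the ball of radius `R`, which contains the support of `χ`.
  set G' : E n → E n := (closedBall 0 (R + 1)).indicator G with hG'
  have hG'2 : MemLp G' 2 volume := (memLp_indicator_iff_restrict measurableSet_closedBall).2 (hG2 _)
  have hGeq : ∀ x ∈ closedBall (0 : E n) R, G x = G' x := fun x hx =>
    (indicator_of_mem (closedBall_subset_closedBall (by linarith) hx) G).symm
  have hmoll : ∀ ε : ℝ, 0 < ε → ε ≤ 1 → ∀ x ∈ closedBall (0 : E n) R,
      moll ε G x = moll ε G' x := fun ε hε hε1 x hx => by
    refine moll_eq_of_eqOn hε fun z hz => (indicator_of_mem ?_ G).symm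
    rw [mem_closedBall] at *
    linarith [dist_triangle z x 0]
  have hum := hu.1.aestronglyMeasurable
  have hGm := h.2.1.aestronglyMeasurable
  have hθm := h.1.aestronglyMeasurable
  -- the sequence of scales
  obtain ⟨e, he⟩ : ∃ e : ℕ → ℝ, ∀ k, e k = 1 / ((k : ℝ) + 1) := ⟨_, fun _ => rfl⟩
  have he0 : ∀ k, 0 < e k := fun k => by rw [he]; positivity
  have he1 : ∀ k, e k ≤ 1 := fun k => by
    rw [he, div_le_one (by positivity)]; linarith [(Nat.cast_nonneg k : (0:ℝ) ≤ k)]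
  have hetend : Tendsto e atTop (𝓝[>] 0) := by
    refine tendsto_nhdsWithin_iff.2 ⟨?_, Eventually.of_forall he0⟩
    refine (tendsto_one_div_add_atTop_nhds_zero_nat (𝕜 := ℝ)).congr fun k => (he k).symm
  have hmsm : ∀ k, ContDiff ℝ ∞ (moll (e k) θ) := fun k => moll_contDiff (he0 k) h.1
  have hmG' : ∀ k, Continuous (moll (e k) G') := fun k => by
    have : moll (e k) G' = MeasureTheory.convolution (bump (0 : E n) (e k)) G'
        (ContinuousLinearMap.lsmul ℝ ℝ) volume := by
      ext1 x; rw [moll_eq_integral_translate]; rfl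
    rw [this]
    exact (bump_hasCompactSupport 0 (he0 k)).continuous_convolution_left _
      (bump_contDiff 0 _).continuous (hG'2.locallyIntegrable one_le_two)
  -- the approximate identity
  set I : ℕ → E n → ℝ := fun k x => χ x * (deriv β (moll (e k) θ x) * inner ℝ (moll (e k) G x) (u x)) +
    β (moll (e k) θ x) * fderiv ℝ χ x (u x) with hI
  set I₀ : E n → ℝ := fun x => χ x * (deriv β (θ x) * inner ℝ (G x) (u x)) +
    β (θ x) * fderiv ℝ χ x (u x) with hI₀
  -- The products `χ * β (moll (e k) θ)` are admissible in the definition of divergence free, and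
  -- expanding their derivative gives the approximate identity.
  have hφ : ∀ k, ContDiff ℝ ∞ (fun x => χ x * β (moll (e k) θ x)) := fun k =>
    hχ.mul (hβ.comp (hmsm k))
  have hφc : ∀ k, HasCompactSupport (fun x => χ x * β (moll (e k) θ x)) := fun k => hχc.mul_right
  have hIeq : ∀ k x, I k x = fderiv ℝ (fun x => χ x * β (moll (e k) θ x)) x (u x) := fun k x => by
    have h1 : HasFDerivAt χ (fderiv ℝ χ x) x := (hχ.differentiable (by simp) x).hasFDerivAt
    have h2 : HasFDerivAt (moll (e k) θ) (fderiv ℝ (moll (e k) θ) x) x :=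
      ((hmsm k).differentiable (by simp) x).hasFDerivAt
    have h3 : HasDerivAt β (deriv β (moll (e k) θ x)) (moll (e k) θ x) :=
      (hβ.differentiable (by simp) _).hasDerivAt
    have h4 := h1.mul (h3.comp_hasFDerivAt x h2)
    have h5 : fderiv ℝ (fun x => χ x * β (moll (e k) θ x)) x = _ := h4.fderiv
    rw [h5]
    simp only [hI, add_apply, smul_apply, smul_eq_mul,
      Function.comp_apply]
    rw [h.fderiv_moll (he0 k)]
  have hIint : ∀ k, Integrable (I k) volume := fun k => by
    rw [show I k = _ from funext (hIeq k)]
    exact integrable_clm_apply hu.1 ((hφ k).continuous_fderiv (by simp)) ((hφc k).fderiv (𝕜 := ℝ))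
  have hIzero : ∀ k, ∫ x, I k x = 0 := fun k => by
    rw [show I k = _ from funext (hIeq k)]
    exact hu.2 _ (hφ k) (hφc k)
  -- integrability of the limit
  have hGu : Integrable (fun x => ‖G' x‖ * ‖u x‖) volume := hG'2.norm.integrable_mul hu2.norm
  have hθu : Integrable (fun x => |θ x| * ‖u x‖) volume := hθ2.norm.integrable_mul hu2.norm
  have ha : Integrable (fun x => χ x * (deriv β (θ x) * inner ℝ (G x) (u x))) volume := by
    refine (hGu.const_mul (C₀ * K)).mono' ?_ (Eventually.of_forall fun x => ?_)
    · exact hχ.continuous.aestronglyMeasurable.mul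
        ((hβc.comp_aestronglyMeasurable hθm).mul (hGm.inner hum))
    · by_cases hx : x ∈ closedBall (0 : E n) R
      · rw [norm_mul, norm_mul, mul_assoc, hGeq x hx]
        exact mul_le_mul (hC₀ x) (mul_le_mul (hK _) (norm_inner_le_norm _ _) (norm_nonneg _) hK0)
          (by positivity) hC₀n
      · rw [hχ0 x hx, zero_mul, norm_zero]; positivity
  have hb : Integrable (fun x => β (θ x) * fderiv ℝ χ x (u x)) volume := by
    have h1 := ((integrable_clm_apply hu.1 hfχc (hχc.fderiv (𝕜 := ℝ))).norm.const_mul |β 0|).add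
      (hθu.const_mul (K * C₁))
    refine h1.mono' ((hβ.continuous.comp_aestronglyMeasurable hθm).mul
      (aestronglyMeasurable_clm_apply hfχc.aestronglyMeasurable hum)) (Eventually.of_forall fun x => ?_)
    have h2 : |β (θ x)| ≤ |β 0| + K * |θ x| := by
      have := hlip (θ x) 0
      rw [sub_zero] at this
      linarith [abs_sub_abs_le_abs_sub (β (θ x)) (β 0)]
    have h3 : ‖fderiv ℝ χ x (u x)‖ ≤ C₁ * ‖u x‖ :=
      ((fderiv ℝ χ x).le_opNorm _).trans (by gcongr; exact hC₁ x)
    rw [norm_mul, Real.norm_eq_abs]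
    calc _ ≤ (|β 0| + K * |θ x|) * ‖fderiv ℝ χ x (u x)‖ := by gcongr
      _ = |β 0| * ‖fderiv ℝ χ x (u x)‖ + K * |θ x| * ‖fderiv ℝ χ x (u x)‖ := by ring
      _ ≤ |β 0| * ‖fderiv ℝ χ x (u x)‖ + K * |θ x| * (C₁ * ‖u x‖) := by gcongr
      _ = _ := by simp only [Pi.add_apply]; ring
  have hlim : Tendsto (fun k => ∫ x, I k x) atTop (𝓝 (∫ x, I₀ x)) := by
    refine tendsto_integral_of_L1 I₀ (ha.add hb).aestronglyMeasurable (Eventually.of_forall hIint) ?_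
    have hu2' : ∫⁻ x, ‖u x‖ₑ ^ 2 < ⊤ := by
      rw [← eLpNorm_two_sq]; exact ENNReal.pow_lt_top hu2.2
    have t1 : Tendsto (fun k => ∫⁻ x, ‖moll (e k) G' x - G' x‖ₑ * ‖u x‖ₑ) atTop (𝓝 0) :=
      tendsto_lintegral_mul_zero
        (fun k => ((hmG' k).aestronglyMeasurable.sub hG'2.1).enorm) hum.enorm hu2'
        ((tendsto_moll hG'2).comp hetend)
    have t2 : Tendsto (fun k => ∫⁻ x, ‖moll (e k) θ x - θ x‖ₑ * ‖u x‖ₑ) atTop (𝓝 0) :=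
      tendsto_lintegral_mul_zero
        (fun k => ((hmsm k).continuous.aestronglyMeasurable.sub hθ2.1).enorm) hum.enorm hu2'
        ((tendsto_moll hθ2).comp hetend)
    -- Here `deriv β` is only continuous and bounded along this argument, so almost everywhere
    -- convergence of the mollifications and domination by `2 * K` replace an `L²` estimate.
    have t3 : Tendsto (fun k => ∫⁻ x, ‖deriv β (moll (e k) θ x) - deriv β (θ x)‖ₑ *
        ‖‖G' x‖ * ‖u x‖‖ₑ) atTop (𝓝 0) := by
      have := tendsto_lintegral_of_dominated_convergence'
        (F := fun k x => ‖deriv β (moll (e k) θ x) - deriv β (θ x)‖ₑ * ‖‖G' x‖ * ‖u x‖‖ₑ)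
        (f := fun _ => 0) (μ := volume) (fun x => ENNReal.ofReal (2 * K) * ‖‖G' x‖ * ‖u x‖‖ₑ)
        (fun k => (((hβc.comp (hmsm k).continuous).aestronglyMeasurable.sub
          (hβc.comp_aestronglyMeasurable hθm)).enorm).mul hGu.1.enorm)
        (fun k => Eventually.of_forall fun x => ?_) ?_ ?_
      · simpa using this
      · refine mul_le_mul' ?_ le_rfl
        rw [← ofReal_norm]
        refine ENNReal.ofReal_le_ofReal ((norm_sub_le _ _).trans ?_)
        have h1 := hK (moll (e k) θ x)
        have h2 := hK (θ x)
        simp only [Real.norm_eq_abs]; linarith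
      · rw [lintegral_const_mul'' _ hGu.1.enorm]
        exact (ENNReal.mul_lt_top ENNReal.ofReal_lt_top hGu.2).ne
      · filter_upwards [ae_tendsto_integral_bump h.1] with x hx
        have h1 : Tendsto (fun k => moll (e k) θ x) atTop (𝓝 (θ x)) := by
          refine (hx.comp hetend).congr fun k => ?_
          simp only [moll, Function.comp, smul_eq_mul, mul_comm]
        have h2 : Tendsto (fun k => ‖deriv β (moll (e k) θ x) - deriv β (θ x)‖ₑ) atTop (𝓝 0) := by
          have := (((hβc.tendsto _).comp h1).sub_const (deriv β (θ x))).enorm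
          simpa using this
        have := ENNReal.Tendsto.mul_const (b := ‖‖G' x‖ * ‖u x‖‖ₑ) h2 (Or.inr enorm_ne_top)
        simpa using this
    have t4 := ((ENNReal.Tendsto.const_mul (a := ENNReal.ofReal (C₀ * K)) t1
      (Or.inr ENNReal.ofReal_ne_top)).add (ENNReal.Tendsto.const_mul (a := ENNReal.ofReal C₀) t3
      (Or.inr ENNReal.ofReal_ne_top))).add (ENNReal.Tendsto.const_mul (a := ENNReal.ofReal (K * C₁)) t2
      (Or.inr ENNReal.ofReal_ne_top))
    simp only [mul_zero, add_zero] at t4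
    refine tendsto_of_tendsto_of_tendsto_of_le_of_le tendsto_const_nhds t4 (fun _ => zero_le)
      (fun k => ?_)
    have m1 : AEMeasurable (fun x => ‖moll (e k) G' x - G' x‖ₑ * ‖u x‖ₑ) volume :=
      (((hmG' k).aestronglyMeasurable.sub hG'2.1).enorm).mul hum.enorm
    have m2 : AEMeasurable (fun x => ‖deriv β (moll (e k) θ x) - deriv β (θ x)‖ₑ *
        ‖‖G' x‖ * ‖u x‖‖ₑ) volume := (((hβc.comp (hmsm k).continuous).aestronglyMeasurable.sub
          (hβc.comp_aestronglyMeasurable hθm)).enorm).mul hGu.1.enorm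
    have m3 : AEMeasurable (fun x => ‖moll (e k) θ x - θ x‖ₑ * ‖u x‖ₑ) volume :=
      (((hmsm k).continuous.aestronglyMeasurable.sub hθ2.1).enorm).mul hum.enorm
    simp only
    rw [← lintegral_const_mul'' _ m1, ← lintegral_const_mul'' _ m2, ← lintegral_const_mul'' _ m3,
      ← lintegral_add_left' (m1.const_mul _), ← lintegral_add_right' _ (m3.const_mul _)]
    refine lintegral_mono fun x => ?_
    simp only [← ofReal_norm]
    rw [← ENNReal.ofReal_mul (norm_nonneg _), ← ENNReal.ofReal_mul (norm_nonneg _),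
      ← ENNReal.ofReal_mul (norm_nonneg _), ← ENNReal.ofReal_mul (by positivity),
      ← ENNReal.ofReal_mul (by positivity), ← ENNReal.ofReal_mul (by positivity),
      ← ENNReal.ofReal_add (by positivity) (by positivity),
      ← ENNReal.ofReal_add (by positivity) (by positivity)]
    refine ENNReal.ofReal_le_ofReal ?_
    by_cases hx : x ∈ closedBall (0 : E n) R
    -- The three errors come from replacing the mollified gradient, the argument of `deriv β`, and
    -- the argument of `β`.
    · have e1 : I k x - I₀ x = χ x * (deriv β (moll (e k) θ x) * inner ℝ (moll (e k) G' x - G' x) (u x))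
          + χ x * ((deriv β (moll (e k) θ x) - deriv β (θ x)) * inner ℝ (G' x) (u x))
          + (β (moll (e k) θ x) - β (θ x)) * fderiv ℝ χ x (u x) := by
        simp only [hI, hI₀]
        rw [hmoll _ (he0 k) (he1 k) x hx, hGeq x hx, inner_sub_left]; ring
      rw [e1]
      refine (norm_add₃_le).trans (add_le_add (add_le_add ?_ ?_) ?_)
      · rw [norm_mul, norm_mul, mul_assoc]
        exact mul_le_mul (hC₀ x) (mul_le_mul (hK _) (norm_inner_le_norm _ _) (norm_nonneg _) hK0)
          (by positivity) hC₀n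
      · rw [norm_mul, norm_mul, norm_mul ‖G' x‖, norm_norm, norm_norm]
        exact mul_le_mul (hC₀ x) (mul_le_mul le_rfl (norm_inner_le_norm _ _) (norm_nonneg _)
          (norm_nonneg _)) (by positivity) hC₀n
      · rw [norm_mul]
        calc _ ≤ (K * |moll (e k) θ x - θ x|) * (C₁ * ‖u x‖) :=
              mul_le_mul (hlip _ _) (((fderiv ℝ χ x).le_opNorm _).trans (by gcongr; exact hC₁ x))
                (norm_nonneg _) (by positivity)
          _ = _ := by rw [Real.norm_eq_abs]; ring
    · have : I k x - I₀ x = 0 := by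
        simp only [hI, hI₀]
        rw [hχ0 x hx, hfχ0 x hx]; simp
      rw [this, norm_zero]; positivity
  simp only [hIzero] at hlim
  have h0 : ∫ x, I₀ x = 0 := tendsto_nhds_unique hlim tendsto_const_nhds
  have h1 : ∫ x, I₀ x = (∫ x, χ x * (deriv β (θ x) * inner ℝ (G x) (u x))) +
    ∫ x, β (θ x) * fderiv ℝ χ x (u x) := integral_add ha hb
  linarith


/-! ### Measurable control of the oscillation in time -/

/-- The double integral measuring the oscillation of `f` over a closed ball. -/
def oscInt {n : ℕ} {F : Type*} [NormedAddCommGroup F] (f : E n → F) (x : E n) (r : ℝ) : ℝ≥0∞ :=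
  ∫⁻ y in closedBall x r, ∫⁻ z in closedBall x r, ‖f y - f z‖ₑ

/-- The supremum of the mean oscillations over a countable family of balls. -/
def oscSup {n : ℕ} {F : Type*} [NormedAddCommGroup F] (f : E n → F) : ℝ≥0∞ :=
  ⨆ (k : ℕ) (r : ℚ), oscInt f (TopologicalSpace.denseSeq (E n) k) r / volume (closedBall (TopologicalSpace.denseSeq (E n) k) (r : ℝ)) ^ 2

section
variable {n : ℕ} {F : Type*} [NormedAddCommGroup F]

lemma oscInt_mono (f : E n → F) {x x' : E n} {r r' : ℝ} (h : closedBall x r ⊆ closedBall x' r') :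
    oscInt f x r ≤ oscInt f x' r' :=
  (lintegral_mono_set h).trans (lintegral_mono fun _ => lintegral_mono_set h)

lemma oscInt_congr_ae {f f' : E n → F} (h : f =ᵐ[volume] f') (x : E n) (r : ℝ) :
    oscInt f x r = oscInt f' x r := by
  refine lintegral_congr_ae ?_
  filter_upwards [ae_restrict_of_ae h] with y hy
  refine lintegral_congr_ae ?_
  filter_upwards [ae_restrict_of_ae h] with z hz
  rw [hy, hz]

lemma volume_closedBall_ne (x : E n) {r : ℝ} (hr : 0 < r) : volume (closedBall x r) ≠ 0 :=
  (measure_closedBall_pos _ _ hr).ne'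

/-- A ball sits in a ball of the countable family of less than twice its radius; the squared volume
ratio gives `4 ^ n`. -/
lemma oscInt_le_oscSup (f : E n → F) (x : E n) {r : ℝ} (hr : 0 < r) :
    oscInt f x r ≤ 4 ^ n * oscSup f * volume (closedBall x r) ^ 2 := by
  obtain ⟨k, hk⟩ := (TopologicalSpace.denseRange_denseSeq (E n)).exists_dist_lt x (show (0:ℝ) < r / 2 by linarith)
  obtain ⟨ρ, hρ1, hρ2⟩ := exists_rat_btwn (show 3 / 2 * r < 2 * r by linarith)
  set c := TopologicalSpace.denseSeq (E n) k
  have hρ : (0 : ℝ) < ρ := by linarith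
  have hsub : closedBall x r ⊆ closedBall c ρ := by
    refine closedBall_subset_closedBall' ?_; linarith
  have hvol : volume (closedBall c (ρ : ℝ)) ≤ 2 ^ n * volume (closedBall x r) := by
    rw [volume_closedBall_eq c hρ.le, volume_closedBall_eq x hr.le,
      show (2 : ℝ≥0∞) ^ n = ENNReal.ofReal (2 ^ n) by rw [ENNReal.ofReal_pow (by norm_num)]; simp,
      ← ENNReal.ofReal_mul (by positivity), ← mul_assoc, ← mul_pow]
    have := unitVol_pos n
    gcongr
  have hle : oscInt f c ρ / volume (closedBall c (ρ : ℝ)) ^ 2 ≤ oscSup f :=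
    le_iSup₂ (f := fun k (r : ℚ) => oscInt f (TopologicalSpace.denseSeq (E n) k) r /
      volume (closedBall (TopologicalSpace.denseSeq (E n) k) (r : ℝ)) ^ 2) k ρ
  have h2 : oscInt f c ρ ≤ oscSup f * volume (closedBall c (ρ : ℝ)) ^ 2 :=
    (ENNReal.div_le_iff (pow_ne_zero 2 (volume_closedBall_ne c hρ))
      (ENNReal.pow_ne_top measure_closedBall_lt_top.ne)).1 hle
  calc oscInt f x r ≤ oscInt f c ρ := oscInt_mono f hsub
    _ ≤ oscSup f * (2 ^ n * volume (closedBall x r)) ^ 2 := h2.trans (by gcongr)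
    _ = _ := by
        rw [mul_pow, ← pow_mul, mul_comm n 2, pow_mul, show (2 : ℝ≥0∞) ^ 2 = 4 by norm_num]; ring

lemma oscSup_le {f : E n → F} {A : ℝ≥0∞}
    (h : ∀ x r, 0 < r → oscInt f x r ≤ A * volume (closedBall x r) ^ 2) : oscSup f ≤ A := by
  refine iSup₂_le fun k r => ?_
  set c := TopologicalSpace.denseSeq (E n) k
  -- The rational radii include nonpositive ones, which contribute zero.
  rcases lt_trichotomy (r : ℝ) 0 with hr | hr | hr
  · simp [oscInt, closedBall_eq_empty.2 hr]
  · rw [hr]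
    have : oscInt f c 0 = 0 := by
      simp [oscInt, closedBall_zero]
    simp [this]
  · exact (ENNReal.div_le_iff (pow_ne_zero 2 (volume_closedBall_ne c hr))
      (ENNReal.pow_ne_top measure_closedBall_lt_top.ne)).2 (h _ _ hr)

lemma oscSup_le_eLpNorm_top (f : E n → F) : oscSup f ≤ 2 * eLpNorm f ⊤ volume := by
  refine oscSup_le fun x r hr => ?_
  have h : ∀ᵐ y ∂(volume.restrict (closedBall x r)), ‖f y‖ₑ ≤ eLpNorm f ⊤ volume := by
    rw [eLpNorm_exponent_top]
    exact ae_restrict_of_ae (enorm_ae_le_eLpNormEssSup f volume)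
  calc oscInt f x r ≤ ∫⁻ y in closedBall x r, ∫⁻ z in closedBall x r, 2 * eLpNorm f ⊤ volume := by
        refine lintegral_mono_ae ?_
        filter_upwards [h] with y hy
        refine lintegral_mono_ae ?_
        filter_upwards [h] with z hz
        rw [two_mul]
        exact enorm_sub_le.trans (add_le_add hy hz)
    _ = _ := by simp only [lintegral_const, Measure.restrict_apply_univ]; ring

lemma cube_subset_closedBall (x : E n) {r : ℝ} (hr : 0 ≤ r) :
    cube x r ⊆ closedBall x ((n + 1) * r) := by
  intro y hy
  rw [mem_closedBall, dist_eq_norm]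
  refine (norm_le_sum_abs _).trans ?_
  calc ∑ i, |(y - x) i| ≤ ∑ _i : Fin n, r := Finset.sum_le_sum fun i _ => hy i
    _ ≤ _ := by simp; nlinarith

lemma closedBall_subset_cube (x : E n) (r : ℝ) : closedBall x r ⊆ cube x r := by
  intro y hy i
  rw [mem_closedBall, dist_eq_norm] at hy
  exact (abs_apply_le_norm (y - x) i).trans hy

/-- A ball is compared with the concentric cube of half side `r`, itself contained in the ball of
radius `(n + 1) * r`. The `2` comes from inserting the mean over the cube. -/
lemma oscSup_le_bmoNorm [NormedSpace ℝ F] {f : E n → F} (hf : AEStronglyMeasurable f volume) :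
    oscSup f ≤ (2 * (n + 1 : NNReal) ^ n : NNReal) * bmoNorm f := by
  refine oscSup_le fun x r hr => ?_
  set Q := cube x r
  set B := closedBall x r
  have hBQ : B ⊆ Q := closedBall_subset_cube x r
  have hQ0 : volume Q ≠ 0 := ((measure_closedBall_pos volume x hr).trans_le (measure_mono hBQ)).ne'
  have hQle : volume Q ≤ ((n + 1 : NNReal) ^ n : NNReal) * volume B := by
    refine (measure_mono (cube_subset_closedBall x hr.le)).trans ?_
    rw [volume_closedBall_eq x (by positivity), volume_closedBall_eq x hr.le,
      ← ENNReal.ofReal_coe_nnreal, ← ENNReal.ofReal_mul (by positivity)]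
    refine ENNReal.ofReal_le_ofReal (le_of_eq ?_)
    push_cast; rw [mul_pow]; ring
  have hQt : volume Q ≠ ⊤ := (hQle.trans_lt
    (ENNReal.mul_lt_top ENNReal.coe_lt_top measure_closedBall_lt_top)).ne
  set c := ⨍ z in Q, f z
  have h1 : (volume Q)⁻¹ * ∫⁻ y in Q, ‖f y - c‖ₑ ≤ bmoNorm f := by
    have hae := enorm_ae_le_eLpNormEssSup (sharpMaximal f) volume
    -- The norm is an essential supremum, but the cube has positive measure and hence contains a
    -- point where the bound holds; the cube itself competes in the sharp maximal function there.
    obtain ⟨y, hy, hyQ⟩ : ∃ y, ‖sharpMaximal f y‖ₑ ≤ eLpNormEssSup (sharpMaximal f) volume ∧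
        y ∈ Q := by
      by_contra hcon
      push Not at hcon
      refine hQ0 (measure_mono_null (fun y hy => ?_) hae)
      exact fun h => hcon y h hy
    rw [bmoNorm, eLpNorm_exponent_top]
    refine le_trans ?_ hy
    rw [enorm_eq_self, sharpMaximal]
    exact le_iSup_of_le x (le_iSup_of_le r (le_iSup_of_le hr (le_iSup_of_le hyQ le_rfl)))
  have h2 : ∫⁻ y in Q, ‖f y - c‖ₑ ≤ bmoNorm f * volume Q := by
    rwa [← ENNReal.div_eq_inv_mul, ENNReal.div_le_iff hQ0 hQt] at h1
  have hm : AEMeasurable (fun z => ‖f z - c‖ₑ) (volume.restrict B) :=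
    (hf.sub aestronglyMeasurable_const).enorm.restrict
  calc oscInt f x r ≤ ∫⁻ y in B, ∫⁻ z in B, (‖f y - c‖ₑ + ‖f z - c‖ₑ) := by
        refine lintegral_mono fun y => lintegral_mono fun z => ?_
        rw [← sub_sub_sub_cancel_right (f y) (f z) c]
        exact enorm_sub_le
    _ = 2 * volume B * ∫⁻ z in B, ‖f z - c‖ₑ := by
        simp_rw [lintegral_add_left measurable_const]
        rw [lintegral_add_right _ measurable_const]
        simp only [lintegral_const, Measure.restrict_apply_univ]
        rw [lintegral_mul_const'' _ hm]
        ring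
    _ ≤ 2 * volume B * (bmoNorm f * (((n + 1 : NNReal) ^ n : NNReal) * volume B)) := by
        gcongr
        exact (lintegral_mono_set hBQ).trans (h2.trans (by gcongr))
    _ = _ := by push_cast; ring

/-- For a fixed ball, Tonelli gives measurability in time, and the supremum is countable. The
supremum over all cubes in the `BMO` norm gives no such direct argument. -/
lemma aemeasurable_oscSup {ν : Measure ℝ} [SFinite ν] {f : ℝ → E n → F}
    (hf : AEStronglyMeasurable (Function.uncurry f) (ν.prod volume)) :
    AEMeasurable (fun t => oscSup (f t)) ν := by
  refine AEMeasurable.iSup fun k => AEMeasurable.iSup fun r => AEMeasurable.div_const ?_ _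
  set f' : ℝ × E n → F := hf.mk _
  have hm : StronglyMeasurable f' := hf.stronglyMeasurable_mk
  set B := closedBall (TopologicalSpace.denseSeq (E n) k) (r : ℝ)
  have h1 : Measurable fun t => ∫⁻ y in B, ∫⁻ z in B, ‖f' (t, y) - f' (t, z)‖ₑ := by
    refine Measurable.lintegral_prod_right' (ν := volume.restrict B)
      (f := fun q : ℝ × E n => ∫⁻ z in B, ‖f' (q.1, q.2) - f' (q.1, z)‖ₑ) ?_
    refine Measurable.lintegral_prod_right' (ν := volume.restrict B)
      (f := fun q : (ℝ × E n) × E n => ‖f' (q.1.1, q.1.2) - f' (q.1.1, q.2)‖ₑ) ?_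
    have a1 : StronglyMeasurable fun q : (ℝ × E n) × E n => f' (q.1.1, q.1.2) :=
      hm.comp_measurable (by fun_prop)
    have a2 : StronglyMeasurable fun q : (ℝ × E n) × E n => f' (q.1.1, q.2) :=
      hm.comp_measurable (by fun_prop)
    exact (a1.sub a2).enorm
  refine ⟨_, h1, ?_⟩
  filter_upwards [Measure.ae_ae_of_ae_prod hf.ae_eq_mk] with t ht
  exact oscInt_congr_ae ht _ _

end

/-- The oscillation of the gradient of a function in the uniqueness class is controlled by an
integrable function of time. -/
lemma exists_lintegral_lt_top_oscInt_le {n : ℕ} {T : ℝ} {s : ℝ≥0∞} (hs : 1 ≤ s)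
    {g b : ℝ → E n → E n} (hg : MemLqLp T 1 ⊤ g) (hb : MemLsBMO T s b) :
    ∃ N : ℝ → ℝ≥0∞, AEMeasurable N (volume.restrict (Ioo 0 T)) ∧ ∫⁻ t in Ioo 0 T, N t < ⊤ ∧
      ∀ᵐ t ∂(volume.restrict (Ioo 0 T)), ∀ x r, 0 < r →
        oscInt (fun y => g t y + b t y) x r ≤ N t * volume (closedBall x r) ^ 2 := by
  have mg := aemeasurable_oscSup hg.1
  have mb := aemeasurable_oscSup hb.1
  have ig : ∫⁻ t in Ioo 0 T, oscSup (g t) < ⊤ := by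
    have h1 := hg.2
    rw [eLpNorm_one_eq_lintegral_enorm] at h1
    simp only [enorm_eq_self] at h1
    calc _ ≤ ∫⁻ t in Ioo 0 T, 2 * eLpNorm (g t) ⊤ volume :=
          lintegral_mono fun t => oscSup_le_eLpNorm_top (g t)
      _ = 2 * ∫⁻ t in Ioo 0 T, eLpNorm (g t) ⊤ volume := lintegral_const_mul' _ _ (by simp)
      _ < ⊤ := ENNReal.mul_lt_top (by simp) h1
  have ib : ∫⁻ t in Ioo 0 T, oscSup (b t) < ⊤ := by
    have h1 : eLpNorm (fun t => oscSup (b t)) s (volume.restrict (Ioo 0 T)) < ⊤ := by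
      refine (eLpNorm_le_nnreal_smul_eLpNorm_of_ae_le_mul' (g := fun t => bmoNorm (b t))
        (c := 2 * (n + 1 : NNReal) ^ n) ?_ s).trans_lt ?_
      · filter_upwards [hb.2.1] with t ht
        simpa only [enorm_eq_self] using oscSup_le_bmoNorm ht.1.aestronglyMeasurable
      · exact ENNReal.mul_lt_top ENNReal.coe_lt_top hb.2.2
    -- Hölder on the finite interval is applied to the measurable `oscSup`, not to the `BMO` norm.
    have h2 := MemLp.mono_exponent (p := 1) ⟨mb.aestronglyMeasurable, h1⟩ hs
    have h3 := h2.2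
    rw [eLpNorm_one_eq_lintegral_enorm] at h3
    simpa only [enorm_eq_self] using h3
  refine ⟨fun t => 4 ^ n * (oscSup (g t) + oscSup (b t)), (mg.add mb).const_mul _, ?_, ?_⟩
  · simp only
    rw [lintegral_const_mul' _ _ (by finiteness), lintegral_add_left' mg]
    refine ENNReal.mul_lt_top (by finiteness) ?_
    exact ENNReal.add_lt_top.2 ⟨ig, ib⟩
  · filter_upwards [hb.2.1, Measure.ae_ae_of_ae_prod hg.1.ae_eq_mk] with t hbt hgt x r hr
    have hgm : AEStronglyMeasurable (g t) volume :=
      ⟨_, hg.1.stronglyMeasurable_mk.comp_measurable measurable_prodMk_left, hgt⟩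
    have hbm := hbt.1.aestronglyMeasurable
    calc oscInt (fun y => g t y + b t y) x r
        ≤ ∫⁻ y in closedBall x r, ∫⁻ z in closedBall x r, (‖g t y - g t z‖ₑ + ‖b t y - b t z‖ₑ) := by
          refine lintegral_mono fun y => lintegral_mono fun z => ?_
          rw [show g t y + b t y - (g t z + b t z) = (g t y - g t z) + (b t y - b t z) by abel]
          exact enorm_add_le _ _
      _ = oscInt (g t) x r + oscInt (b t) x r := by
          have a1 : ∀ y, AEMeasurable (fun z => ‖g t y - g t z‖ₑ) (volume.restrict (closedBall x r)) :=
            fun y => (aestronglyMeasurable_const.sub hgm).enorm.restrict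
          have a2 : AEMeasurable (fun y => ∫⁻ z in closedBall x r, ‖g t y - g t z‖ₑ)
              (volume.restrict (closedBall x r)) := by
            refine AEMeasurable.lintegral_prod_right' (f := fun q : E n × E n => ‖g t q.1 - g t q.2‖ₑ) ?_
            exact (hgm.restrict.comp_fst.sub hgm.restrict.comp_snd).enorm
          simp_rw [fun y => lintegral_add_left' (a1 y) (fun z => ‖b t y - b t z‖ₑ)]
          rw [lintegral_add_left' a2]
          rfl
      _ ≤ _ := by
          rw [mul_add, add_mul]
          exact add_le_add (oscInt_le_oscSup _ _ hr) (oscInt_le_oscSup _ _ hr)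

/-- Replacing `N` by `N + S` makes the small mass condition automatic for `R ≥ 1`. The level `-1`
turns the John–Nirenberg tail into the whole integral. -/
lemma HasWeakGradient.lintegral_sq_closedBall_le {n : ℕ} {θ : E n → ℝ} {G : E n → E n}
    (h : HasWeakGradient θ G) (hθ2 : Integrable (fun y => θ y ^ 2) volume) {N S R : ℝ} (hN : 0 < N)
    (hS : 0 ≤ S) (hNS : ∫ y, θ y ^ 2 ≤ S ^ 2) (hosc : BallOsc G N) (hR : 1 ≤ R) :
    ∫⁻ x in closedBall 0 R, ‖G x‖ₑ ^ 2 ≤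
      ENNReal.ofReal (64 / jnRate n ^ 2 * Real.exp (jnRate n * avgConst n) *
        Real.exp (jnRate n / 2) * (N + S) ^ 2) * volume (closedBall (0 : E n) R) := by
  have hN' : 0 < N + S := by linarith
  have hosc' : BallOsc G (N + S) := fun x r hr => (hosc x r hr).trans (by
    gcongr; linarith)
  have h1 : ‖ballAvg G 0 R‖ ≤ avgConst n * (N + S) := by
    refine h.norm_ballAvg_le hθ2 hN' hosc' (by linarith) ?_
    calc ∫ y in closedBall 0 R, θ y ^ 2 ≤ ∫ y, θ y ^ 2 :=
          setIntegral_le_integral hθ2 (Eventually.of_forall fun _ => sq_nonneg _)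
      _ ≤ (N + S) ^ 2 * 1 := by nlinarith
      _ ≤ _ := by gcongr; exact one_le_pow₀ hR
  have h2 := hosc'.lintegral_sq_level_le hN' h.2.1 0 (by linarith : (0:ℝ) < R) h1 (-1)
  have h3 : {y | -1 * (N + S) < ‖G y‖} = univ := by
    ext y; simp only [mem_ofPred_eq, mem_univ, iff_true]; linarith [norm_nonneg (G y)]
  rw [h3] at h2
  simp only [indicator_univ] at h2
  refine h2.trans (le_of_eq ?_)
  rw [show -(jnRate n / 2 * -1) = jnRate n / 2 by ring]

/-! ### The transport equation integrated in time -/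

lemma contDiff_primitive {a : ℝ → ℝ} (ha : ContDiff ℝ ∞ a) (c : ℝ) :
    ContDiff ℝ ∞ (fun t => ∫ v in c..t, a v) := by
  have hd : ∀ t, HasDerivAt (fun t => ∫ v in c..t, a v) (a t) t := fun t =>
    ha.continuous.integral_hasStrictDerivAt c t |>.hasDerivAt
  rw [contDiff_infty_iff_deriv]
  refine ⟨fun t => (hd t).differentiableAt, ?_⟩
  rwa [show deriv (fun t => ∫ v in c..t, a v) = a from funext fun t => (hd t).deriv]

lemma integral_primitive_mul {h a : ℝ → ℝ} {T : ℝ} (hh : IntervalIntegrable h volume 0 T)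
    (ha : Continuous a) :
    ∫ t in 0..T, h t * ∫ v in T..t, a v = -∫ t in 0..T, (∫ v in 0..t, h v) * a t := by
  have hia : IntervalIntegrable a volume 0 T := ha.intervalIntegrable _ _
  have h1 : AbsolutelyContinuousOnInterval (fun t => ∫ v in 0..t, h v) 0 T :=
    hh.absolutelyContinuousOnInterval_intervalIntegral left_mem_uIcc
  have h2 : AbsolutelyContinuousOnInterval (fun t => ∫ v in T..t, a v) 0 T :=
    hia.absolutelyContinuousOnInterval_intervalIntegral right_mem_uIcc
  have h3 := h1.integral_mul_deriv_eq_deriv_mul h2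
  simp only [intervalIntegral.integral_same, mul_zero, zero_mul, sub_zero, zero_sub] at h3
  have e1 : ∫ t in 0..T, (∫ v in 0..t, h v) * deriv (fun t => ∫ v in T..t, a v) t =
      ∫ t in 0..T, (∫ v in 0..t, h v) * a t := by
    congr 1; ext t
    rw [ha.deriv_integral]
  have e2 : ∫ t in 0..T, deriv (fun t => ∫ v in 0..t, h v) t * ∫ v in T..t, a v =
      ∫ t in 0..T, h t * ∫ v in T..t, a v := by
    refine intervalIntegral.integral_congr_ae ?_
    filter_upwards [hh.ae_hasDerivAt_integral] with t ht htm
    rw [(ht (uIoc_subset_uIcc htm) 0 left_mem_uIcc).deriv]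
  rw [e1, e2] at h3
  linarith

/-- Test functions need not vanish at time `0`, so the identity encodes a zero initial value and
leaves no free constant. -/
lemma ae_eq_neg_primitive {T : ℝ} (hT : 0 < T) {f h : ℝ → ℝ} (hf : IntegrableOn f (Ioo 0 T))
    (hh : IntegrableOn h (Ioo 0 T))
    (hw : ∀ A : ℝ → ℝ, ContDiff ℝ ∞ A → HasCompactSupport A → tsupport A ⊆ Iio T →
      ∫ t in Ioo 0 T, (f t * deriv A t - h t * A t) = 0) :
    ∀ᵐ t ∂(volume.restrict (Ioo 0 T)), f t = -∫ v in 0..t, h v := by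
  have hhi : IntervalIntegrable h volume 0 T :=
    (intervalIntegrable_iff_integrableOn_Ioo_of_le hT.le).2 hh
  have hΦc : ContinuousOn (fun t => ∫ v in 0..t, h v) (Icc 0 T) := by
    have := (hhi.absolutelyContinuousOnInterval_intervalIntegral left_mem_uIcc).continuousOn
    rwa [uIcc_of_le hT.le] at this
  have hΦi : IntegrableOn (fun t => ∫ v in 0..t, h v) (Ioo 0 T) :=
    (hΦc.integrableOn_Icc).mono_set Ioo_subset_Icc_self
  rw [ae_restrict_iff' measurableSet_Ioo]
  have key := isOpen_Ioo.ae_eq_zero_of_integral_contDiff_smul_eq_zero (μ := volume)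
    (U := Ioo 0 T) (f := fun t => f t + ∫ v in 0..t, h v) (hf.add hΦi).locallyIntegrableOn ?_
  · filter_upwards [key] with t ht htm
    linarith [ht htm]
  intro a ha hac has
  obtain ⟨T', hT'0, hT', hsub⟩ : ∃ T', 0 < T' ∧ T' < T ∧ tsupport a ⊆ Icc 0 T' := by
    rcases (tsupport a).eq_empty_or_nonempty with he | hne
    · exact ⟨T / 2, by linarith, by linarith, by simp [he]⟩
    · obtain ⟨x, hx, hmax⟩ := hac.isCompact.exists_isMaxOn hne continuousOn_id
      exact ⟨x, (has hx).1, (has hx).2, fun y hy => ⟨(has hy).1.le, hmax hy⟩⟩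
  -- The primitive of `a` taken from `T` vanishes beyond `T'` and has derivative `a`; the cutoff,
  -- equal to `1` on `(0,T)`, only makes its support compact on the negative side.
  let χ : ContDiffBump (0 : ℝ) := ⟨T, T + 1, hT, by linarith⟩
  set A : ℝ → ℝ := fun t => χ t * ∫ v in T..t, a v with hA
  have hAs : ContDiff ℝ ∞ A := χ.contDiff.mul (contDiff_primitive ha T)
  have hAc : HasCompactSupport A := χ.hasCompactSupport.mul_right
  have hAsub : tsupport A ⊆ Iio T := by
    have : tsupport A ⊆ Iic T' := closure_minimal (fun t ht => by
      by_contra hcon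
      have hlt : T' < t := not_le.1 hcon
      refine ht ?_
      have : ∫ v in T..t, a v = 0 := by
        rw [intervalIntegral.integral_congr (g := fun _ => 0) (fun v hv => ?_)]
        · simp
        · refine image_eq_zero_of_notMem_tsupport fun hv' => ?_
          have h1 := (hsub hv').2
          have h2 : min T t ≤ v := hv.1
          have h3 : T' < min T t := lt_min hT' hlt
          linarith
      simp only [hA, this, mul_zero]) isClosed_Iic
    exact this.trans fun t ht => lt_of_le_of_lt ht hT'
  have hχ1 : ∀ t ∈ Ioo 0 T, χ t = 1 := fun t ht => χ.one_of_mem_closedBall (by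
    rw [mem_closedBall, dist_zero_right, Real.norm_eq_abs, abs_of_pos ht.1]; exact ht.2.le)
  have hA1 : ∀ t ∈ Ioo 0 T, A t = ∫ v in T..t, a v := fun t ht => by
    simp only [hA, hχ1 t ht, one_mul]
  have hA2 : ∀ t ∈ Ioo 0 T, deriv A t = a t := fun t ht => by
    have : A =ᶠ[𝓝 t] fun t => ∫ v in T..t, a v := by
      filter_upwards [isOpen_Ioo.mem_nhds ht] with s hs using hA1 s hs
    rw [this.deriv_eq, ha.continuous.deriv_integral]
  have h1 := hw A hAs hAc hAsub
  rw [setIntegral_congr_fun measurableSet_Ioo (g := fun t => a t * f t - h t * ∫ v in T..t, a v)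
    (fun t ht => by simp only [hA1 t ht, hA2 t ht]; ring)] at h1
  obtain ⟨C, hC⟩ := hac.exists_bound_of_continuous ha.continuous
  have i1 : IntegrableOn (fun t => a t * f t) (Ioo 0 T) :=
    Integrable.bdd_mul hf ha.continuous.aestronglyMeasurable (Eventually.of_forall hC)
  have i1' : IntegrableOn (fun t => a t * ∫ v in 0..t, h v) (Ioo 0 T) :=
    Integrable.bdd_mul hΦi ha.continuous.aestronglyMeasurable (Eventually.of_forall hC)
  have i2 : IntegrableOn (fun t => h t * ∫ v in T..t, a v) (Ioo 0 T) := by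
    rw [← intervalIntegrable_iff_integrableOn_Ioo_of_le hT.le]
    exact hhi.mul_continuousOn (contDiff_primitive ha T).continuous.continuousOn
  rw [integral_sub i1 i2] at h1
  have h2 := integral_primitive_mul hhi ha.continuous
  rw [intervalIntegral.integral_of_le hT.le, intervalIntegral.integral_of_le hT.le,
    integral_Ioc_eq_integral_Ioo, integral_Ioc_eq_integral_Ioo] at h2
  have h3 : ∫ t, a t • (f t + ∫ v in 0..t, h v) =
      ∫ t in Ioo 0 T, (a t * f t + a t * ∫ v in 0..t, h v) := by
    rw [← setIntegral_eq_integral_of_forall_compl_eq_zero (s := Ioo 0 T)]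
    · simp only [smul_eq_mul, mul_add]
    · intro t ht
      rw [image_eq_zero_of_notMem_tsupport fun h' => ht (has h'), zero_smul]
  rw [h3, integral_add i1 i1']
  simp only [mul_comm (∫ v in 0.._, h v)] at h2
  linarith

/-- A locally integrable function which is orthogonal to a countable dense family of bumps
vanishes. -/
lemma ae_eq_zero_of_integral_bump {n : ℕ} {W : E n → ℝ} (hW : LocallyIntegrable W volume)
    (h : ∀ k j : ℕ, ∫ x, W x * bump (TopologicalSpace.denseSeq (E n) k) (1 / ((j : ℝ) + 1)) x = 0) :
    W =ᵐ[volume] 0 := by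
  -- Mollifications are continuous, so vanishing at a dense sequence of centres suffices.
  have h0 : ∀ j : ℕ, moll (1 / ((j : ℝ) + 1)) W = 0 := fun j => by
    refine Continuous.ext_on (TopologicalSpace.denseRange_denseSeq (E n))
      (moll_contDiff (by positivity) hW).continuous continuous_zero ?_
    rintro _ ⟨k, rfl⟩
    rw [Pi.zero_apply, ← h k j, moll]
    simp only [smul_eq_mul, mul_comm]
  filter_upwards [ae_tendsto_integral_bump hW] with x hx
  have hetend : Tendsto (fun j : ℕ => 1 / ((j : ℝ) + 1)) atTop (𝓝[>] 0) :=
    tendsto_nhdsWithin_iff.2 ⟨tendsto_one_div_add_atTop_nhds_zero_nat (𝕜 := ℝ),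
      Eventually.of_forall fun k => by show (0:ℝ) < _; positivity⟩
  refine tendsto_nhds_unique (hx.comp hetend) (tendsto_const_nhds.congr fun j => ?_)
  have := congrFun (h0 j) x
  rw [moll] at this
  simp only [Function.comp, mul_comm (W _)]
  simpa using this.symm

/-! ### Weak solutions in the uniqueness class at a fixed time -/

/-- The properties at almost every fixed time of a weak solution in the uniqueness class. -/
structure RegularAt {n : ℕ} (S N : ℝ) (θ : E n → ℝ) (u G : E n → E n) : Prop where
  grad : HasWeakGradient θ G
  osc : BallOsc G N
  pos : 0 < N
  memLp_scalar : MemLp θ 2 volume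
  scalar_le : ∫⁻ x, ‖θ x‖ₑ ^ 2 ≤ ENNReal.ofReal (S ^ 2)
  memLp_drift : MemLp u 2 volume
  drift_le : ∫⁻ x, ‖u x‖ₑ ^ 2 ≤ ENNReal.ofReal (S ^ 2)
  div_free : WeakDivFree u

/-- The constant in `RegularAt.lintegral_sq_grad_le`. -/
def gradConst (n : ℕ) (R : ℝ) : ℝ :=
  64 / jnRate n ^ 2 * Real.exp (jnRate n * avgConst n) * Real.exp (jnRate n / 2) *
    (R ^ n * unitVol n)

lemma gradConst_nonneg (n : ℕ) {R : ℝ} (hR : 0 ≤ R) : 0 ≤ gradConst n R := by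
  have := unitVol_pos n; unfold gradConst; positivity

lemma integral_sq_le_of_lintegral_le {n : ℕ} {θ : E n → ℝ} (hθ : MemLp θ 2 volume) {A : ℝ}
    (hA : 0 ≤ A) (h : ∫⁻ x, ‖θ x‖ₑ ^ 2 ≤ ENNReal.ofReal A) : ∫ x, θ x ^ 2 ≤ A := by
  rw [← ENNReal.ofReal_le_ofReal_iff hA, ofReal_integral_eq_lintegral_ofReal hθ.integrable_sq
    (Eventually.of_forall fun _ => sq_nonneg _)]
  refine le_trans (le_of_eq (lintegral_congr fun x => ?_)) h
  rw [← ofReal_norm, ← ENNReal.ofReal_pow (norm_nonneg _), Real.norm_eq_abs, sq_abs]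

namespace RegularAt
variable {n : ℕ} {S N : ℝ} {θ : E n → ℝ} {u G : E n → E n}

lemma lintegral_sq_grad_le (h : RegularAt S N θ u G) (hS : 0 ≤ S) {R : ℝ} (hR : 1 ≤ R) :
    ∫⁻ x in closedBall 0 R, ‖G x‖ₑ ^ 2 ≤ ENNReal.ofReal (gradConst n R * (N + S) ^ 2) := by
  refine (h.grad.lintegral_sq_closedBall_le h.memLp_scalar.integrable_sq h.pos hS
    (integral_sq_le_of_lintegral_le h.memLp_scalar (sq_nonneg _) h.scalar_le) h.osc hR).trans ?_
  rw [volume_closedBall_eq _ (by linarith), ← ENNReal.ofReal_mul (by positivity), gradConst]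
  refine ENNReal.ofReal_le_ofReal (le_of_eq (by ring))

lemma memLp_grad (h : RegularAt S N θ u G) (hS : 0 ≤ S) (R : ℝ) :
    MemLp G 2 (volume.restrict (closedBall 0 R)) := by
  have h1 : MemLp G 2 (volume.restrict (closedBall 0 (max R 1))) := by
    refine ⟨h.grad.2.1.aestronglyMeasurable.restrict, ?_⟩
    have h2 := (h.lintegral_sq_grad_le hS (le_max_right R 1)).trans_lt ENNReal.ofReal_lt_top
    rw [← eLpNorm_two_sq] at h2
    by_contra hcon
    rw [not_lt, top_le_iff] at hcon
    simp [hcon] at h2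
  exact h1.mono_measure (Measure.restrict_mono_set _ (closedBall_subset_closedBall (le_max_left _ _)))

/-- The bound is linear in `N`, so `G · u` is locally integrable in space and time when `N` is only
integrable in time. -/
lemma lintegral_inner_le (h : RegularAt S N θ u G) (hS : 0 ≤ S) {R : ℝ} (hR : 1 ≤ R) :
    ∫⁻ x in closedBall 0 R, ‖inner ℝ (G x) (u x)‖ₑ ≤
      ENNReal.ofReal (Real.sqrt (gradConst n R) * S * (N + S)) := by
  have hN := h.pos
  have hg := gradConst_nonneg n (by linarith : 0 ≤ R)
  calc _ ≤ ∫⁻ x in closedBall 0 R, ‖G x‖ₑ * ‖u x‖ₑ := by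
        refine lintegral_mono fun x => ?_
        rw [← ofReal_norm, ← ofReal_norm, ← ofReal_norm, ← ENNReal.ofReal_mul (norm_nonneg _)]
        exact ENNReal.ofReal_le_ofReal (norm_inner_le_norm _ _)
    _ ≤ (∫⁻ x in closedBall 0 R, ‖G x‖ₑ ^ 2) ^ (1 / 2 : ℝ) *
          (∫⁻ x in closedBall 0 R, ‖u x‖ₑ ^ 2) ^ (1 / 2 : ℝ) :=
        lintegral_mul_le_sqrt h.grad.2.1.aestronglyMeasurable.restrict.enorm
          h.memLp_drift.1.restrict.enorm
    _ ≤ (ENNReal.ofReal (gradConst n R * (N + S) ^ 2)) ^ (1 / 2 : ℝ) *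
          (ENNReal.ofReal (S ^ 2)) ^ (1 / 2 : ℝ) := by
        gcongr
        · exact h.lintegral_sq_grad_le hS hR
        · exact (setLIntegral_le_lintegral _ _).trans h.drift_le
    _ = _ := by
        rw [ENNReal.ofReal_rpow_of_nonneg (by positivity) (by norm_num),
          ENNReal.ofReal_rpow_of_nonneg (by positivity) (by norm_num), ← ENNReal.ofReal_mul
          (by positivity), ← Real.sqrt_eq_rpow, ← Real.sqrt_eq_rpow, Real.sqrt_mul hg,
          Real.sqrt_sq (by positivity), Real.sqrt_sq hS]
        congr 1; ring

lemma integrableOn_inner (h : RegularAt S N θ u G) (hS : 0 ≤ S) {R : ℝ} (hR : 1 ≤ R) :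
    IntegrableOn (fun x => inner ℝ (G x) (u x)) (closedBall 0 R) volume :=
  ⟨h.grad.2.1.aestronglyMeasurable.restrict.inner h.memLp_drift.1.restrict,
    (h.lintegral_inner_le hS hR).trans_lt ENNReal.ofReal_lt_top⟩

/-- The chain rule with `β = id`: it converts the weak transport term into the function `G · u`. -/
lemma integral_mul_fderiv (h : RegularAt S N θ u G) (hS : 0 ≤ S) {ψ : E n → ℝ}
    (hψ : ContDiff ℝ ∞ ψ) (hc : HasCompactSupport ψ) :
    ∫ x, θ x * fderiv ℝ ψ x (u x) = -∫ x, ψ x * inner ℝ (G x) (u x) := by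
  have h1 := h.div_free.integral_mul_deriv_comp h.memLp_drift h.grad h.memLp_scalar
    (h.memLp_grad hS) (β := id) contDiff_id (K := 1) (by simp) hψ hc
  simp only [deriv_id', id, one_mul] at h1
  linarith

end RegularAt

lemma BallOsc.mono {n : ℕ} {F : Type*} [NormedAddCommGroup F] {f : E n → F} {N N' : ℝ}
    (h : BallOsc f N) (hN : N ≤ N') : BallOsc f N' := fun x r hr => (h x r hr).trans (by gcongr)

lemma BallOsc.sub {n : ℕ} {F : Type*} [NormedAddCommGroup F] {f f' : E n → F} {N N' : ℝ}
    (h : BallOsc f N) (h' : BallOsc f' N') (hN : 0 ≤ N) (hN' : 0 ≤ N')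
    (hf : AEStronglyMeasurable f volume) :
    BallOsc (fun x => f x - f' x) (N + N') := fun x r hr => by
  have a1 : ∀ y, AEMeasurable (fun z => ‖f y - f z‖ₑ) (volume.restrict (closedBall x r)) :=
    fun y => (aestronglyMeasurable_const.sub hf).enorm.restrict
  have a2 : AEMeasurable (fun y => ∫⁻ z in closedBall x r, ‖f y - f z‖ₑ)
      (volume.restrict (closedBall x r)) := by
    refine AEMeasurable.lintegral_prod_right' (f := fun q : E n × E n => ‖f q.1 - f q.2‖ₑ) ?_
    exact (hf.restrict.comp_fst.sub hf.restrict.comp_snd).enorm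
  rw [ENNReal.ofReal_add hN hN', add_mul]
  refine le_trans ?_ (add_le_add (h x r hr) (h' x r hr))
  rw [← lintegral_add_left' a2]
  refine lintegral_mono fun y => ?_
  rw [← lintegral_add_left' (a1 y)]
  refine lintegral_mono fun z => ?_
  rw [show f y - f' y - (f z - f' z) = (f y - f z) - (f' y - f' z) by abel]
  exact enorm_sub_le

/-- The properties of a weak solution in the uniqueness class, with gradient `G`. -/
structure IsRegular {n : ℕ} (T S : ℝ) (N : ℝ → ℝ) (θ : ℝ → E n → ℝ) (u G : ℝ → E n → E n) :
    Prop where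
  nonneg : 0 ≤ S
  integrableOn : IntegrableOn N (Ioo 0 T)
  meas_scalar : AEStronglyMeasurable (Function.uncurry θ) ((volume.restrict (Ioo 0 T)).prod volume)
  meas_drift : AEStronglyMeasurable (Function.uncurry u) ((volume.restrict (Ioo 0 T)).prod volume)
  meas_grad : AEStronglyMeasurable (Function.uncurry G) ((volume.restrict (Ioo 0 T)).prod volume)
  ae_regular : ∀ᵐ t ∂(volume.restrict (Ioo 0 T)), RegularAt S (N t) (θ t) (u t) (G t)

lemma MemL2Loc.aestronglyMeasurable {n : ℕ} {F : Type*} [NormedAddCommGroup F] {T : ℝ}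
    {f : ℝ → E n → F} (h : MemL2Loc T f) :
    AEStronglyMeasurable (Function.uncurry f) ((volume.restrict (Ioo 0 T)).prod volume) := by
  have h1 : ∀ k : ℕ, AEStronglyMeasurable (Function.uncurry f)
      (((volume.restrict (Ioo 0 T)).prod volume).restrict
        (univ ×ˢ closedBall (0 : E n) (k : ℝ))) := fun k => by
    have := (h _ (isCompact_closedBall (0 : E n) (k : ℝ))).1
    rwa [← Measure.prod_restrict, Measure.restrict_univ]
  have h2 := (aestronglyMeasurable_iUnion_iff (μ := (volume.restrict (Ioo 0 T)).prod volume)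
    (s := fun k : ℕ => univ ×ˢ closedBall (0 : E n) (k : ℝ))).2 h1
  rwa [← prod_iUnion, iUnion_closedBall_nat, univ_prod_univ, Measure.restrict_univ] at h2

/-- Collects what the class provides at almost every time: an `L²` bound `S` independent of time and
an integrable oscillation bound for the gradient. -/
lemma IsWeakSolution.exists_isRegular {n : ℕ} (hn : 1 ≤ n) {m : E n → EuclideanSpace ℂ (Fin n)}
    (hm : IsOrderZeroSymbol m) {T : ℝ} {p q s : ℝ≥0∞} (hs : 1 ≤ s) {θ₀ : E n → ℝ}
    {θ : ℝ → E n → ℝ} {u : ℝ → E n → E n} (h : IsWeakSolution m T θ₀ θ u)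
    (hc : InUniquenessClass T p q s θ) : ∃ S N G, IsRegular T S N θ u G := by
  obtain ⟨⟨-, hbd⟩, -, g, b, hgrad, hg, hb, -⟩ := hc
  obtain ⟨N, hNm, hNi, hN⟩ := exists_lintegral_lt_top_oscInt_le hs hg hb
  obtain ⟨C, hC⟩ := hm.exists_bound
  have hC0 : 0 ≤ C := (norm_nonneg _).trans (hC (EuclideanSpace.single ⟨0, hn⟩ 1) (by simp))
  set A := eLpNorm (fun t => eLpNorm (θ t) 2 volume) ⊤ (volume.restrict (Ioo 0 T)) with hA
  have hA1 : ∀ᵐ t ∂(volume.restrict (Ioo 0 T)), eLpNorm (θ t) 2 volume ≤ A := by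
    rw [hA, eLpNorm_exponent_top]
    simpa only [enorm_eq_self] using
      enorm_ae_le_eLpNormEssSup (fun t => eLpNorm (θ t) 2 volume) (volume.restrict (Ioo 0 T))
  have hA0 : 0 ≤ A.toReal := ENNReal.toReal_nonneg
  -- One constant for both: it dominates the scalar bound `A`, and the drift bound because `n * C ^
  -- 2 ≤ (1 + n * C) ^ 2`.
  set S := (1 + n * C) * A.toReal with hS
  -- Adding `1` makes the oscillation bound strictly positive, as the scaling by `N` requires.
  refine ⟨S, fun t => (N t).toReal + 1, fun t x => g t x + b t x, by positivity,
    (integrable_toReal_of_lintegral_ne_top hNm hNi.ne).add (integrable_const 1),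
    h.memL2Loc_scalar.aestronglyMeasurable, h.memL2Loc_drift.aestronglyMeasurable,
    hg.1.add hb.1, ?_⟩
  filter_upwards [hgrad, hN, hA1, h.drift_eq, h.div_free, ae_lt_top' hNm hNi.ne] with t h1 h2 h3 h4 h5 h6
  have hsc : ∫⁻ x, ‖θ t x‖ₑ ^ 2 ≤ ENNReal.ofReal (A.toReal ^ 2) := by
    rw [← eLpNorm_two_sq, ENNReal.ofReal_pow hA0, ENNReal.ofReal_toReal hbd.ne]
    gcongr
  have hθ : MemLp (θ t) 2 volume := MemLp.of_ofReal h4.choose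
  have hn1 : (1 : ℝ) ≤ n := by exact_mod_cast hn
  have hu : ∫⁻ x, ‖u t x‖ₑ ^ 2 ≤ ENNReal.ofReal (S ^ 2) := by
    refine (h4.lintegral_le hC hn).trans ((mul_le_mul' le_rfl hsc).trans ?_)
    rw [← ENNReal.ofReal_mul (by positivity), hS, mul_pow]
    refine ENNReal.ofReal_le_ofReal ?_
    gcongr
    nlinarith [mul_nonneg (by linarith : (0:ℝ) ≤ n) hC0, sq_nonneg C]
  refine ⟨h1, fun x r hr => (h2 x r hr).trans ?_, by positivity, hθ, hsc.trans ?_, ?_, hu, h5⟩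
  · gcongr
    rw [← ENNReal.ofReal_toReal h6.ne]
    exact ENNReal.ofReal_le_ofReal (by simp)
  · refine ENNReal.ofReal_le_ofReal (pow_le_pow_left₀ hA0 ?_ 2)
    rw [hS]; nlinarith [mul_nonneg (by linarith : (0:ℝ) ≤ n) hC0]
  · refine ⟨h5.1.aestronglyMeasurable, ?_⟩
    have h7 := hu.trans_lt ENNReal.ofReal_lt_top
    rw [← eLpNorm_two_sq] at h7
    by_contra hcon
    rw [not_lt, top_le_iff] at hcon
    simp [hcon] at h7

lemma RegularAt.integrable_mul_fderiv {n : ℕ} {S N : ℝ} {θ : E n → ℝ} {u G : E n → E n}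
    (h : RegularAt S N θ u G) {ψ : E n → ℝ} (hψ : ContDiff ℝ ∞ ψ) (hc : HasCompactSupport ψ) :
    Integrable (fun x => θ x * fderiv ℝ ψ x (u x)) volume := by
  have hfc : Continuous (fderiv ℝ ψ) := hψ.continuous_fderiv (by simp)
  obtain ⟨C, hC⟩ := (hc.fderiv (𝕜 := ℝ)).exists_bound_of_continuous hfc
  have h1 : Integrable (fun x => ‖θ x‖ * ‖u x‖) volume :=
    h.memLp_scalar.norm.integrable_mul h.memLp_drift.norm
  refine (h1.const_mul C).mono' (h.memLp_scalar.1.mul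
    (aestronglyMeasurable_clm_apply hfc.aestronglyMeasurable h.memLp_drift.1))
    (Eventually.of_forall fun x => ?_)
  rw [norm_mul]
  calc _ ≤ ‖θ x‖ * (C * ‖u x‖) := by
        gcongr; exact ((fderiv ℝ ψ x).le_opNorm _).trans (by gcongr; exact hC x)
    _ = _ := by ring

lemma fderiv_tensor {n : ℕ} {A : ℝ → ℝ} {ψ : E n → ℝ} (hA : ContDiff ℝ ∞ A)
    (hψ : ContDiff ℝ ∞ ψ) (t τ : ℝ) (x v : E n) :
    fderiv ℝ (fun p : ℝ × E n => A p.1 * ψ p.2) (t, x) (τ, v) =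
      τ * deriv A t * ψ x + A t * fderiv ℝ ψ x v := by
  have h1 : HasFDerivAt (fun p : ℝ × E n => A p.1)
      (deriv A t • ContinuousLinearMap.fst ℝ ℝ (E n)) (t, x) :=
    HasDerivAt.comp_hasFDerivAt (h₂ := A) (t, x) (hA.differentiable (by simp) t).hasDerivAt
      hasFDerivAt_fst
  have h2 : HasFDerivAt (fun p : ℝ × E n => ψ p.2)
      ((fderiv ℝ ψ x).comp (ContinuousLinearMap.snd ℝ ℝ (E n))) (t, x) :=
    HasFDerivAt.comp (g := ψ) (t, x) (hψ.differentiable (by simp) x).hasFDerivAt hasFDerivAt_snd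
  have h3 := h1.mul h2
  have h4 : fderiv ℝ (fun p : ℝ × E n => A p.1 * ψ p.2) (t, x) = _ := h3.fderiv
  rw [h4]
  simp
  ring

/-- Product test functions reduce the equation to a scalar equation in time for each `ψ`. -/
lemma IsWeakSolution.integral_tensor {n : ℕ} {m : E n → EuclideanSpace ℂ (Fin n)} {T S : ℝ}
    {N : ℝ → ℝ} {θ₀ : E n → ℝ} {θ : ℝ → E n → ℝ} {u G : ℝ → E n → E n}
    (h : IsWeakSolution m T θ₀ θ u) (hr : IsRegular T S N θ u G) {A : ℝ → ℝ} {ψ : E n → ℝ}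
    (hA : ContDiff ℝ ∞ A) (hAc : HasCompactSupport A) (hAT : tsupport A ⊆ Iio T)
    (hψ : ContDiff ℝ ∞ ψ) (hψc : HasCompactSupport ψ) :
    (∫ t in Ioo 0 T, ((∫ x, ψ x * θ t x) * deriv A t -
      (∫ x, ψ x * inner ℝ (G t x) (u t x)) * A t)) + ∫ x, θ₀ x * (A 0 * ψ x) = 0 := by
  have hsub : tsupport (fun p : ℝ × E n => A p.1 * ψ p.2) ⊆ tsupport A ×ˢ tsupport ψ := by
    refine closure_minimal (fun p hp => ?_) ((isClosed_tsupport A).prod (isClosed_tsupport ψ))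
    exact ⟨subset_tsupport _ (left_ne_zero_of_mul hp), subset_tsupport _ (right_ne_zero_of_mul hp)⟩
  have h1 := h.weak_eq (fun p => A p.1 * ψ p.2)
    ((hA.comp (contDiff_fst (𝕜 := ℝ) (E := ℝ) (F := E n))).mul (hψ.comp (contDiff_snd (𝕜 := ℝ) (E := ℝ) (F := E n))))
    ((hAc.isCompact.prod hψc.isCompact).of_isClosed_subset (isClosed_tsupport _) hsub)
    (hsub.trans (prod_mono hAT (subset_univ _)))
  refine Eq.trans ?_ h1
  refine congrArg (· + ∫ x, θ₀ x * (A 0 * ψ x)) (integral_congr_ae ?_)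
  filter_upwards [hr.ae_regular] with t ht
  have i1 : Integrable (fun x => ψ x * θ t x) volume :=
    continuous_integrable_mul ht.grad.1 hψ.continuous hψc
  have i2 := ht.integrable_mul_fderiv hψ hψc
  simp only [fderiv_tensor hA hψ, one_mul, map_zero, mul_zero, add_zero, zero_mul, zero_add]
  have e1 : ∀ x, θ t x * (deriv A t * ψ x + A t * fderiv ℝ ψ x (u t x)) =
      ψ x * θ t x * deriv A t + θ t x * fderiv ℝ ψ x (u t x) * A t := fun x => by ring
  simp_rw [e1]
  rw [integral_add (i1.mul_const _) (i2.mul_const _), integral_mul_const, integral_mul_const,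
    ht.integral_mul_fderiv hr.nonneg hψ hψc]
  ring

/-! ### From the distributional equation to primitives along lines in time. -/

/-- Integrability on `(0,T) × B` for all balls `B`. -/
def LocInt {n : ℕ} (T : ℝ) (w : ℝ → E n → ℝ) : Prop :=
  ∀ R : ℝ, 1 ≤ R → Integrable (Function.uncurry w)
    ((volume.restrict (Ioo 0 T)).prod (volume.restrict (closedBall 0 R)))

namespace LocInt
variable {n : ℕ} {T : ℝ} {w w' : ℝ → E n → ℝ}

lemma sub (h : LocInt T w) (h' : LocInt T w') : LocInt T (fun t x => w t x - w' t x) :=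
  fun R hR => (h R hR).sub (h' R hR)

lemma aestronglyMeasurable (h : LocInt T w) :
    AEStronglyMeasurable (Function.uncurry w) ((volume.restrict (Ioo 0 T)).prod volume) := by
  have h1 : ∀ k : ℕ, AEStronglyMeasurable (Function.uncurry w)
      (((volume.restrict (Ioo 0 T)).prod volume).restrict
        (univ ×ˢ closedBall (0 : E n) (k : ℝ))) := fun k => by
    have h2 := (h (max k 1) (le_max_right _ _)).1
    have := h2.mono_measure (Measure.prod_mono le_rfl (Measure.restrict_mono_set volume
      (closedBall_subset_closedBall (le_max_left (k : ℝ) 1))))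
    rwa [← Measure.prod_restrict, Measure.restrict_univ]
  have h2 := (aestronglyMeasurable_iUnion_iff (μ := (volume.restrict (Ioo 0 T)).prod volume)
    (s := fun k : ℕ => univ ×ˢ closedBall (0 : E n) (k : ℝ))).2 h1
  rwa [← prod_iUnion, iUnion_closedBall_nat, univ_prod_univ, Measure.restrict_univ] at h2

lemma integrable_mul (h : LocInt T w) {ψ : E n → ℝ} (hψ : Continuous ψ) (hc : HasCompactSupport ψ) :
    Integrable (fun p : ℝ × E n => ψ p.2 * w p.1 p.2)
      ((volume.restrict (Ioo 0 T)).prod volume) := by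
  obtain ⟨R, hR⟩ := hc.isCompact.isBounded.subset_closedBall (0 : E n)
  obtain ⟨C, hC⟩ := hc.exists_bound_of_continuous hψ
  have h1 := h (max R 1) (le_max_right _ _)
  have h2 : IntegrableOn (fun p : ℝ × E n => ψ p.2 * w p.1 p.2)
      (univ ×ˢ closedBall 0 (max R 1)) ((volume.restrict (Ioo 0 T)).prod volume) := by
    rw [IntegrableOn, ← Measure.prod_restrict, Measure.restrict_univ]
    exact Integrable.bdd_mul h1 (hψ.comp continuous_snd).aestronglyMeasurable
      (Eventually.of_forall fun p => hC p.2)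
  rwa [integrableOn_iff_integrable_of_support_subset] at h2
  intro p hp
  refine ⟨mem_univ _, closedBall_subset_closedBall (le_max_left _ _) (hR ?_)⟩
  exact subset_tsupport _ (left_ne_zero_of_mul hp)

lemma integrable_mul_Ioc (h : LocInt T w) {ψ : E n → ℝ} (hψ : Continuous ψ)
    (hc : HasCompactSupport ψ) {t : ℝ} (ht : t < T) :
    Integrable (fun p : ℝ × E n => ψ p.2 * w p.1 p.2)
      ((volume.restrict (Ioc 0 t)).prod volume) :=
  (h.integrable_mul hψ hc).mono_measure (Measure.prod_mono (Measure.restrict_mono_set _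
    fun _ hv => ⟨hv.1, hv.2.trans_lt ht⟩) le_rfl)

lemma locallyIntegrable_integral (h : LocInt T w) {t : ℝ} (ht : t ∈ Ioo 0 T) :
    LocallyIntegrable (fun x => ∫ v in 0..t, w v x) volume := by
  rw [locallyIntegrable_iff]
  intro K hK
  obtain ⟨R, hR⟩ := hK.isBounded.subset_closedBall (0 : E n)
  have h1 := (h (max R 1) (le_max_right _ _)).mono_measure (Measure.prod_mono
    (Measure.restrict_mono_set volume (s := Ioc 0 t) (t := Ioo 0 T)
      fun _ hv => ⟨hv.1, hv.2.trans_lt ht.2⟩) le_rfl)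
  have h2 := h1.integral_prod_right
  simp_rw [intervalIntegral.integral_of_le ht.1.le]
  exact IntegrableOn.mono_set h2 (hR.trans (closedBall_subset_closedBall (le_max_left _ _)))

end LocInt

/-- A distributional solution of `∂_t θ + H = 0` with vanishing initial datum is the primitive
of `-H`. -/
lemma LocInt.ae_eq_neg_integral {n : ℕ} {T : ℝ} (hT : 0 < T) {θ H : ℝ → E n → ℝ}
    (hθ : LocInt T θ) (hH : LocInt T H)
    (hθl : ∀ᵐ t ∂(volume.restrict (Ioo 0 T)), LocallyIntegrable (θ t) volume)
    (hw : ∀ (A : ℝ → ℝ) (ψ : E n → ℝ), ContDiff ℝ ∞ A → HasCompactSupport A → tsupport A ⊆ Iio T →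
      ContDiff ℝ ∞ ψ → HasCompactSupport ψ →
      ∫ t in Ioo 0 T, ((∫ x, ψ x * θ t x) * deriv A t - (∫ x, ψ x * H t x) * A t) = 0) :
    ∀ᵐ t ∂(volume.restrict (Ioo 0 T)), ∀ᵐ x, θ t x = -∫ v in 0..t, H v x := by
  have h1 : ∀ k j : ℕ, ∀ᵐ t ∂(volume.restrict (Ioo 0 T)),
      ∫ x, bump (TopologicalSpace.denseSeq (E n) k) (1 / ((j : ℝ) + 1)) x * θ t x =
        -∫ v in 0..t, ∫ x, bump (TopologicalSpace.denseSeq (E n) k) (1 / ((j : ℝ) + 1)) x * H v x :=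
    fun k j => by
      have hb := bump_contDiff (TopologicalSpace.denseSeq (E n) k) (1 / ((j : ℝ) + 1))
      have hbc := bump_hasCompactSupport (TopologicalSpace.denseSeq (E n) k)
        (δ := 1 / ((j : ℝ) + 1)) (by positivity)
      exact ae_eq_neg_primitive hT (hθ.integrable_mul hb.continuous hbc).integral_prod_left
        (hH.integrable_mul hb.continuous hbc).integral_prod_left
        fun A hA hAc hAT => hw A _ hA hAc hAT hb hbc
  -- Only countably many bumps are used, so one null set of times serves them all.
  have h2 := ae_all_iff.2 fun k => ae_all_iff.2 fun j => h1 k j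
  filter_upwards [h2, hθl, ae_restrict_mem measurableSet_Ioo] with t ht htl htm
  have hl := hH.locallyIntegrable_integral htm
  have h3 := ae_eq_zero_of_integral_bump (htl.add hl) fun k j => by
    set b := bump (TopologicalSpace.denseSeq (E n) k) (1 / ((j : ℝ) + 1)) with hbdef
    have hb : Continuous b := (bump_contDiff _ _).continuous
    have hbc : HasCompactSupport b := bump_hasCompactSupport _ (by positivity)
    have i1 : Integrable (fun x => b x * θ t x) volume := continuous_integrable_mul htl hb hbc
    have i2 : Integrable (fun x => b x * ∫ v in 0..t, H v x) volume :=
      continuous_integrable_mul hl hb hbc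
    have e : ∀ x, (θ t + fun x => ∫ v in 0..t, H v x) x * b x =
        b x * θ t x + b x * ∫ v in 0..t, H v x := fun x => by simp only [Pi.add_apply]; ring
    simp_rw [e]
    rw [integral_add i1 i2, ht k j, intervalIntegral.integral_of_le htm.1.le,
      integral_integral_swap (hH.integrable_mul_Ioc hb hbc htm.2)]
    simp_rw [intervalIntegral.integral_of_le htm.1.le, integral_const_mul]
    exact neg_add_cancel _
  filter_upwards [h3] with x hx
  simp only [Pi.add_apply, Pi.zero_apply] at hx
  linarith

lemma ae_ae_swap {α β : Type*} [MeasurableSpace α] [MeasurableSpace β] {μ : Measure α}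
    {ν : Measure β} [SFinite μ] [SFinite ν] {p : α × β → Prop} (h : ∀ᵐ z ∂μ.prod ν, p z) :
    ∀ᵐ y ∂ν, ∀ᵐ x ∂μ, p (x, y) :=
  Measure.ae_ae_of_ae_prod (p := fun z : β × α => p z.swap)
    ((Measure.measurePreserving_swap (μ := ν) (ν := μ)).quasiMeasurePreserving.ae h)

lemma LocInt.ae_integrableOn {n : ℕ} {T : ℝ} {w : ℝ → E n → ℝ} (h : LocInt T w) :
    ∀ᵐ x : E n, IntegrableOn (fun t => w t x) (Ioo 0 T) := by
  have h1 : ∀ k : ℕ, ∀ᵐ x : E n, x ∈ closedBall (0 : E n) (max k 1) →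
      IntegrableOn (fun t => w t x) (Ioo 0 T) := fun k =>
    (ae_restrict_iff' measurableSet_closedBall).1 (h (max k 1) (le_max_right _ _)).prod_left_ae
  filter_upwards [ae_all_iff.2 h1] with x hx
  obtain ⟨k, hk⟩ := exists_nat_ge ‖x‖
  exact hx k (by simpa using Or.inl hk)

/-- The primitive in time is jointly measurable and the equation holds along almost every line. -/
lemma LocInt.ae_ae_eq_neg_integral {n : ℕ} {T : ℝ} {θ H : ℝ → E n → ℝ} (hθ : LocInt T θ)
    (hH : LocInt T H)
    (heq : ∀ᵐ t ∂(volume.restrict (Ioo 0 T)), ∀ᵐ x, θ t x = -∫ v in 0..t, H v x) :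
    ∀ᵐ x : E n, ∀ᵐ t ∂(volume.restrict (Ioo 0 T)), θ t x = -∫ v in 0..t, H v x := by
  have hm := hH.aestronglyMeasurable
  have hθm := hθ.aestronglyMeasurable
  set H' : ℝ × E n → ℝ := hm.mk _ with hH'
  have hs : StronglyMeasurable H' := hm.stronglyMeasurable_mk
  have e1 : ∀ᵐ x : E n, ∀ᵐ v ∂(volume.restrict (Ioo 0 T)), H v x = H' (v, x) :=
    ae_ae_swap hm.ae_eq_mk
  have e2 : ∀ᵐ x : E n, ∀ t ∈ Ioo 0 T, ∫ v in 0..t, H v x =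
      ∫ v, (Ioc 0 t).indicator (fun v => H' (v, x)) v := by
    filter_upwards [e1] with x hx t ht
    rw [intervalIntegral.integral_of_le ht.1.le, integral_indicator measurableSet_Ioc]
    have hsub : Ioc 0 t ⊆ Ioo 0 T := fun v hv => ⟨hv.1, hv.2.trans_lt ht.2⟩
    exact integral_congr_ae (ae_restrict_of_ae_restrict_of_subset hsub hx)
  have hΦ : StronglyMeasurable (fun q : ℝ × E n =>
      ∫ v, (Ioc 0 q.1).indicator (fun v => H' (v, q.2)) v) := by
    refine StronglyMeasurable.integral_prod_right'
      (f := fun r : (ℝ × E n) × ℝ => (Ioc 0 r.1.1).indicator (fun v => H' (v, r.1.2)) r.2) ?_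
    have a1 : StronglyMeasurable fun r : (ℝ × E n) × ℝ => H' (r.2, r.1.2) :=
      hs.comp_measurable (by fun_prop)
    have a2 : MeasurableSet {r : (ℝ × E n) × ℝ | 0 < r.2 ∧ r.2 ≤ r.1.1} :=
      (measurableSet_lt measurable_const measurable_snd).inter
        (measurableSet_le measurable_snd (by fun_prop))
    exact a1.indicator a2
  set θ' : ℝ × E n → ℝ := hθm.mk _ with hθ'
  have hθs : StronglyMeasurable θ' := hθm.stronglyMeasurable_mk
  -- Exchanging "almost every `t`" with "almost every `x`" needs a measurable set, whence the
  -- strongly measurable representatives.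
  have key : ∀ᵐ z ∂((volume.restrict (Ioo 0 T)).prod (volume : Measure (E n))),
      θ' z = -∫ v, (Ioc 0 z.1).indicator (fun v => H' (v, z.2)) v := by
    refine (Measure.ae_prod_iff_ae_ae (p := fun z : ℝ × E n => θ' z =
      -∫ v, (Ioc 0 z.1).indicator (fun v => H' (v, z.2)) v)
      (measurableSet_eq_fun hθs.measurable hΦ.measurable.neg)).2 ?_
    filter_upwards [heq, Measure.ae_ae_of_ae_prod hθm.ae_eq_mk, ae_restrict_mem measurableSet_Ioo]
      with t h1 h2 h3
    filter_upwards [h1, h2, e2] with x h4 h5 h6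
    rw [← h6 t h3, ← h4]
    exact h5.symm
  filter_upwards [ae_ae_swap key, ae_ae_swap hθm.ae_eq_mk, e2] with x h1 h2 h3
  filter_upwards [h1, h2, ae_restrict_mem measurableSet_Ioo] with t h4 h5 h6
  rw [h3 t h6, ← h4]
  exact h5

/-- The chain rule for `∂_t θ + H = 0`, integrated against a cutoff. -/
lemma LocInt.integral_comp {n : ℕ} {T : ℝ} {θ H : ℝ → E n → ℝ} (hθ : LocInt T θ)
    (hH : LocInt T H)
    (heq : ∀ᵐ t ∂(volume.restrict (Ioo 0 T)), ∀ᵐ x, θ t x = -∫ v in 0..t, H v x)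
    {β : ℝ → ℝ} (hβ : ContDiff ℝ ∞ β) (hβ0 : β 0 = 0) {K : ℝ} (hK : ∀ s, |deriv β s| ≤ K)
    {ψ : E n → ℝ} (hψ : Continuous ψ) (hc : HasCompactSupport ψ) :
    ∀ᵐ t ∂(volume.restrict (Ioo 0 T)), ∫ x, ψ x * β (θ t x) =
      -∫ v in Ioc 0 t, ∫ x, ψ x * (deriv β (θ v x) * H v x) := by
  have hβc : Continuous (deriv β) := hβ.continuous_deriv (by simp)
  have hline := hθ.ae_ae_eq_neg_integral hH heq
  filter_upwards [heq, ae_restrict_mem measurableSet_Ioo] with t ht htm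
  have hsub : Ioc 0 t ⊆ Ioo 0 T := fun v hv => ⟨hv.1, hv.2.trans_lt htm.2⟩
  have h1 : ∀ᵐ x : E n, β (θ t x) = -∫ v in Ioc 0 t, deriv β (θ v x) * H v x := by
    filter_upwards [hline, ht, hH.ae_integrableOn] with x hx htx hi
    have hi' : IntervalIntegrable (fun v => H v x) volume 0 t :=
      (intervalIntegrable_iff_integrableOn_Ioc_of_le htm.1.le).2 (hi.mono_set hsub)
    -- Reflecting `β` accounts for the sign in `θ = -∫ H`.
    have h2 := integral_deriv_comp_primitive hi' (β := fun s => β (-s))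
      (β' := fun s => -deriv β (-s)) (fun s => by
        have := (hβ.differentiable (by simp) (-s)).hasDerivAt.comp s (hasDerivAt_neg s)
        simpa [Function.comp_def] using this) (by fun_prop)
    rw [← htx, neg_zero, hβ0, sub_zero, intervalIntegral.integral_of_le htm.1.le] at h2
    rw [← h2, ← integral_neg]
    refine integral_congr_ae ?_
    filter_upwards [ae_restrict_of_ae_restrict_of_subset hsub hx] with v hv
    simp only [← hv]; ring
  have hθm : AEStronglyMeasurable (Function.uncurry θ) ((volume.restrict (Ioc 0 t)).prod volume) :=
    hθ.aestronglyMeasurable.mono_measure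
      (Measure.prod_mono (Measure.restrict_mono_set _ hsub) le_rfl)
  have h2 : Integrable (fun p : ℝ × E n => ψ p.2 * (deriv β (θ p.1 p.2) * H p.1 p.2))
      ((volume.restrict (Ioc 0 t)).prod volume) := by
    have h3 := Integrable.bdd_mul (hH.integrable_mul_Ioc hψ hc htm.2)
      (hβc.comp_aestronglyMeasurable hθm) (c := K) (Eventually.of_forall fun p => hK _)
    refine h3.congr (Eventually.of_forall fun p => ?_)
    simp only [Function.uncurry]; ring
  rw [integral_integral_swap h2, ← integral_neg]
  refine integral_congr_ae ?_
  filter_upwards [h1] with x hx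
  simp only [integral_const_mul]
  rw [hx]; ring

/-! ### Logarithmic truncation of the square and cutoffs -/

/-- A smooth approximation of `s ↦ s² / 2` with bounded derivative. -/
def logTrunc (k s : ℝ) : ℝ := k ^ 2 / 2 * Real.log (1 + s ^ 2 / k ^ 2)

lemma logTrunc_contDiff {k : ℝ} : ContDiff ℝ ∞ (logTrunc k) := by
  unfold logTrunc
  refine contDiff_const.mul (ContDiff.log (by fun_prop) fun s => ?_)
  positivity

lemma logTrunc_zero (k : ℝ) : logTrunc k 0 = 0 := by simp [logTrunc]

lemma logTrunc_nonneg (k s : ℝ) : 0 ≤ logTrunc k s :=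
  mul_nonneg (by positivity) (Real.log_nonneg (by
    have : 0 ≤ s ^ 2 / k ^ 2 := by positivity
    linarith))

lemma deriv_logTrunc {k : ℝ} (hk : 0 < k) (s : ℝ) :
    deriv (logTrunc k) s = s / (1 + s ^ 2 / k ^ 2) := by
  have h0 : (1 + s ^ 2 / k ^ 2) ≠ 0 := by positivity
  have h1 : HasDerivAt (fun s : ℝ => 1 + s ^ 2 / k ^ 2) (2 * s / k ^ 2) s := by
    have := ((hasDerivAt_pow 2 s).div_const (k ^ 2)).const_add 1
    simpa using this
  have h2 := (h1.log h0).const_mul (k ^ 2 / 2)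
  have h3 : deriv (logTrunc k) s = _ := h2.deriv
  rw [h3]
  field_simp

lemma abs_deriv_logTrunc_le_abs {k : ℝ} (hk : 0 < k) (s : ℝ) :
    |deriv (logTrunc k) s| ≤ |s| := by
  have h1 : 0 ≤ s ^ 2 / k ^ 2 := by positivity
  rw [deriv_logTrunc hk, abs_div, abs_of_pos (by positivity : 0 < 1 + s ^ 2 / k ^ 2)]
  exact div_le_self (abs_nonneg s) (by linarith)

lemma abs_deriv_logTrunc_le {k : ℝ} (hk : 0 < k) (s : ℝ) : |deriv (logTrunc k) s| ≤ k := by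
  rw [deriv_logTrunc hk, abs_div, abs_of_pos (by positivity : 0 < 1 + s ^ 2 / k ^ 2),
    div_le_iff₀ (by positivity), mul_add, mul_one, mul_div_assoc', ← sq_abs s,
    show k * |s| ^ 2 / k ^ 2 = |s| ^ 2 / k by field_simp]
  have h : (k - |s|) ^ 2 / k = k + |s| ^ 2 / k - 2 * |s| := by field_simp; ring
  have h1 : 0 ≤ (k - |s|) ^ 2 / k := by positivity
  linarith [abs_nonneg s]

lemma abs_logTrunc_le {k : ℝ} (hk : 0 < k) (s : ℝ) : |logTrunc k s| ≤ k * |s| := by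
  have := Convex.norm_image_sub_le_of_norm_deriv_le (f := logTrunc k) (C := k) (s := univ)
      (fun x _ => (logTrunc_contDiff.differentiable (by simp)) x)
      (fun x _ => abs_deriv_logTrunc_le hk x) convex_univ (mem_univ 0) (mem_univ s)
  simpa [logTrunc_zero] using this

/-- From `log x ≥ 1 - 1/x`. The lower bound tends to `s ^ 2 / 2` as `k → ∞`, which is all that
Fatou's lemma needs. -/
lemma le_logTrunc {k : ℝ} (hk : 0 < k) (s : ℝ) :
    s ^ 2 / 2 * (1 + s ^ 2 / k ^ 2)⁻¹ ≤ logTrunc k s := by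
  have h1 := Real.one_sub_inv_le_log_of_pos (by positivity : 0 < 1 + s ^ 2 / k ^ 2)
  calc _ = k ^ 2 / 2 * (1 - (1 + s ^ 2 / k ^ 2)⁻¹) := by field_simp; ring
    _ ≤ _ := by unfold logTrunc; gcongr

lemma exists_cutoff (n : ℕ) : ∃ C : ℝ, 0 ≤ C ∧ ∀ R : ℝ, 0 < R → ∃ χ : E n → ℝ, ContDiff ℝ ∞ χ ∧
    HasCompactSupport χ ∧ (∀ x, 0 ≤ χ x) ∧ (∀ x, χ x ≤ 1) ∧ (∀ x, ‖x‖ ≤ R → χ x = 1) ∧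
    ∀ x, ‖fderiv ℝ χ x‖ ≤ C / R := by
  let f : ContDiffBump (0 : E n) := ⟨1, 2, one_pos, by norm_num⟩
  have hf : ContDiff ℝ ∞ f := f.contDiff
  obtain ⟨C, hC⟩ := (f.hasCompactSupport.fderiv (𝕜 := ℝ)).exists_bound_of_continuous
    (hf.continuous_fderiv (by simp))
  refine ⟨C, (norm_nonneg _).trans (hC 0), fun R hR => ⟨fun x => f (R⁻¹ • x), by fun_prop, ?_,
    fun x => f.nonneg, fun x => f.le_one, fun x hx => f.one_of_mem_closedBall ?_, fun x => ?_⟩⟩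
  · exact f.hasCompactSupport.comp_smul (inv_ne_zero hR.ne')
  · rw [mem_closedBall, dist_zero_right, norm_smul, norm_inv, Real.norm_eq_abs, abs_of_pos hR,
      inv_mul_le_iff₀ hR]
    show ‖x‖ ≤ R * 1
    rwa [mul_one]
  · have h1 : fderiv ℝ (fun x => f (R⁻¹ • x)) x = R⁻¹ • fderiv ℝ f (R⁻¹ • x) :=
      fderiv_comp_smul R⁻¹
    rw [h1, norm_smul, norm_inv, Real.norm_eq_abs, abs_of_pos hR, div_eq_inv_mul]
    gcongr
    exact hC _

/-! ### The energy estimate for the difference of two solutions -/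

lemma HasWeakGradient.sub {n : ℕ} {θ θ' : E n → ℝ} {G G' : E n → E n} (h : HasWeakGradient θ G)
    (h' : HasWeakGradient θ' G') :
    HasWeakGradient (fun x => θ x - θ' x) (fun x => G x - G' x) := by
  refine ⟨h.1.sub h'.1, h.2.1.sub h'.2.1, fun φ hφ hc i => ?_⟩
  have hc' : HasCompactSupport fun z => fderiv ℝ φ z (EuclideanSpace.single i 1) :=
    (hc.fderiv (𝕜 := ℝ)).comp_left (g := fun ℓ : E n →L[ℝ] ℝ => ℓ (EuclideanSpace.single i 1)) rfl
  have hcont : Continuous fun z => fderiv ℝ φ z (EuclideanSpace.single i 1) :=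
    (hφ.continuous_fderiv (by simp)).clm_apply continuous_const
  have a1 := continuous_integrable_mul h.1 hcont hc'
  have a2 := continuous_integrable_mul h'.1 hcont hc'
  have b1 := continuous_integrable_mul (LocallyIntegrable.coord h.2.1 i) hφ.continuous hc
  have b2 := continuous_integrable_mul (LocallyIntegrable.coord h'.2.1 i) hφ.continuous hc
  simp only [smul_eq_mul, mul_comm (fderiv ℝ φ _ _), mul_comm (φ _)] at a1 a2 b1 b2
  simp only [PiLp.sub_apply, sub_mul]
  rw [integral_sub a1 a2, integral_sub b1 b2, h.2.2 φ hφ hc i, h'.2.2 φ hφ hc i]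
  ring

lemma lintegral_enorm_sub_sq_le {α F : Type*} [MeasurableSpace α] [NormedAddCommGroup F]
    {μ : Measure α} {f g : α → F} (hf : AEStronglyMeasurable f μ) {S : ℝ}
    (h : ∫⁻ x, ‖f x‖ₑ ^ 2 ∂μ ≤ ENNReal.ofReal (S ^ 2))
    (h' : ∫⁻ x, ‖g x‖ₑ ^ 2 ∂μ ≤ ENNReal.ofReal (S ^ 2)) :
    ∫⁻ x, ‖f x - g x‖ₑ ^ 2 ∂μ ≤ ENNReal.ofReal ((2 * S) ^ 2) := by
  calc _ ≤ ∫⁻ x, (2 * ‖f x‖ₑ ^ 2 + 2 * ‖g x‖ₑ ^ 2) ∂μ := by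
        refine lintegral_mono fun x => ?_
        simp only [← ofReal_norm]
        rw [← ENNReal.ofReal_pow (norm_nonneg _), ← ENNReal.ofReal_pow (norm_nonneg _),
          ← ENNReal.ofReal_pow (norm_nonneg _), ← ENNReal.ofReal_ofNat,
          ← ENNReal.ofReal_mul (by norm_num), ← ENNReal.ofReal_mul (by norm_num),
          ← ENNReal.ofReal_add (by positivity) (by positivity)]
        refine ENNReal.ofReal_le_ofReal ?_
        nlinarith [norm_sub_le (f x) (g x), norm_nonneg (f x - g x), sq_nonneg (‖f x‖ - ‖g x‖),
          norm_nonneg (f x), norm_nonneg (g x)]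
    _ = 2 * (∫⁻ x, ‖f x‖ₑ ^ 2 ∂μ) + 2 * ∫⁻ x, ‖g x‖ₑ ^ 2 ∂μ := by
        rw [lintegral_add_left' ((hf.enorm.pow_const 2).const_mul 2), lintegral_const_mul' _ _
          (by simp), lintegral_const_mul' _ _ (by simp)]
    _ ≤ 2 * ENNReal.ofReal (S ^ 2) + 2 * ENNReal.ofReal (S ^ 2) := by gcongr
    _ = _ := by
        rw [← ENNReal.ofReal_ofNat, ← ENNReal.ofReal_mul (by norm_num),
          ← ENNReal.ofReal_add (by positivity) (by positivity)]
        congr 1; ring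

namespace RegularAt
variable {n : ℕ} {S N S' N' : ℝ} {θ θ' : E n → ℝ} {u G u' G' : E n → E n}

lemma mono (h : RegularAt S N θ u G) (hS : 0 ≤ S) (hSS : S ≤ S') (hN : N ≤ N') :
    RegularAt S' N' θ u G := by
  have h1 : ENNReal.ofReal (S ^ 2) ≤ ENNReal.ofReal (S' ^ 2) := by gcongr
  exact ⟨h.grad, h.osc.mono hN, h.pos.trans_le hN, h.memLp_scalar, h.scalar_le.trans h1,
    h.memLp_drift, h.drift_le.trans h1, h.div_free⟩

/-- The drift of the first solution is kept: `RegularAt` does not tie the drift to the scalar, and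
only `u` transports the difference in the estimate below. -/
lemma sub (h : RegularAt S N θ u G) (h' : RegularAt S N θ' u' G') :
    RegularAt (2 * S) (2 * N) (fun x => θ x - θ' x) u (fun x => G x - G' x) := by
  have h2 : ENNReal.ofReal (S ^ 2) ≤ ENNReal.ofReal ((2 * S) ^ 2) :=
    ENNReal.ofReal_le_ofReal (by nlinarith [sq_nonneg S])
  refine ⟨h.grad.sub h'.grad, ?_, by linarith [h.pos], h.memLp_scalar.sub h'.memLp_scalar,
    lintegral_enorm_sub_sq_le h.memLp_scalar.1 h.scalar_le h'.scalar_le,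
    h.memLp_drift, h.drift_le.trans h2, h.div_free⟩
  rw [two_mul]
  exact h.osc.sub h'.osc h.pos.le h.pos.le h.grad.2.1.aestronglyMeasurable

/-- The estimate of the tested nonlinearity: the first drift is removed by the divergence free
condition. -/
lemma enorm_integral_nonlinear_le (h : RegularAt S N θ u G) (h' : RegularAt S N θ' u' G')
    (hS : 0 ≤ S) {β : ℝ → ℝ} (hβ : ContDiff ℝ ∞ β) {k D : ℝ} (hk : ∀ s, |deriv β s| ≤ k)
    (hβ1 : ∀ s, |deriv β s| ≤ |s|) (hβ2 : ∀ s, |β s| ≤ k * |s|) {χ : E n → ℝ}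
    (hχ : ContDiff ℝ ∞ χ) (hc : HasCompactSupport χ) (hχ0 : ∀ x, 0 ≤ χ x) (hχ1 : ∀ x, χ x ≤ 1)
    (hD : ∀ x, ‖fderiv ℝ χ x‖ ≤ D) :
    ‖∫ x, χ x * (deriv β (θ x - θ' x) * (inner ℝ (G x) (u x) - inner ℝ (G' x) (u' x)))‖ₑ ≤
      ENNReal.ofReal (k * D * (2 * S) ^ 2) +
        ∫⁻ x, ‖θ x - θ' x‖ₑ * ‖u x - u' x‖ₑ * ‖G' x‖ₑ := by
  have hw := h.sub h'
  have hk0 : 0 ≤ k := (abs_nonneg _).trans (hk 0)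
  have hD0 : 0 ≤ D := (norm_nonneg _).trans (hD 0)
  have hβc : Continuous (deriv β) := hβ.continuous_deriv (by simp)
  have hθm : AEStronglyMeasurable (fun x => θ x - θ' x) volume := hw.memLp_scalar.1
  have hGm := h.grad.2.1.aestronglyMeasurable
  have hG'm := h'.grad.2.1.aestronglyMeasurable
  obtain ⟨R, hR⟩ := hc.isCompact.isBounded.subset_closedBall (0 : E n)
  have hint : ∀ {g v : E n → E n}, IntegrableOn (fun x => inner ℝ (g x) (v x))
      (closedBall 0 (max R 1)) volume →
      Integrable (fun x => χ x * (deriv β (θ x - θ' x) * inner ℝ (g x) (v x))) volume := by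
    intro g v hgv
    have h1 : IntegrableOn (fun x => χ x * (deriv β (θ x - θ' x) * inner ℝ (g x) (v x)))
        (closedBall 0 (max R 1)) volume := by
      refine Integrable.bdd_mul (c := 1) (Integrable.bdd_mul (c := k) hgv
        (hβc.comp_aestronglyMeasurable hθm).restrict (Eventually.of_forall fun x => hk _))
        hχ.continuous.aestronglyMeasurable (Eventually.of_forall fun x => ?_)
      rw [Real.norm_eq_abs, abs_of_nonneg (hχ0 x)]; exact hχ1 x
    rwa [integrableOn_iff_integrable_of_support_subset] at h1
    intro x hx
    exact closedBall_subset_closedBall (le_max_left _ _) (hR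
      (subset_tsupport _ (left_ne_zero_of_mul hx)))
  have hS2 : 0 ≤ 2 * S := by linarith
  -- The second scalar with the first drift, so that the mixed product `G' · u` is integrable on
  -- balls.
  have h'2 : RegularAt S N θ' u G' := ⟨h'.grad, h'.osc, h'.pos, h'.memLp_scalar, h'.scalar_le,
    h.memLp_drift, h.drift_le, h.div_free⟩
  have i1 := hint (hw.integrableOn_inner hS2 (le_max_right R 1))
  have i3 : IntegrableOn (fun x => inner ℝ (G' x) (u x - u' x)) (closedBall 0 (max R 1)) volume := by
    simp only [inner_sub_right]
    exact (h'2.integrableOn_inner hS (le_max_right R 1)).sub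
      (h'.integrableOn_inner hS (le_max_right R 1))
  have i2 := hint i3
  -- The splitting `G · u - G' · u' = (G - G') · u + G' · (u - u')`.
  have e1 : ∀ x, χ x * (deriv β (θ x - θ' x) * (inner ℝ (G x) (u x) - inner ℝ (G' x) (u' x))) =
      χ x * (deriv β (θ x - θ' x) * inner ℝ (G x - G' x) (u x)) +
        χ x * (deriv β (θ x - θ' x) * inner ℝ (G' x) (u x - u' x)) := fun x => by
    rw [inner_sub_left, inner_sub_right]; ring
  simp_rw [e1]
  rw [integral_add i1 i2]
  refine (enorm_add_le _ _).trans (add_le_add ?_ ?_)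
  -- The transport part leaves only the derivative of the cutoff, whose contribution is small for
  -- large cutoffs.
  · have h1 := hw.div_free.integral_mul_deriv_comp hw.memLp_drift hw.grad hw.memLp_scalar
      (hw.memLp_grad hS2) hβ hk hχ hc
    rw [h1, enorm_neg]
    calc _ ≤ ∫⁻ x, ‖β (θ x - θ' x) * fderiv ℝ χ x (u x)‖ₑ := enorm_integral_le_lintegral_enorm _
      _ ≤ ∫⁻ x, ENNReal.ofReal (k * D) * (‖θ x - θ' x‖ₑ * ‖u x‖ₑ) := by
          refine lintegral_mono fun x => ?_
          simp only [← ofReal_norm]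
          rw [← ENNReal.ofReal_mul (norm_nonneg _), ← ENNReal.ofReal_mul (by positivity), norm_mul]
          refine ENNReal.ofReal_le_ofReal ?_
          calc _ ≤ k * ‖θ x - θ' x‖ * (D * ‖u x‖) :=
                mul_le_mul (hβ2 _) (((fderiv ℝ χ x).le_opNorm _).trans (by gcongr; exact hD x))
                  (norm_nonneg _) (by positivity)
            _ = _ := by ring
      _ = ENNReal.ofReal (k * D) * ∫⁻ x, ‖θ x - θ' x‖ₑ * ‖u x‖ₑ :=
          lintegral_const_mul' _ _ ENNReal.ofReal_ne_top
      _ ≤ ENNReal.ofReal (k * D) * ((ENNReal.ofReal ((2 * S) ^ 2)) ^ (1 / 2 : ℝ) *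
            (ENNReal.ofReal ((2 * S) ^ 2)) ^ (1 / 2 : ℝ)) := by
          gcongr
          refine (lintegral_mul_le_sqrt hθm.enorm hw.memLp_drift.1.enorm).trans ?_
          gcongr
          · exact hw.scalar_le
          · exact hw.drift_le
      _ = _ := by
          rw [ENNReal.ofReal_rpow_of_nonneg (by positivity) (by norm_num), ← Real.sqrt_eq_rpow,
            Real.sqrt_sq hS2, ← ENNReal.ofReal_mul hS2, ← ENNReal.ofReal_mul (by positivity)]
          congr 1; ring
  · refine (enorm_integral_le_lintegral_enorm _).trans (lintegral_mono fun x => ?_)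
    simp only [← ofReal_norm]
    rw [← ENNReal.ofReal_mul (norm_nonneg _), ← ENNReal.ofReal_mul (by positivity), norm_mul,
      norm_mul]
    refine ENNReal.ofReal_le_ofReal ?_
    calc _ ≤ 1 * (‖θ x - θ' x‖ * (‖G' x‖ * ‖u x - u' x‖)) := by
          refine mul_le_mul ?_ (mul_le_mul (hβ1 _) (norm_inner_le_norm _ _) (norm_nonneg _)
            (norm_nonneg _)) (by positivity) zero_le_one
          rw [Real.norm_eq_abs, abs_of_nonneg (hχ0 x)]; exact hχ1 x
      _ = _ := by ring

end RegularAt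

lemma MemL2Loc.locInt {n : ℕ} {T : ℝ} {θ : ℝ → E n → ℝ} (h : MemL2Loc T θ) : LocInt T θ :=
  fun R _ => by
    have : IsFiniteMeasure (volume.restrict (closedBall (0 : E n) R)) :=
      ⟨by rw [Measure.restrict_apply_univ]; exact measure_closedBall_lt_top⟩
    exact (h _ (isCompact_closedBall 0 R)).integrable one_le_two

lemma IsRegular.locInt_inner {n : ℕ} {T S : ℝ} {N : ℝ → ℝ} {θ : ℝ → E n → ℝ}
    {u G : ℝ → E n → E n} (h : IsRegular T S N θ u G) :
    LocInt T (fun t x => inner ℝ (G t x) (u t x)) := fun R hR => by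
  have hle : (volume.restrict (Ioo 0 T)).prod (volume.restrict (closedBall (0 : E n) R)) ≤
      (volume.restrict (Ioo 0 T)).prod volume := Measure.prod_mono le_rfl Measure.restrict_le_self
  have hm : AEStronglyMeasurable (Function.uncurry fun t x => inner ℝ (G t x) (u t x))
      ((volume.restrict (Ioo 0 T)).prod (volume.restrict (closedBall (0 : E n) R))) :=
    (h.meas_grad.mono_measure hle).inner (h.meas_drift.mono_measure hle)
  refine ⟨hm, ?_⟩
  rw [HasFiniteIntegral, lintegral_prod _ hm.enorm]
  have hi : IntegrableOn (fun t => Real.sqrt (gradConst n R) * S * (N t + S)) (Ioo 0 T) :=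
    (h.integrableOn.add (integrable_const S)).const_mul _
  refine lt_of_le_of_lt ?_ hi.2
  refine lintegral_mono_ae ?_
  filter_upwards [h.ae_regular] with t ht
  exact (ht.lintegral_inner_le h.nonneg hR).trans (Real.ofReal_le_enorm _)

lemma tendsto_logTrunc_lower (s : ℝ) :
    Tendsto (fun k : ℕ => s ^ 2 / 2 * (1 + s ^ 2 / ((k : ℝ) + 1) ^ 2)⁻¹) atTop (𝓝 (s ^ 2 / 2)) := by
  have h1 : Tendsto (fun k : ℕ => ((k : ℝ) + 1)) atTop atTop :=
    tendsto_atTop_add_const_right _ _ tendsto_natCast_atTop_atTop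
  have h2 : Tendsto (fun k : ℕ => s ^ 2 / ((k : ℝ) + 1) ^ 2) atTop (𝓝 0) :=
    ((tendsto_pow_atTop two_ne_zero).comp h1).const_div_atTop _
  have h3 : Tendsto (fun k : ℕ => (1 + s ^ 2 / ((k : ℝ) + 1) ^ 2)⁻¹) atTop (𝓝 (1 + 0)⁻¹) :=
    (h2.const_add 1).inv₀ (by norm_num)
  simpa using h3.const_mul (s ^ 2 / 2)

/-- The energy estimate for the difference of two weak solutions. -/
lemma IsWeakSolution.lintegral_sq_sub_le {n : ℕ} {m : E n → EuclideanSpace ℂ (Fin n)} {T S : ℝ}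
    (hT : 0 < T) {N : ℝ → ℝ} {θ₀ : E n → ℝ} {θ θ' : ℝ → E n → ℝ} {u u' G G' : ℝ → E n → E n}
    (h : IsWeakSolution m T θ₀ θ u) (h' : IsWeakSolution m T θ₀ θ' u')
    (hr : IsRegular T S N θ u G) (hr' : IsRegular T S N θ' u' G') :
    ∀ᵐ t ∂(volume.restrict (Ioo 0 T)), ∫⁻ x, ‖θ t x - θ' t x‖ₑ ^ 2 ≤
      2 * ∫⁻ v in Ioo 0 t, ∫⁻ x, ‖θ v x - θ' v x‖ₑ * ‖u v x - u' v x‖ₑ * ‖G' v x‖ₑ := by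
  set w : ℝ → E n → ℝ := fun t x => θ t x - θ' t x with hw
  set H : ℝ → E n → ℝ := fun t x => inner ℝ (G t x) (u t x) - inner ℝ (G' t x) (u' t x) with hH
  have hwl : LocInt T w := h.memL2Loc_scalar.locInt.sub h'.memL2Loc_scalar.locInt
  have hHl : LocInt T H := hr.locInt_inner.sub hr'.locInt_inner
  -- The common initial datum cancels in the difference, so `w` starts from zero.
  have heq : ∀ᵐ t ∂(volume.restrict (Ioo 0 T)), ∀ᵐ x, w t x = -∫ v in 0..t, H v x := by
    refine hwl.ae_eq_neg_integral hT hHl ?_ fun A ψ hA hAc hAT hψ hψc => ?_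
    · filter_upwards [hr.ae_regular, hr'.ae_regular] with t ht ht'
      exact ht.grad.1.sub ht'.grad.1
    · have e1 := h.integral_tensor hr hA hAc hAT hψ hψc
      have e2 := h'.integral_tensor hr' hA hAc hAT hψ hψc
      obtain ⟨C₀, hC₀⟩ := hAc.exists_bound_of_continuous hA.continuous
      have hA'c : Continuous (deriv A) := hA.continuous_deriv (by simp)
      obtain ⟨C₁, hC₁⟩ := hAc.deriv.exists_bound_of_continuous hA'c
      have hi : ∀ {f g : ℝ → E n → ℝ}, LocInt T f → LocInt T g →
          IntegrableOn (fun t => (∫ x, ψ x * f t x) * deriv A t - (∫ x, ψ x * g t x) * A t)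
            (Ioo 0 T) := fun hf hg =>
        (Integrable.mul_bdd (hf.integrable_mul hψ.continuous hψc).integral_prod_left
          hA'c.aestronglyMeasurable (Eventually.of_forall hC₁)).sub
        (Integrable.mul_bdd (hg.integrable_mul hψ.continuous hψc).integral_prod_left
          hA.continuous.aestronglyMeasurable (Eventually.of_forall hC₀))
      have j1 := hi h.memL2Loc_scalar.locInt hr.locInt_inner
      have j2 := hi h'.memL2Loc_scalar.locInt hr'.locInt_inner
      have e3 := integral_sub j1 j2
      refine Eq.trans (integral_congr_ae ?_) (e3.trans (by linarith))
      filter_upwards [hr.ae_regular, hr'.ae_regular,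
        (hr.locInt_inner.integrable_mul hψ.continuous hψc).prod_right_ae,
        (hr'.locInt_inner.integrable_mul hψ.continuous hψc).prod_right_ae] with t ht ht' i1 i2
      have i3 : Integrable (fun x => ψ x * θ t x) volume :=
        continuous_integrable_mul ht.grad.1 hψ.continuous hψc
      have i4 : Integrable (fun x => ψ x * θ' t x) volume :=
        continuous_integrable_mul ht'.grad.1 hψ.continuous hψc
      simp only [hw, hH, mul_sub]
      rw [integral_sub i3 i4, integral_sub i1 i2]
      ring
  obtain ⟨C, hC, hcut⟩ := exists_cutoff n
  -- The cutoff radius is the square of the truncation level `k + 1`, so the cutoff error, of size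
  -- level over radius, is `O(1 / (k + 1))`.
  choose χ hχs hχc hχ0 hχ1 hχR hχD using fun k : ℕ =>
    hcut (((k : ℝ) + 1) ^ 2) (by positivity)
  have hk : ∀ k : ℕ, (0 : ℝ) < (k : ℝ) + 1 := fun k => by positivity
  have hsteps := fun k : ℕ => hwl.integral_comp hHl heq (logTrunc_contDiff (k := (k : ℝ) + 1))
    (logTrunc_zero _) (abs_deriv_logTrunc_le (hk k)) (hχs k).continuous (hχc k)
  filter_upwards [ae_all_iff.2 hsteps, hr.ae_regular, hr'.ae_regular, ae_restrict_mem measurableSet_Ioo]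
    with t hst hrt hrt' htm
  set B := ∫⁻ v in Ioo 0 t, ∫⁻ x, ‖θ v x - θ' v x‖ₑ * ‖u v x - u' v x‖ₑ * ‖G' v x‖ₑ with hB
  have hsub : Ioc 0 t ⊆ Ioo 0 T := fun v hv => ⟨hv.1, hv.2.trans_lt htm.2⟩
  have hwm : AEStronglyMeasurable (w t) volume := hrt.memLp_scalar.1.sub hrt'.memLp_scalar.1
  have hbound : ∀ k : ℕ, ∫⁻ x, ENNReal.ofReal (χ k x * logTrunc ((k : ℝ) + 1) (w t x)) ≤
      ENNReal.ofReal (C * (2 * S) ^ 2 * t / ((k : ℝ) + 1)) + B := fun k => by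
    have hnn : ∀ x, 0 ≤ χ k x * logTrunc ((k : ℝ) + 1) (w t x) := fun x =>
      mul_nonneg (hχ0 k x) (logTrunc_nonneg _ _)
    have hint : Integrable (fun x => χ k x * logTrunc ((k : ℝ) + 1) (w t x)) volume := by
      have hl : LocallyIntegrable (fun x => logTrunc ((k : ℝ) + 1) (w t x)) volume := by
        refine ((hrt.grad.1.sub hrt'.grad.1).smul ((k : ℝ) + 1)).mono
          (logTrunc_contDiff.continuous.comp_aestronglyMeasurable hwm) (Eventually.of_forall fun x => ?_)
        simp only [Pi.smul_apply, Pi.sub_apply, smul_eq_mul, norm_mul, Real.norm_eq_abs]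
        rw [abs_of_pos (hk k)]
        exact abs_logTrunc_le (hk k) _
      exact continuous_integrable_mul hl (hχs k).continuous (hχc k)
    rw [← ofReal_integral_eq_lintegral_ofReal hint (Eventually.of_forall hnn), hst k]
    refine (Real.ofReal_le_enorm _).trans ?_
    rw [enorm_neg]
    refine (enorm_integral_le_lintegral_enorm _).trans ?_
    calc _ ≤ ∫⁻ v in Ioc 0 t, (ENNReal.ofReal ((k + 1) * (C / ((k : ℝ) + 1) ^ 2) * (2 * S) ^ 2) +
          ∫⁻ x, ‖θ v x - θ' v x‖ₑ * ‖u v x - u' v x‖ₑ * ‖G' v x‖ₑ) := by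
          refine lintegral_mono_ae ?_
          filter_upwards [ae_restrict_of_ae_restrict_of_subset hsub hr.ae_regular,
            ae_restrict_of_ae_restrict_of_subset hsub hr'.ae_regular] with v hv hv'
          exact hv.enorm_integral_nonlinear_le hv' hr.nonneg logTrunc_contDiff
            (abs_deriv_logTrunc_le (hk k)) (abs_deriv_logTrunc_le_abs (hk k)) (abs_logTrunc_le (hk k))
            (hχs k) (hχc k) (hχ0 k) (hχ1 k) (hχD k)
      _ = ENNReal.ofReal ((k + 1) * (C / ((k : ℝ) + 1) ^ 2) * (2 * S) ^ 2) * ENNReal.ofReal t + B := by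
          rw [lintegral_add_left measurable_const, lintegral_const, Measure.restrict_apply_univ,
            Real.volume_Ioc, sub_zero, hB, restrict_Ioo_eq_restrict_Ioc]
      _ = _ := by
          rw [← ENNReal.ofReal_mul (by positivity)]
          congr 2
          have := (hk k).ne'
          field_simp
  -- Fatou's lemma removes cutoff and truncation together.
  have hfatou : ∫⁻ x, ENNReal.ofReal (w t x ^ 2 / 2) ≤ B := by
    calc _ ≤ ∫⁻ x, liminf (fun k : ℕ => ENNReal.ofReal (χ k x * logTrunc ((k : ℝ) + 1) (w t x))) atTop := by
          refine lintegral_mono fun x => ?_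
          have h1 := ENNReal.tendsto_ofReal (tendsto_logTrunc_lower (w t x))
          rw [← h1.liminf_eq]
          refine liminf_le_liminf ?_
          obtain ⟨j, hj⟩ := exists_nat_ge ‖x‖
          filter_upwards [eventually_ge_atTop j] with k hkj
          refine ENNReal.ofReal_le_ofReal ?_
          rw [hχR k x, one_mul]
          · exact le_logTrunc (hk k) _
          · have : (j : ℝ) ≤ k := by exact_mod_cast hkj
            have h0 : (0 : ℝ) ≤ j := Nat.cast_nonneg j
            nlinarith
      _ ≤ liminf (fun k : ℕ => ∫⁻ x, ENNReal.ofReal (χ k x * logTrunc ((k : ℝ) + 1) (w t x))) atTop :=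
          lintegral_liminf_le' fun k => ((hχs k).continuous.aestronglyMeasurable.mul
            (logTrunc_contDiff.continuous.comp_aestronglyMeasurable hwm)).aemeasurable.ennreal_ofReal
      _ ≤ liminf (fun k : ℕ => ENNReal.ofReal (C * (2 * S) ^ 2 * t / ((k : ℝ) + 1)) + B) atTop :=
          liminf_le_liminf (Eventually.of_forall hbound)
      _ = B := by
          refine Tendsto.liminf_eq ?_
          have h1 : Tendsto (fun k : ℕ => C * (2 * S) ^ 2 * t / ((k : ℝ) + 1)) atTop (𝓝 0) :=
            (tendsto_atTop_add_const_right _ _ tendsto_natCast_atTop_atTop).const_div_atTop _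
          simpa using (ENNReal.tendsto_ofReal h1).add_const B
  calc ∫⁻ x, ‖w t x‖ₑ ^ 2 = ∫⁻ x, 2 * ENNReal.ofReal (w t x ^ 2 / 2) := by
        refine lintegral_congr fun x => ?_
        rw [← ofReal_norm, ← ENNReal.ofReal_pow (norm_nonneg _), Real.norm_eq_abs, sq_abs,
          ← ENNReal.ofReal_ofNat, ← ENNReal.ofReal_mul (by norm_num)]
        congr 1; ring
    _ = 2 * ∫⁻ x, ENNReal.ofReal (w t x ^ 2 / 2) := lintegral_const_mul' _ _ (by simp)
    _ ≤ 2 * B := by gcongr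

lemma IsRegular.mono {n : ℕ} {T S S' : ℝ} {N N' : ℝ → ℝ} {θ : ℝ → E n → ℝ}
    {u G : ℝ → E n → E n} (h : IsRegular T S N θ u G) (hS : S ≤ S')
    (hN' : IntegrableOn N' (Ioo 0 T))
    (hN : ∀ᵐ t ∂(volume.restrict (Ioo 0 T)), N t ≤ N' t) : IsRegular T S' N' θ u G := by
  refine ⟨h.nonneg.trans hS, hN', h.meas_scalar, h.meas_drift, h.meas_grad, ?_⟩
  filter_upwards [h.ae_regular, hN] with t h1 h2
  exact h1.mono h.nonneg hS h2

/-! ### Conclusion by the Osgood criterion. -/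

/-- Two weak solutions in the uniqueness class have the same scalar at almost every time. -/
lemma IsWeakSolution.ae_lintegral_sq_sub_eq_zero {n : ℕ} (hn : 1 ≤ n)
    {m : E n → EuclideanSpace ℂ (Fin n)} (hm : IsOrderZeroSymbol m) {T S : ℝ}
    (hT : 0 < T) {N : ℝ → ℝ} {θ₀ : E n → ℝ} {θ θ' : ℝ → E n → ℝ} {u u' G G' : ℝ → E n → E n}
    (h : IsWeakSolution m T θ₀ θ u) (h' : IsWeakSolution m T θ₀ θ' u')
    (hr : IsRegular T S N θ u G) (hr' : IsRegular T S N θ' u' G') :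
    ∀ᵐ t ∂(volume.restrict (Ioo 0 T)), ∫⁻ x, ‖θ t x - θ' t x‖ₑ ^ 2 = 0 := by
  obtain ⟨C, hC⟩ := hm.exists_bound
  have hlc := levelConst_pos n
  -- The `2` comes from the energy estimate and `n * C ^ 2` from Plancherel. In the kernel, `2 * |N
  -- τ|` is the oscillation bound of the difference of the gradients.
  set c₀ : ℝ := 2 * (1 + n * C ^ 2 + levelConst n * 10 ^ (n + 2)) with hc₀
  have hc₀0 : 0 ≤ c₀ := by positivity
  have hκi : IntervalIntegrable (fun τ => c₀ * (2 * |N τ|)) volume 0 T :=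
    (intervalIntegrable_iff_integrableOn_Ioo_of_le hT.le).2
      ((hr.integrableOn.abs.const_mul 2).const_mul c₀)
  -- `5 * S ^ 2` is `(2 * S) ^ 2` for the difference plus `S ^ 2` for the second scalar.
  refine ae_eq_zero_of_osgood hT hκi (fun τ => by positivity) (K := 5 * S ^ 2) (c := jnRate n / 2)
    (by positivity) (by have := jnRate_pos n; positivity) ?_ ?_
  · filter_upwards [hr.ae_regular, hr'.ae_regular] with t ht ht'
    refine (ht.sub ht').scalar_le.trans (ENNReal.ofReal_le_ofReal ?_)
    nlinarith [sq_nonneg S]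
  · filter_upwards [h.lintegral_sq_sub_le hT h' hr hr', ae_restrict_mem measurableSet_Ioo]
      with t ht htm L hL
    have hsub : Ioo 0 t ⊆ Ioo 0 T := Ioo_subset_Ioo_right htm.2.le
    refine ht.trans ?_
    rw [← lintegral_const_mul' _ _ (by simp)]
    refine lintegral_mono_ae ?_
    filter_upwards [ae_restrict_of_ae_restrict_of_subset hsub hr.ae_regular,
      ae_restrict_of_ae_restrict_of_subset hsub hr'.ae_regular,
      ae_restrict_of_ae_restrict_of_subset hsub h.drift_eq,
      ae_restrict_of_ae_restrict_of_subset hsub h'.drift_eq] with v hv hv' hd hd'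
    have hw := hv.sub hv'
    have hN0 := hv.pos
    have h1 := lintegral_nonlinear_le hw.grad hv'.grad hw.memLp_scalar.integrable_sq
      hv'.memLp_scalar.integrable_sq hw.pos hw.osc (hv'.osc.mono (by linarith))
      (hv.memLp_drift.1.sub hv'.memLp_drift.1) (M := n * C ^ 2) (by positivity)
      ((hd.sub hd').lintegral_le hC hn) hL
    have hK : ∫ x, ((θ v x - θ' v x) ^ 2 + θ' v x ^ 2) ≤ 5 * S ^ 2 := by
      rw [integral_add hw.memLp_scalar.integrable_sq hv'.memLp_scalar.integrable_sq]
      have e1 := integral_sq_le_of_lintegral_le hw.memLp_scalar (sq_nonneg _) hw.scalar_le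
      have e2 := integral_sq_le_of_lintegral_le hv'.memLp_scalar (sq_nonneg _) hv'.scalar_le
      linarith
    calc _ ≤ 2 * _ := mul_le_mul' le_rfl h1
      _ ≤ 2 * (ENNReal.ofReal ((1 + n * C ^ 2 + levelConst n * 10 ^ (n + 2)) * (2 * N v)) *
          (ENNReal.ofReal (L + 1) * (∫⁻ y, ‖θ v y - θ' v y‖ₑ ^ 2) +
          ENNReal.ofReal (Real.exp (-(jnRate n / 2 * L)) * (5 * S ^ 2)))) := by gcongr
      _ = _ := by
          have e : ENNReal.ofReal (c₀ * (2 * |N v|)) = 2 * ENNReal.ofReal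
              ((1 + n * C ^ 2 + levelConst n * 10 ^ (n + 2)) * (2 * N v)) := by
            rw [← ENNReal.ofReal_ofNat, ← ENNReal.ofReal_mul (by norm_num), abs_of_pos hN0, hc₀]
            congr 1; ring
          rw [e, mul_assoc]

/-- Functions agreeing in `L²` at almost every time agree almost everywhere. -/
lemma uncurry_ae_eq_of_lintegral_sq_eq_zero {n : ℕ} {F : Type*} [NormedAddCommGroup F] {T : ℝ}
    {f f' : ℝ → E n → F}
    (hf : AEStronglyMeasurable (Function.uncurry f) ((volume.restrict (Ioo 0 T)).prod volume))
    (hf' : AEStronglyMeasurable (Function.uncurry f') ((volume.restrict (Ioo 0 T)).prod volume))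
    (h : ∀ᵐ t ∂(volume.restrict (Ioo 0 T)), ∫⁻ x, ‖f t x - f' t x‖ₑ ^ 2 = 0) :
    Function.uncurry f =ᵐ[(volume.restrict (Ioo 0 T)).prod volume] Function.uncurry f' := by
  have hm := (hf.sub hf').enorm.pow_const 2
  have h1 : ∫⁻ z, ‖(Function.uncurry f - Function.uncurry f') z‖ₑ ^ 2
      ∂((volume.restrict (Ioo 0 T)).prod volume) = 0 := by
    rw [lintegral_prod _ hm]
    exact (lintegral_congr_ae h).trans lintegral_zero
  filter_upwards [(lintegral_eq_zero_iff' hm).1 h1] with z hz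
  simpa [sub_eq_zero] using hz

end ActiveScalar

end

theorem theorem3p2 (n : ℕ) (hn : 1 ≤ n)
    (m : ActiveScalar.E n → EuclideanSpace ℂ (Fin n)) (hm : ActiveScalar.IsOrderZeroSymbol m)
    (T : ℝ) (hT : 0 < T)
    (p q : ℝ) (hp : 2 < p) (hq : 2 < q)
    (s : ℝ≥0∞) (hs : ENNReal.ofReal (q / (q - 2)) < s)
    (θ₀ : ActiveScalar.E n → ℝ)
    (θ₁ θ₂ : ℝ → ActiveScalar.E n → ℝ) (u₁ u₂ : ℝ → ActiveScalar.E n → ActiveScalar.E n)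
    (hsol₁ : ActiveScalar.IsWeakSolution m T θ₀ θ₁ u₁)
    (hsol₂ : ActiveScalar.IsWeakSolution m T θ₀ θ₂ u₂)
    (hcls₁ : ActiveScalar.InUniquenessClass T (ENNReal.ofReal p) (ENNReal.ofReal q) s θ₁)
    (hcls₂ : ActiveScalar.InUniquenessClass T (ENNReal.ofReal p) (ENNReal.ofReal q) s θ₂) :
    Function.uncurry θ₁ =ᵐ[(volume.restrict (Ioo 0 T)).prod volume] Function.uncurry θ₂ ∧
      Function.uncurry u₁ =ᵐ[(volume.restrict (Ioo 0 T)).prod volume] Function.uncurry u₂ := by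
  have hs1 : 1 ≤ s := by
    refine le_trans ?_ hs.le
    rw [← ENNReal.ofReal_one]
    refine ENNReal.ofReal_le_ofReal ?_
    rw [le_div_iff₀ (by linarith)]
    linarith
  obtain ⟨S₁, N₁, G₁, hr₁⟩ := hsol₁.exists_isRegular hn hm hs1 hcls₁
  obtain ⟨S₂, N₂, G₂, hr₂⟩ := hsol₂.exists_isRegular hn hm hs1 hcls₂
  -- Sums serve as bounds common to both solutions.
  have hN := hr₁.integrableOn.add hr₂.integrableOn
  have hr₁' := hr₁.mono (le_add_of_nonneg_right hr₂.nonneg) hN (by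
    filter_upwards [hr₂.ae_regular] with t ht
    exact le_add_of_nonneg_right ht.pos.le)
  have hr₂' := hr₂.mono (le_add_of_nonneg_left hr₁.nonneg) hN (by
    filter_upwards [hr₁.ae_regular] with t ht
    exact le_add_of_nonneg_left ht.pos.le)
  have hθ := hsol₁.ae_lintegral_sq_sub_eq_zero hn hm hT hsol₂ hr₁' hr₂'
  refine ⟨ActiveScalar.uncurry_ae_eq_of_lintegral_sq_eq_zero hr₁.meas_scalar hr₂.meas_scalar hθ,
    ActiveScalar.uncurry_ae_eq_of_lintegral_sq_eq_zero hr₁.meas_drift hr₂.meas_drift ?_⟩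
  obtain ⟨C, hC⟩ := hm.exists_bound
  filter_upwards [hθ, hsol₁.drift_eq, hsol₂.drift_eq] with t ht h₁ h₂
  -- The drifts agree because their difference is the multiplier image of zero.
  have h := (h₁.sub h₂).lintegral_le hC hn
  rw [ht, mul_zero] at h
  exact le_antisymm h zero_le
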